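/- **Conventions.** A *black box group* $X$ encrypting a finite group $G$ consists of a set of $0$–$1$ strings of one fixed length $l(X)$, a projection $\pi$ of this set onto $G$ (not assumed computable; an element may be encrypted by several strings), and an oracle which (i) returns random independent strings encrypting almost uniformly distributed elements of $G$ (total variation distance $\delta_X\le 1/4$ from uniform), (ii) returns a string encrypting the product of two elements, or the inverse of an element, given by strings, (iii) decides whether two strings encrypt the same element; moreover a global exponent $E\geq 1$ is given, with $g^E=1$ for all $g\in G$. As always for black box groups, polynomial bounds are fixed for the family under consideration: for some polynomial $Q$, $l(X)\le Q(\lfloor\log_2|G|\rfloor)$ and $\lfloor\log_2 E\rfloor\le Q(l(X))$. Algorithms are fixed randomised programs operating on bit strings, with access to the oracle; running time is the number of steps, each oracle query being one step. A *black box field* $\mathbb U$ encrypting a finite field $F$ consists, similarly, of strings of one fixed length which encrypt the elements of $F$, with procedures for $0$, $1$, $x+y$, $-x$, $xy$, $x^{-1}$ ($x\neq0$), for comparison, and for generation of almost uniformly distributed random elements. The strings of $\mathrm{SL}_2(\mathbb U)$ are quadruples of strings of $\mathbb U$ encrypting the entries of a matrix in $\mathrm{SL}_2(F)$. **Theorem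 (recognition of $\mathrm{SL}_2(2^n)$ given an involution).** There is a Monte-Carlo algorithm with the following property. For every polynomial $Q$ there is a polynomial $p$ such that the following holds for every $n\ge 1$, every black box group $X$ encrypting $G=\mathrm{SL}_2(\mathbb F_{2^n})$ and satisfying the bounds given by $Q$, every string $r$ of $X$ encrypting an involution $\rho\in G$, and every $k\in\mathbb N$. Given $E$, $r$ and $k$, but not $n$, and the oracle of $X$, the algorithm always halts within $p(l(X)+k)$ steps, and with probability at least $1-2^{-k}$ it constructs * a black box field $\mathbb U$ encrypting $\mathbb F_{2^n}$, whose operations always return correct answers and take at most $p(l(X))$ steps, and whose random generation takes at most $p(l(X))$ steps and is within total variation distance $\delta_X$ of uniform; and * an isomorphism $\Phi:\mathrm{SL}_2(\mathbb U)\to X$ computable in at most $p(l(X))$ steps, that is, a procedure which for some abstract group isomorphism $\beta:\mathrm{SL}_2(\mathbb F_{2^n})\to G$ always takes a string encrypting a matrix $g$ to a string of $X$ encrypting $\beta(g)$. Moreover $\mathbb U$ is interpreted in the Borel subgroup $B=N_G(U)$, $U=C_G(\rho)$, acting by conjugation on the unipotent subgroup $U$: there are an isomorphism $u:(\mathbb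 F_{2^n},+)\to U$ with $u(1)=\rho$ and a homomorphism $\tau:B\to\mathbb F_{2^n}^{*}$ with kernel $U$ such that $b^{-1}u(x)b=u(x\,\tau(b))$ for all $b\in B$ and $x\in\mathbb F_{2^n}$; the strings of $\mathbb U$ encrypting $x\neq0$ are the pairs of strings of $X$ encrypting some $b\in B$ with $\tau(b)=x$, and $u(x)$; those encrypting $0$ are the pairs encrypting some $b\in U$, and $1$. -/

import Mathlib

open scoped ENNReal MatrixGroups

namespace BlackBox

/-! ### Strings encrypting the elements of a set -/

/-- An encryption of the elements of `α` by `0`-`1` strings of one fixed length `len`.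
`decode` is the canonical projection: `decode x = some g` says that the string `x` encrypts `g`.
An element may be encrypted by many strings, and a string need not encrypt anything.
Nothing is assumed about the computability of `decode`. -/
structure Encryption (α : Type) where
  len : ℕ
  decode : List Bool → Option α
  length_eq : ∀ x g, decode x = some g → x.length = len
  surj : ∀ g, ∃ x, decode x = some g

/-- The random string `μ` always encrypts an element of `α`, and the distribution of that element
is at total variation distance at most `δ` from the uniform distribution on `α`. -/
def Encryption.NearlyUniform {α : Type} (X : Encryption α) (δ : ℝ) (μ : PMF (List Bool)) : Prop :=
  (∀ x ∈ μ.support, ∃ g, X.decode x = some g) ∧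
  ∀ S : Set α, |(μ.toOuterMeasure {x | ∃ g ∈ S, X.decode x = some g}).toReal
    - (S.ncard : ℝ) / (Nat.card α : ℝ)| ≤ δ

/-! ### Black box groups -/

/-- The bare interface of a black box group: a source of random strings, two operations on
strings and a comparison of strings. Answers may themselves be random: when an element is encrypted
by several strings, the box may return any of them. -/
structure Oracle where
  gen : PMF (List Bool)
  mul : List Bool → List Bool → PMF (List Bool)
  inv : List Bool → PMF (List Bool)
  eq : List Bool → List Bool → Bool

/-- A black box group encrypting `G`. The box produces strings encrypting almost uniformly
distributed elements, multiplies and inverts, decides whether two strings encrypt the same element,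
and comes with a global exponent. "Almost uniform" means total variation distance `bias ≤ 1 / 4`;
e.g. it is enough that every `g` has probability between `1 / 2` and `3 / 2` of `1 / |G|`. -/
structure BlackBoxGroup (G : Type) [Group G] extends Encryption G, Oracle where
  bias : ℝ
  bias_le : bias ≤ 1 / 4
  gen_spec : toEncryption.NearlyUniform bias gen
  mul_spec : ∀ x y g h, decode x = some g → decode y = some h →
    ∀ z ∈ (mul x y).support, decode z = some (g * h)
  inv_spec : ∀ x g, decode x = some g → ∀ z ∈ (inv x).support, decode z = some g⁻¹
  eq_spec : ∀ x y g h, decode x = some g → decode y = some h → (eq x y = true ↔ g = h)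
  exponent : ℕ
  exponent_pos : 0 < exponent
  pow_exponent : ∀ g : G, g ^ exponent = 1

/-- The standing size conditions on a family of black box groups, with `Q` the bounding polynomial
of the family: the string length `l(X)` is at most `Q (log |G|)`, and the length of the
global exponent is at most `Q (l(X))`. -/
def BlackBoxGroup.PolyBounded {G : Type} [Group G] (X : BlackBoxGroup G)
    (Q : Polynomial ℕ) : Prop :=
  X.len ≤ Q.eval (Nat.log 2 (Nat.card G)) ∧ Nat.log 2 X.exponent ≤ Q.eval X.len

/-! ### Randomised programs with access to a black box group

A program works on finitely many of the registers `0, 1, 2, …`, each a stack of bits. One step adds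
or removes one bit, tests one bit, tosses one coin, or makes one query to the black box. This is a
multi-stack machine with an oracle, so its step count is polynomially equivalent to the running time
of an oracle Turing machine; as the black box answers in time polynomial in the string length,
it is polynomially equivalent to the total running time as well. A program is a finite
syntactic object which does not depend on the black box it is run with. -/

/-- Contents of the registers; the head of the list is the top of the stack. -/
abbrev Store := ℕ → List Bool

inductive Test where
  | nonempty (a : ℕ)
  | top (a : ℕ)

def Test.eval (s : Store) : Test → Bool
  | .nonempty a => !(s a).isEmpty
  | .top a => (s a).headD false

inductive Prog where
  | skip
  | push (a : ℕ) (b : Bool)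
  | pop (a : ℕ)
  /-- Put a fair random bit on register `a`. -/
  | flip (a : ℕ)
  /-- Fill register `a` with a fresh random string of the black box. -/
  | gen (a : ℕ)
  /-- Query the product of the strings in `a` and `b`; the answer goes to register `c`. -/
  | mul (a b c : ℕ)
  /-- Query the inverse of the string in `a`; the answer goes to register `c`. -/
  | inv (a c : ℕ)
  /-- Query whether the strings in `a` and `b` are equivalent; the one-bit answer goes to `c`. -/
  | eq (a b c : ℕ)
  | seq (P Q : Prog)
  | ite (t : Test) (P Q : Prog)
  | loop (t : Test) (P : Prog)

/-- A configuration: the programs which remain to be executed, and the store. -/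
abbrev Config := List Prog × Store

/-- One step of execution; a configuration with nothing left to execute has halted. -/
noncomputable def step (O : Oracle) : Config → PMF Config
  | ([], s) => PMF.pure ([], s)
  | (.skip :: k, s) => PMF.pure (k, s)
  | (.push a b :: k, s) => PMF.pure (k, Function.update s a (b :: s a))
  | (.pop a :: k, s) => PMF.pure (k, Function.update s a (s a).tail)
  | (.flip a :: k, s) =>
      (PMF.uniformOfFintype Bool).map fun b => (k, Function.update s a (b :: s a))
  | (.gen a :: k, s) => O.gen.map fun z => (k, Function.update s a z)
  | (.mul a b c :: k, s) => (O.mul (s a) (s b)).map fun z => (k, Function.update s c z)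
  | (.inv a c :: k, s) => (O.inv (s a)).map fun z => (k, Function.update s c z)
  | (.eq a b c :: k, s) => PMF.pure (k, Function.update s c [O.eq (s a) (s b)])
  | (.seq P Q :: k, s) => PMF.pure (P :: Q :: k, s)
  | (.ite t P Q :: k, s) => PMF.pure ((if t.eval s then P else Q) :: k, s)
  | (.loop t P :: k, s) => PMF.pure (if t.eval s then P :: .loop t P :: k else k, s)

/-- The distribution of the configuration after `T` steps. -/
noncomputable def run (O : Oracle) : ℕ → Config → PMF Config
  | 0, c => PMF.pure c
  | T + 1, c => (step O c).bind (run O T)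

/-- The initial store for a list of arguments: they stand in registers `0, 1, …`, and all
other registers are empty. -/
def initStore (args : List (List Bool)) : Store := fun i => args.getD i []

/-- The random configuration after `T` steps of `P` on the given arguments. -/
noncomputable def exec (O : Oracle) (P : Prog) (args : List (List Bool)) (T : ℕ) : PMF Config :=
  run O T ([P], initStore args)

/-- On the given arguments every run of `P` halts within `T` steps. -/
def HaltsWithin (O : Oracle) (P : Prog) (args : List (List Bool)) (T : ℕ) : Prop :=
  ∀ c ∈ (exec O P args T).support, c.1 = []

/-- On the given arguments every run of `P` halts within `T` steps, with a string
satisfying `post` in register `0`. -/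
def Computes (O : Oracle) (P : Prog) (args : List (List Bool)) (T : ℕ)
    (post : List Bool → Prop) : Prop :=
  ∀ c ∈ (exec O P args T).support, c.1 = [] ∧ post (c.2 0)

/-! ### The output of a structure recovery algorithm -/

/-- The fixed programs of a structure recovery algorithm. `construct` is run first, on the black
box group; its output is the tuple `d` of strings in registers `0, …, arity - 1`. The other programs
take `d`, followed by their own arguments, as input: they are the operations of the field
black box and the map from `SL₂` of it to the black box group. -/
structure RecoveryAlgorithm where
  construct : Prog
  arity : ℕ
  zero : Prog
  one : Prog
  add : Prog
  neg : Prog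
  mul : Prog
  inv : Prog
  eq : Prog
  gen : Prog
  morphism : Prog

/-- The input of `construct`: the global exponent in binary (least significant bit on top), the
string `r`, and the confidence parameter `k` in unary. -/
def constructInput (E : ℕ) (r : List Bool) (k : ℕ) : List (List Bool) :=
  [Nat.bits E, r, List.replicate k true]

/-- The random tuple of strings which `construct` leaves after `T` steps. -/
noncomputable def RecoveryAlgorithm.output (A : RecoveryAlgorithm) (O : Oracle)
    (input : List (List Bool)) (T : ℕ) : PMF (List (List Bool)) :=
  (exec O A.construct input T).map fun c => (List.range A.arity).map c.2

/-- With the data `d`, the field programs of `A` are a black box field on the strings of `K`,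
encrypting the field `F`: all operations run in at most `T` steps and always
return correct answers, and random generation is within `δ` of uniform. -/
structure IsBlackBoxField {F : Type} [Field F] (O : Oracle) (A : RecoveryAlgorithm)
    (d : List (List Bool)) (K : Encryption F) (δ : ℝ) (T : ℕ) : Prop where
  zero : Computes O A.zero d T fun z => K.decode z = some 0
  one : Computes O A.one d T fun z => K.decode z = some 1
  add : ∀ x y a b, K.decode x = some a → K.decode y = some b →
    Computes O A.add (d ++ [x, y]) T fun z => K.decode z = some (a + b)
  neg : ∀ x a, K.decode x = some a →
    Computes O A.neg (d ++ [x]) T fun z => K.decode z = some (-a)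
  mul : ∀ x y a b, K.decode x = some a → K.decode y = some b →
    Computes O A.mul (d ++ [x, y]) T fun z => K.decode z = some (a * b)
  inv : ∀ x a, K.decode x = some a → a ≠ 0 →
    Computes O A.inv (d ++ [x]) T fun z => K.decode z = some a⁻¹
  eq : ∀ x y a b, K.decode x = some a → K.decode y = some b →
    Computes O A.eq (d ++ [x, y]) T fun z => (z = [true] ∧ a = b) ∨ (z = [false] ∧ a ≠ b)
  gen_halts : HaltsWithin O A.gen d T
  gen_uniform : K.NearlyUniform δ ((exec O A.gen d T).map fun c => c.2 0)

/-- The centralizer `U = C_G(ρ)`. -/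
abbrev cent {G : Type} [Group G] (ρ : G) : Subgroup G := Subgroup.centralizer {ρ}

/-- The normalizer `B = N_G(C_G(ρ))`. -/
abbrev borel {G : Type} [Group G] (ρ : G) : Subgroup G := Subgroup.normalizer (cent ρ : Set G)

/-- The field encrypted by `K` is interpreted in `B = N_G(C_G(ρ))`, acting by conjugation on
`U = C_G(ρ)`: the group `U` is the additive group of the field, with `ρ` as `1`; the group `B / U` is
its multiplicative group; and `B / U` acts on `U` as multiplication. The strings of `K` are
the pairs `(t, s)` of strings of `X` which encrypt `b ∈ B` (standing for its coset modulo `U`) and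
`u ∈ U` with `b⁻¹ ρ b = u`, and, for the zero of the field, those with `b ∈ U` and `u = 1`. -/
def IsInterpretedInBorel {G F : Type} [Group G] [Field F] (X : Encryption G) (ρ : G)
    (K : Encryption F) : Prop :=
  ∃ (unip : Multiplicative F ≃* cent ρ) (tor : borel ρ →* Fˣ),
    (unip (Multiplicative.ofAdd 1) : G) = ρ ∧
    tor.ker = (cent ρ).subgroupOf (borel ρ) ∧
    (∀ (b : borel ρ) (x : F), (b : G)⁻¹ * unip (Multiplicative.ofAdd x) * b
      = unip (Multiplicative.ofAdd (x * tor b))) ∧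
    ∀ (a : List Bool) (x : F), K.decode a = some x ↔
      ∃ (t s : List Bool) (b : borel ρ), a = t ++ s ∧ X.decode t = some (b : G) ∧
        X.decode s = some (unip (Multiplicative.ofAdd x) : G) ∧
        ((x = 0 ∧ (b : G) ∈ cent ρ) ∨ (x ≠ 0 ∧ (tor b : F) = x))

/-- With the data `d`, the program `A.morphism` is an isomorphism from `SL₂` of the black box
field to the black box group: it encrypts a group isomorphism `β`. A string of `SL₂` of
the field is the quadruple of strings encrypting the entries of a matrix of determinant `1`. -/
def IsMorphismIso {F G : Type} [Field F] [Group G] (O : Oracle) (X : Encryption G)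
    (A : RecoveryAlgorithm) (d : List (List Bool)) (K : Encryption F) (T : ℕ) : Prop :=
  ∃ β : SL(2, F) ≃* G, ∀ (g : SL(2, F)) (x₁₁ x₁₂ x₂₁ x₂₂ : List Bool),
    K.decode x₁₁ = some (g.val 0 0) → K.decode x₁₂ = some (g.val 0 1) →
    K.decode x₂₁ = some (g.val 1 0) → K.decode x₂₂ = some (g.val 1 1) →
    Computes O A.morphism (d ++ [x₁₁, x₁₂, x₂₁, x₂₂]) T fun z => X.decode z = some (β g)

/-- The data `d` make the programs of `A` a black box field encrypting `F`, interpreted in the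
Borel subgroup of the involution `ρ`, together with an isomorphism from `SL₂` of that
black box field to `X`, everything running in at most `T` steps. -/
def RecoveryAlgorithm.Recovers {G : Type} [Group G] (A : RecoveryAlgorithm) (F : Type) [Field F]
    (X : BlackBoxGroup G) (ρ : G) (d : List (List Bool)) (T : ℕ) : Prop :=
  ∃ K : Encryption F,
    IsBlackBoxField X.toOracle A d K X.bias T ∧
    IsInterpretedInBorel X.toEncryption ρ K ∧
    IsMorphismIso X.toOracle X.toEncryption A d K T

end BlackBox

/-! In characteristic two, Cayley–Hamilton makes square roots explicit: if `S * S = z` in `SL₂`,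
then `tr(S)² = tr z` and `tr(S) S = z + 1` (`sq_eq_apply`). Elements of nonzero trace have odd
order, so with `E = 2^a (2m + 1)` the power `z ^ (1 + m)` is a square root of such a `z`
(`pow_mul_pow_self`). The black box can therefore extract these roots without knowing `n`.

For involutions `i`, `j` with `i j` of odd order, the root of `i j` conjugates `i` to `j`. `zetaElt`
uses this to correct a random `g` to an element of `U = C(ρ)`. `betaElt` chains two such roots, from
`ρ` through an auxiliary involution `t` to `v` in `U`, and produces a diagonal element of the Borel
subgroup conjugating `ρ` to `v`. So `u(x)` alone determines an element acting on `U` as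
multiplication by `x`: addition is the product in `U`, multiplication is conjugation.

The isomorphism needs an involution `t` with `ρ t` of order three. Up to a change of coordinates
fixing `ρ`, the pair is then `upper 1`, `lower 1` (`IsPartner.exists_equiv`), and `ρ t ρ` is a Weyl
element. A matrix with `c ≠ 0` in the lower left corner is `upper ((a+1)/c) * lower c * upper
((d+1)/c)`, and the divisions by `c` are conjugations by the Borel element belonging to `c`.

To find `t`, a random conjugate of `ρ` is, up to conjugation by `U`, some `lower c`, and
`scaleElt_conj_lower` rescales `c` to `1`. This fails on at most `3/5` of the group
(`ncard_badSet_le`), hence with probability at most `3/5 + 1/4 = 17/20` per trial. Success can be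
verified in the black box, so repetition makes the failure probability exponentially small. Random
field elements come from `sampleField`, which is equivariant for left multiplication by `U`; its
fibres have equal size, and the total variation distance does not grow.

Programs are treated by bounds on failure probabilities that are passed through continuations:
`Runs` for parts whose outcome is certain, `Improves` for the random search. -/

namespace BlackBox

/-! ### A program logic for failure probabilities -/

/-- The probability that after `N` steps from `c` the program has not halted in a store
satisfying `S`. -/
noncomputable def loss (O : Oracle) (N : ℕ) (c : Config) (S : Store → Prop) : ℝ≥0∞ :=
  (run O N c).toOuterMeasure {c' | ¬(c'.1 = [] ∧ S c'.2)}

theorem loss_le_one (O : Oracle) (N : ℕ) (c : Config) (S : Store → Prop) : loss O N c S ≤ 1 := by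
  unfold loss
  rw [PMF.toOuterMeasure_apply]
  calc _ ≤ ∑' x, run O N c x := ENNReal.tsum_le_tsum fun x => Set.indicator_le_self _ _ x
    _ = 1 := PMF.tsum_coe _

theorem loss_succ (O : Oracle) (N : ℕ) (c : Config) (S : Store → Prop) :
    loss O (N + 1) c S = ∑' c', step O c c' * loss O N c' S := by
  simp only [loss, run, PMF.toOuterMeasure_bind_apply]

theorem loss_succ_of_step_eq_pure {O : Oracle} {c c' : Config} (h : step O c = PMF.pure c')
    (N : ℕ) (S : Store → Prop) : loss O (N + 1) c S = loss O N c' S := by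
  simp only [loss, run, h, PMF.pure_bind]

theorem loss_succ_of_step_eq_map {O : Oracle} {c : Config} {p : PMF (List Bool)}
    {f : List Bool → Config} (h : step O c = p.map f) (N : ℕ) (S : Store → Prop) :
    loss O (N + 1) c S = ∑' z, p z * loss O N (f z) S := by
  simp only [loss, run, h, PMF.bind_map, PMF.toOuterMeasure_bind_apply, Function.comp]

theorem tsum_mul_le_of_support {α : Type*} (p : PMF α) (f : α → ℝ≥0∞) (y : ℝ≥0∞)
    (h : ∀ z ∈ p.support, f z ≤ y) : ∑' z, p z * f z ≤ y := by
  calc ∑' z, p z * f z ≤ ∑' z, p z * y := by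
        refine ENNReal.tsum_le_tsum fun z => ?_
        by_cases hz : p z = 0
        · simp [hz]
        · exact mul_le_mul_right (h z ((PMF.mem_support_iff _ _).2 hz)) _
    _ = y := by rw [ENNReal.tsum_mul_right, PMF.tsum_coe, one_mul]

/-- Used for queries to `gen`, where the outcome is controlled only off a set of bad answers. -/
theorem tsum_mul_le_toOuterMeasure_mul {α : Type*} (p : PMF α) (f : α → ℝ≥0∞) (y : ℝ≥0∞)
    (bad : Set α) (h : ∀ z ∈ p.support, z ∉ bad → f z = 0) (h' : ∀ z ∈ p.support, f z ≤ y) :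
    ∑' z, p z * f z ≤ p.toOuterMeasure bad * y := by
  rw [PMF.toOuterMeasure_apply, ← ENNReal.tsum_mul_right]
  refine ENNReal.tsum_le_tsum fun z => ?_
  by_cases hz : p z = 0
  · simp [hz]
  have hz := (PMF.mem_support_iff _ _).2 hz
  by_cases hb : z ∈ bad
  · rw [Set.indicator_of_mem hb]; exact mul_le_mul_right (h' z hz) _
  · simp [h z hz hb]

/-- A halted configuration is fixed by `step`, so success is never lost by running longer. Time
bounds may therefore be rounded up freely. -/
theorem loss_succ_le (O : Oracle) (N : ℕ) (c : Config) (S : Store → Prop) :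
    loss O (N + 1) c S ≤ loss O N c S := by
  induction N generalizing c with
  | zero =>
    by_cases hc : c.1 = [] ∧ S c.2
    · obtain ⟨k, s⟩ := c
      obtain ⟨h1, h2⟩ := hc
      dsimp only at h1
      subst h1
      rw [loss_succ_of_step_eq_pure (c' := ([], s)) rfl]
    · refine (loss_le_one _ _ _ _).trans ?_
      simp only [loss, run, PMF.toOuterMeasure_pure_apply]
      rw [if_pos (show c ∈ {c' : Config | ¬(c'.1 = [] ∧ S c'.2)} from hc)]
  | succ N ih =>
    rw [loss_succ, loss_succ O N]
    exact ENNReal.tsum_le_tsum fun c' => mul_le_mul_right (ih c') _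

theorem loss_anti (O : Oracle) {N N' : ℕ} (h : N ≤ N') (c : Config) (S : Store → Prop) :
    loss O N' c S ≤ loss O N c S := by
  induction h with
  | refl => exact le_rfl
  | step _ ih => exact (loss_succ_le _ _ _ _).trans ih

theorem forall_mem_support_of_loss_eq_zero {O : Oracle} {N : ℕ} {c : Config} {S : Store → Prop}
    (h : loss O N c S = 0) : ∀ c' ∈ (run O N c).support, c'.1 = [] ∧ S c'.2 := by
  intro c' hc'
  by_contra hn
  exact Set.disjoint_left.1 ((PMF.toOuterMeasure_apply_eq_zero_iff _ _).1 h) hc' hn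

/-- Started in the store `s`, the program `P` halts within `T` steps in a store satisfying `post`,
whatever the black box answers. This is phrased by continuations: failure probabilities which are
bounded by `y` for all stores satisfying `post` are bounded by `y` before `P` is run. -/
def Runs (O : Oracle) (P : Prog) (s : Store) (T : ℕ) (post : Store → Prop) : Prop :=
  ∀ (k : List Prog) (N : ℕ) (S : Store → Prop) (y : ℝ≥0∞),
    (∀ s', post s' → loss O N (k, s') S ≤ y) → loss O (T + N) (P :: k, s) S ≤ y

namespace Runs

variable {O : Oracle} {P P' : Prog} {s : Store} {T T' T₁ T₂ : ℕ} {post post' mid : Store → Prop}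

theorem mono (h : Runs O P s T post) (hT : T ≤ T') (hp : ∀ s', post s' → post' s') :
    Runs O P s T' post' := fun k N S y hy =>
  (loss_anti O (Nat.add_le_add_right hT N) _ _).trans (h k N S y fun s' hs' => hy s' (hp s' hs'))

theorem loss_eq_zero (h : Runs O P s T post) : loss O T ([P], s) post = 0 := by
  refine le_antisymm (h [] 0 post 0 fun s' hs' => ?_) (zero_le)
  simp [loss, run, PMF.toOuterMeasure_pure_apply, hs']

theorem computes {args : List (List Bool)} {q : List Bool → Prop}
    (h : Runs O P (initStore args) T fun s' => q (s' 0)) : Computes O P args T q :=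
  forall_mem_support_of_loss_eq_zero h.loss_eq_zero

theorem of_step_eq_pure {s' : Store} (h : ∀ k, step O (P :: k, s) = PMF.pure (k, s'))
    (hp : post s') : Runs O P s 1 post := by
  intro k N S y hy
  rw [Nat.add_comm, loss_succ_of_step_eq_pure (h k)]
  exact hy _ hp

theorem of_step_eq_map {p : PMF (List Bool)} {f : List Bool → Store}
    (h : ∀ k, step O (P :: k, s) = p.map fun z => (k, f z))
    (hp : ∀ z ∈ p.support, post (f z)) : Runs O P s 1 post := by
  intro k N S y hy
  rw [Nat.add_comm, loss_succ_of_step_eq_map (h k)]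
  exact tsum_mul_le_of_support _ _ _ fun z hz => hy _ (hp z hz)

theorem skip (hp : post s) : Runs O .skip s 1 post := of_step_eq_pure (fun _ => rfl) hp

theorem push {a : ℕ} {b : Bool} (hp : post (Function.update s a (b :: s a))) :
    Runs O (.push a b) s 1 post := of_step_eq_pure (fun _ => rfl) hp

theorem pop {a : ℕ} (hp : post (Function.update s a (s a).tail)) :
    Runs O (.pop a) s 1 post := of_step_eq_pure (fun _ => rfl) hp

theorem eq {a b c : ℕ} (hp : post (Function.update s c [O.eq (s a) (s b)])) :
    Runs O (.eq a b c) s 1 post := of_step_eq_pure (fun _ => rfl) hp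

theorem mul {a b c : ℕ} (hp : ∀ z ∈ (O.mul (s a) (s b)).support, post (Function.update s c z)) :
    Runs O (.mul a b c) s 1 post := of_step_eq_map (fun _ => rfl) hp

theorem inv {a c : ℕ} (hp : ∀ z ∈ (O.inv (s a)).support, post (Function.update s c z)) :
    Runs O (.inv a c) s 1 post := of_step_eq_map (fun _ => rfl) hp

theorem seq (h₁ : Runs O P s T₁ mid) (h₂ : ∀ s', mid s' → Runs O P' s' T₂ post) :
    Runs O (.seq P P') s (1 + T₁ + T₂) post := by
  intro k N S y hy
  rw [show 1 + T₁ + T₂ + N = T₁ + (T₂ + N) + 1 by ring, loss_succ_of_step_eq_pure rfl]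
  exact h₁ _ _ _ _ fun s' hs' => h₂ s' hs' _ _ _ _ hy

theorem ite {t : Test} (h₁ : t.eval s = true → Runs O P s T post)
    (h₂ : t.eval s = false → Runs O P' s T post) : Runs O (.ite t P P') s (1 + T) post := by
  intro k N S y hy
  rw [show 1 + T + N = T + N + 1 by ring, loss_succ_of_step_eq_pure rfl]
  cases h : t.eval s
  · simpa [h] using h₂ h _ _ _ _ hy
  · simpa [h] using h₁ h _ _ _ _ hy

theorem loop_of_false {t : Test} (ht : t.eval s = false) (hp : post s) :
    Runs O (.loop t P) s 1 post := by
  refine of_step_eq_pure (s' := s) (fun k => ?_) hp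
  simp [step, ht]

theorem loop_of_true {t : Test} (ht : t.eval s = true) (h₁ : Runs O P s T₁ mid)
    (h₂ : ∀ s', mid s' → Runs O (.loop t P) s' T₂ post) :
    Runs O (.loop t P) s (1 + T₁ + T₂) post := by
  intro k N S y hy
  rw [show 1 + T₁ + T₂ + N = T₁ + (T₂ + N) + 1 by ring,
    loss_succ_of_step_eq_pure (c' := (P :: .loop t P :: k, s)) (by simp [step, ht])]
  exact h₁ _ _ _ _ fun s' hs' => h₂ s' hs' _ _ _ _ hy

end Runs

/-! ### Moving bits between registers -/

/-- Only constant bits can be pushed, so a bit is copied by branching on it. -/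
def moveBit (a b : ℕ) : Prog :=
  .ite (.top a) (.seq (.push b true) (.pop a)) (.seq (.push b false) (.pop a))

/-- The order of the bits is reversed; a second move restores it. -/
def moveAll (a b : ℕ) : Prog := .loop (.nonempty a) (moveBit a b)

def clear (a : ℕ) : Prog := .loop (.nonempty a) (.pop a)

theorem runs_moveBit {O : Oracle} {a b : ℕ} (hab : a ≠ b) {s : Store} {x : Bool} {l : List Bool}
    (hs : s a = x :: l) {post : Store → Prop}
    (hp : post (Function.update (Function.update s b (x :: s b)) a l)) :
    Runs O (moveBit a b) s 4 post := by
  refine Runs.ite (T := 3) (fun h => ?_) (fun h => ?_) <;>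
  · simp only [Test.eval, hs, List.headD_cons] at h
    subst h
    refine Runs.seq (T₁ := 1) (T₂ := 1) (Runs.push rfl) ?_
    rintro s' rfl
    refine Runs.pop ?_
    simpa [hab, hs] using hp

theorem runs_moveAll {O : Oracle} {a b : ℕ} (hab : a ≠ b) {post : Store → Prop} (l : List Bool)
    {s : Store} (hs : s a = l)
    (hp : post (Function.update (Function.update s b (l.reverse ++ s b)) a [])) :
    Runs O (moveAll a b) s (5 * l.length + 1) post := by
  induction l generalizing s with
  | nil =>
    refine (Runs.loop_of_false (by simp [Test.eval, hs]) ?_)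
    rwa [List.reverse_nil, List.nil_append, Function.update_eq_self, ← hs,
      Function.update_eq_self] at hp
  | cons x l ih =>
    refine (Runs.loop_of_true (T₁ := 4) (T₂ := 5 * l.length + 1) (by simp [Test.eval, hs])
      (runs_moveBit hab hs rfl) ?_).mono (by simp; omega) fun _ => id
    rintro s' rfl
    refine ih (by simp) ?_
    convert hp using 1
    funext c
    rcases eq_or_ne c a with rfl | hca
    · simp
    · rcases eq_or_ne c b with rfl | hcb <;> simp [*]

theorem runs_clear {O : Oracle} {a : ℕ} {post : Store → Prop} (l : List Bool)
    {s : Store} (hs : s a = l) (hp : post (Function.update s a [])) :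
    Runs O (clear a) s (2 * l.length + 1) post := by
  induction l generalizing s with
  | nil =>
    refine (Runs.loop_of_false (by simp [Test.eval, hs]) ?_)
    convert hp using 1
    simp [← hs]
  | cons x l ih =>
    refine (Runs.loop_of_true (T₁ := 1) (T₂ := 2 * l.length + 1) (by simp [Test.eval, hs])
      (Runs.pop rfl) ?_).mono (by simp; omega) fun _ => id
    rintro s' rfl
    exact ih (by simp [hs]) (by simpa using hp)

/-! ### Straight-line group programs -/

/-- The operations of the oracle are correct for the strings decoded by `dec`. -/
structure Oracle.Faithful {H : Type} [Group H] (O : Oracle) (dec : List Bool → Option H) :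
    Prop where
  mul : ∀ x y g h, dec x = some g → dec y = some h → ∀ z ∈ (O.mul x y).support,
    dec z = some (g * h)
  inv : ∀ x g, dec x = some g → ∀ z ∈ (O.inv x).support, dec z = some g⁻¹
  eq : ∀ x y g h, dec x = some g → dec y = some h → (O.eq x y = true ↔ g = h)

/-- The registers of a group program. -/
abbrev Reg := Fin 16

/-- The register of the store which holds a register of a group program. -/
def loc (i : Reg) : ℕ := 13 + i.val

theorem loc_inj {i j : Reg} : loc i = loc j ↔ i = j := by
  simp [loc, Fin.ext_iff]

theorem loc_ne {i : Reg} {a : ℕ} (ha : a < 13) : loc i ≠ a := by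
  simp only [loc]; omega

/-- Programs which compute in a group. The instruction `root a c` computes a fixed power of the
element in `a`. -/
inductive GroupProg where
  | skip
  | mul (a b c : Reg)
  | inv (a c : Reg)
  | root (a c : Reg)
  | ifeq (a b : Reg) (P Q : GroupProg)
  | seq (P Q : GroupProg)

open Classical in
/-- The effect of a group program, with `e` the exponent used by `root`. -/
noncomputable def GroupProg.eval {H : Type} [Group H] (e : ℕ) : GroupProg → (Reg → H) → Reg → H
  | .skip, σ => σ
  | .mul a b c, σ => Function.update σ c (σ a * σ b)
  | .inv a c, σ => Function.update σ c (σ a)⁻¹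
  | .root a c, σ => Function.update σ c (σ a ^ e)
  | .ifeq a b P Q, σ => if σ a = σ b then P.eval e σ else Q.eval e σ
  | .seq P Q, σ => Q.eval e (P.eval e σ)

/-- Both branches of a test are counted, which gives a time bound independent of the path taken. -/
def GroupProg.size : GroupProg → ℕ
  | .skip => 1
  | .mul _ _ _ => 1
  | .inv _ _ => 1
  | .root _ _ => 1
  | .ifeq _ _ P Q => 1 + P.size + Q.size
  | .seq P Q => 1 + P.size + Q.size

/-- One round of square-and-multiply, with the accumulator in `10` and the base in `11`. -/
def powStep : Prog :=
  .seq (.ite (.top 0) (.seq (.mul 10 11 10) (moveBit 0 8)) (moveBit 0 8)) (.mul 11 11 11)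

/-- Raise the element in `a` to the power `1 + m`, where `m` has its bits in register `0`. -/
def powProg (a c : ℕ) : Prog :=
  -- Multiplication by the identity in `7` copies an element in one query. The accumulator starts at
  -- the base instead of `1`, whence the exponent `1 + m`; the digits collected in `8` are put back
  -- so that `root` can be used again.
  .seq (.mul a 7 10) (.seq (.mul a 7 11) (.seq (.loop (.nonempty 0) powStep)
    (.seq (moveAll 8 0) (.mul 10 7 c))))

def GroupProg.compile : GroupProg → Prog
  | .skip => .skip
  | .mul a b c => .mul (loc a) (loc b) (loc c)
  | .inv a c => .inv (loc a) (loc c)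
  | .root a c => powProg (loc a) (loc c)
  | .ifeq a b P Q => .seq (.eq (loc a) (loc b) 12) (.ite (.top 12) P.compile Q.compile)
  | .seq P Q => .seq P.compile Q.compile

/-- The number with given binary digits, least significant first. -/
def bitsValue (l : List Bool) : ℕ := l.foldr Nat.bit 0

/-- The store `s` holds the raw strings `fr` in the registers below `7`, a string encrypting `1` in
register `7`, and the state `σ` of a group program. -/
structure Rel {H : Type} [Group H] (dec : List Bool → Option H) (fr : ℕ → List Bool) (s : Store)
    (σ : Reg → H) : Prop where
  frame : ∀ a < 7, s a = fr a
  one : dec (s 7) = some 1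
  tmp₁ : s 8 = []
  tmp₂ : s 9 = []
  reg : ∀ i, dec (s (loc i)) = some (σ i)

section

variable {H : Type} [Group H] {O : Oracle} {dec : List Bool → Option H} {fr : ℕ → List Bool}
  {s : Store} {σ : Reg → H}

/-- Registers `10`, `11` and `12` are scratch space for powers and comparisons. -/
theorem Rel.congr (h : Rel dec fr s σ) {s' : Store}
    (hs : ∀ a, a ≠ 10 → a ≠ 11 → a ≠ 12 → s' a = s a) : Rel dec fr s' σ where
  frame a ha := by rw [hs a (by omega) (by omega) (by omega), h.frame a ha]
  one := by rw [hs 7 (by omega) (by omega) (by omega), h.one]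
  tmp₁ := by rw [hs 8 (by omega) (by omega) (by omega), h.tmp₁]
  tmp₂ := by rw [hs 9 (by omega) (by omega) (by omega), h.tmp₂]
  reg i := by
    rw [hs _ (loc_ne (by norm_num)) (loc_ne (by norm_num)) (loc_ne (by norm_num)), h.reg i]

theorem Rel.update (h : Rel dec fr s σ) {z : List Bool} {g : H} (hz : dec z = some g) (c : Reg) :
    Rel dec fr (Function.update s (loc c) z) (Function.update σ c g) where
  frame a ha := by rw [Function.update_of_ne (loc_ne (by omega)).symm, h.frame a ha]
  one := by rw [Function.update_of_ne (loc_ne (by omega)).symm, h.one]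
  tmp₁ := by rw [Function.update_of_ne (loc_ne (by omega)).symm, h.tmp₁]
  tmp₂ := by rw [Function.update_of_ne (loc_ne (by omega)).symm, h.tmp₂]
  reg i := by
    rcases eq_or_ne i c with rfl | hi
    · simpa using hz
    · rw [Function.update_of_ne (by rwa [Ne, loc_inj]), Function.update_of_ne hi, h.reg]

/-- Square-and-multiply preserves `x * y ^ v`, with `v` the value of the remaining digits. The
consumed digits accumulate in reverse order in `8`. -/
theorem runs_powStep_loop (hO : O.Faithful dec) (l : List Bool) {s : Store} (hs : s 0 = l) {x y : H}
    (hx : dec (s 10) = some x) (hy : dec (s 11) = some y) :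
    Runs O (.loop (.nonempty 0) powStep) s (10 * l.length + 1) fun s' =>
      s' 0 = [] ∧ s' 8 = l.reverse ++ s 8 ∧ dec (s' 10) = some (x * y ^ bitsValue l) ∧
      ∀ a, a ≠ 0 → a ≠ 8 → a ≠ 10 → a ≠ 11 → s' a = s a := by
  induction l generalizing s x y with
  | nil =>
    refine Runs.loop_of_false (by simp [Test.eval, hs]) ?_
    simp [hs, hx, bitsValue]
  | cons b l ih =>
    have step : Runs O powStep s 9 fun s' => s' 0 = l ∧ s' 8 = b :: s 8 ∧
        dec (s' 10) = some (x * y ^ b.toNat) ∧ dec (s' 11) = some (y * y) ∧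
        ∀ a, a ≠ 0 → a ≠ 8 → a ≠ 10 → a ≠ 11 → s' a = s a := by
      refine Runs.seq (T₁ := 7) (T₂ := 1) (mid := fun s' => s' 0 = l ∧ s' 8 = b :: s 8 ∧
        dec (s' 10) = some (x * y ^ b.toNat) ∧ s' 11 = s 11 ∧
        ∀ a, a ≠ 0 → a ≠ 8 → a ≠ 10 → a ≠ 11 → s' a = s a)
        (Runs.ite (T := 6) (fun h => ?_) (fun h => ?_)) ?_
      · simp only [Test.eval, hs, List.headD_cons] at h
        subst h
        refine Runs.seq (T₁ := 1) (T₂ := 4)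
          (mid := fun s' => ∃ z, dec z = some (x * y) ∧ s' = Function.update s 10 z)
          (Runs.mul fun z hz => ⟨z, hO.mul _ _ _ _ hx hy z hz, rfl⟩) ?_
        rintro s' ⟨z, hz, rfl⟩
        refine runs_moveBit (by norm_num) (x := true) (l := l) (by simpa using hs) ?_
        simp +contextual [hz]
      · simp only [Test.eval, hs, List.headD_cons] at h
        subst h
        refine (runs_moveBit (by norm_num) (x := false) (l := l) hs ?_).mono (by norm_num)
          fun _ => id
        simp +contextual [hx]
      · rintro s' ⟨h0, h8, h10, h11, hr⟩
        refine Runs.mul fun z hz => ?_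
        have hz := hO.mul _ _ _ _ (by rw [h11]; exact hy) (by rw [h11]; exact hy) z hz
        refine ⟨by simpa using h0, by simpa using h8, by simpa using h10, by simpa using hz,
          fun a ha hb hc hd => by simp [*]⟩
    refine (Runs.loop_of_true (T₁ := 9) (T₂ := 10 * l.length + 1) (by simp [Test.eval, hs])
      step ?_).mono (by simp; omega) fun _ => id
    rintro s' ⟨h0, h8, h10, h11, hr⟩
    refine (ih h0 h10 h11).mono le_rfl ?_
    rintro s'' ⟨g0, g8, g10, gr⟩
    refine ⟨g0, by simp [g8, h8], ?_, fun a ha hb hc hd => by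
      rw [gr a ha hb hc hd, hr a ha hb hc hd]⟩
    rw [g10]
    have : bitsValue (b :: l) = b.toNat + 2 * bitsValue l := by
      cases b <;> simp [bitsValue, Nat.bit]; ring
    rw [this, pow_add, pow_mul, pow_two, mul_assoc]

theorem runs_powProg (hO : O.Faithful dec) (h : Rel dec fr s σ) (a c : Reg) :
    Runs O (powProg (loc a) (loc c)) s (16 * ((fr 0).length + 1)) fun s' =>
      Rel dec fr s' (Function.update σ c (σ a ^ (1 + bitsValue (fr 0)))) := by
  have h0 := h.frame 0 (by norm_num)
  refine (Runs.seq (T₁ := 1) (mid := fun s' => ∃ z, dec z = some (σ a) ∧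
    s' = Function.update s 10 z) (T₂ := 2 + (15 * (fr 0).length + 5)) (Runs.mul fun z hz =>
      ⟨z, by simpa using hO.mul _ _ _ _ (h.reg a) h.one z hz, rfl⟩) ?_).mono
      (by omega) fun _ => id
  rintro _ ⟨z, hz, rfl⟩
  refine Runs.seq (T₁ := 1) (T₂ := 15 * (fr 0).length + 5)
    (mid := fun s' => ∃ z', dec z' = some (σ a) ∧
      s' = Function.update (Function.update s 10 z) 11 z') (Runs.mul fun z' hz' =>
      ⟨z', ?_, rfl⟩) ?_
  · have := hO.mul (s (loc a)) (s 7) (σ a) 1 (h.reg a) h.one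
    rw [mul_one] at this
    refine this _ ?_
    rwa [Function.update_of_ne (loc_ne (by norm_num)), Function.update_of_ne (by norm_num)] at hz'
  rintro _ ⟨z', hz', rfl⟩
  refine (Runs.seq (T₁ := 10 * (fr 0).length + 1) (T₂ := 5 * (fr 0).length + 3)
    (runs_powStep_loop hO (fr 0) (x := σ a) (y := σ a) (by simpa using h0) (by simpa using hz)
      (by simpa using hz')) ?_).mono (by omega) fun _ => id
  rintro s' ⟨g0, g8, g10, gr⟩
  have g8 : s' 8 = (fr 0).reverse := by simpa [h.tmp₁] using g8
  refine (Runs.seq (T₂ := 1) (runs_moveAll (by norm_num) _ g8 rfl) ?_).mono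
    (by rw [List.length_reverse]; omega) fun _ => id
  rintro _ rfl
  refine Runs.mul fun z'' hz'' => ?_
  have gr' : ∀ b, b ≠ 0 → b ≠ 8 → b ≠ 10 → b ≠ 11 → s' b = s b := by
    intro b h1 h2 h3 h4
    rw [gr b h1 h2 h3 h4]
    simp [*]
  have hz3 : dec z'' = some (σ a ^ (1 + bitsValue (fr 0))) := by
    have := hO.mul (s' 10) (s' 7) _ 1 g10 (by
      rw [gr' 7 (by norm_num) (by norm_num) (by norm_num) (by norm_num), h.one])
    rw [mul_one, ← pow_succ', add_comm] at this
    exact this _ (by simpa using hz'')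
  refine Rel.update (h.congr fun b h1 h2 h3 => ?_) hz3 c
  rcases eq_or_ne b 8 with rfl | hb8
  · simpa using h.tmp₁.symm
  rcases eq_or_ne b 0 with rfl | hb0
  · simp [g0, h0]
  · simp [*]

/-- Each instruction is charged the price of the most expensive one, `root`. -/
theorem runs_compile (hO : O.Faithful dec) (P : GroupProg) (h : Rel dec fr s σ) :
    Runs O P.compile s (P.size * (16 * ((fr 0).length + 1))) fun s' =>
      Rel dec fr s' (P.eval (1 + bitsValue (fr 0)) σ) := by
  induction P generalizing s σ with
  | skip =>
    exact (Runs.skip (O := O) h).mono (by simp only [GroupProg.size]; omega) fun _ => id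
  | mul a b c =>
    refine (Runs.mul fun z hz => ?_).mono (T := 1) (by simp only [GroupProg.size]; omega)
      fun _ => id
    exact h.update (hO.mul _ _ _ _ (h.reg a) (h.reg b) z hz) c
  | inv a c =>
    refine (Runs.inv fun z hz => ?_).mono (T := 1) (by simp only [GroupProg.size]; omega)
      fun _ => id
    exact h.update (hO.inv _ _ (h.reg a) z hz) c
  | root a c =>
    exact (runs_powProg hO h a c).mono (by simp [GroupProg.size]) fun _ => id
  | ifeq a b P Q ihP ihQ =>
    refine (Runs.seq (T₁ := 1) (Runs.eq rfl) (T₂ := 1 + (P.size + Q.size) *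
      (16 * ((fr 0).length + 1))) ?_).mono ?_ fun _ => id
    · rintro _ rfl
      have h' : Rel dec fr (Function.update s 12 [O.eq (s (loc a)) (s (loc b))]) σ :=
        h.congr fun c _ _ hc => by simp [hc]
      have key := hO.eq _ _ _ _ (h.reg a) (h.reg b)
      refine Runs.ite (fun ht => ?_) (fun ht => ?_)
      · have ht : O.eq (s (loc a)) (s (loc b)) = true := by simpa [Test.eval] using ht
        refine (ihP h').mono (Nat.mul_le_mul_right _ (by omega)) fun s' hs' => ?_
        simpa [GroupProg.eval, key.1 ht] using hs'
      · have ht : ¬ O.eq (s (loc a)) (s (loc b)) = true := by simpa [Test.eval] using ht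
        refine (ihQ h').mono (Nat.mul_le_mul_right _ (by omega)) fun s' hs' => ?_
        simpa [GroupProg.eval, mt key.2 ht] using hs'
    · simp only [GroupProg.size, add_mul]; omega
  | seq P Q ihP ihQ =>
    refine (Runs.seq (ihP h) fun s' hs' => ihQ hs').mono ?_ fun _ => id
    simp only [GroupProg.size, add_mul]; omega

end

/-! ### Loading and storing the registers of group programs -/

/-- Put strings encrypting `1` in the given registers; register `7` encrypts `1`. -/
def initRegs : List Reg → Prog
  | [] => .skip
  | i :: l => .seq (.mul 7 7 (loc i)) (initRegs l)

/-- Put strings encrypting `1` in register `7` and all registers of group programs, starting from an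
involution in register `1`. -/
def initProg : Prog := .seq (.mul 1 1 7) (initRegs (List.finRange 16))

/-- Split the string in register `a` into two strings of the length of register `1`, and put strings
encrypting the same elements into the registers `i` and `j`. -/
def unpack (a : ℕ) (i j : Reg) : Prog :=
  -- The string in register `1` serves as a ruler: all strings of the box have one length, so
  -- consuming it in parallel cuts the pair in the middle.
  .seq (.loop (.nonempty 1) (.seq (moveBit 1 8) (moveBit a 9)))
    (.seq (moveAll 8 1) (.seq (moveAll 9 8) (.seq (.mul 8 7 (loc i))
      (.seq (clear 8) (.mul a 7 (loc j))))))

/-- Put the concatenation of the strings in `i` and `j` into register `0`. -/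
def pack (i j : Reg) : Prog :=
  -- Registers are stacks, so the second half goes in first; the detour through `8` undoes the
  -- reversal.
  .seq (clear 0) (.seq (moveAll (loc j) 8) (.seq (moveAll 8 0)
    (.seq (moveAll (loc i) 8) (moveAll 8 0))))

section

variable {H : Type} [Group H] {O : Oracle} {dec : List Bool → Option H} {fr : ℕ → List Bool}
  {s : Store} {σ : Reg → H}

theorem runs_initRegs (hO : O.Faithful dec) (l : List Reg) {s : Store} (h7 : dec (s 7) = some 1) :
    Runs O (initRegs l) s (2 * l.length + 1) fun s' => (∀ a < 13, s' a = s a) ∧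
      ∀ i : Reg, (i ∈ l ∨ dec (s (loc i)) = some 1) → dec (s' (loc i)) = some 1 := by
  induction l generalizing s with
  | nil => exact Runs.skip (by simp)
  | cons i l ih =>
    refine (Runs.seq (T₁ := 1) (T₂ := 2 * l.length + 1) (mid := fun s' => ∃ z,
      dec z = some 1 ∧ s' = Function.update s (loc i) z) (Runs.mul fun z hz =>
      ⟨z, by simpa using hO.mul _ _ _ _ h7 h7 z hz, rfl⟩) ?_).mono (by simp; omega) fun _ => id
    rintro _ ⟨z, hz, rfl⟩
    refine (ih (by rwa [Function.update_of_ne (loc_ne (by norm_num)).symm])).mono le_rfl ?_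
    rintro s' ⟨h1, h2⟩
    refine ⟨fun a ha => by rw [h1 a ha, Function.update_of_ne (loc_ne ha).symm], fun j hj => ?_⟩
    refine h2 j ?_
    rcases eq_or_ne j i with rfl | hji
    · right; simpa using hz
    · rcases hj with hj | hj
      · left; simpa [hji] using hj
      · right; rwa [Function.update_of_ne (by rwa [Ne, loc_inj])]

theorem runs_initProg (hO : O.Faithful dec) {ρ : H} (hρ : ρ * ρ = 1) (h1 : dec (s 1) = some ρ)
    (h8 : s 8 = []) (h9 : s 9 = []) :
    Runs O initProg s 35 fun s' => Rel dec s s' fun _ => 1 := by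
  refine (Runs.seq (T₁ := 1) (mid := fun s' => ∃ z, dec z = some 1 ∧ s' = Function.update s 7 z)
    (T₂ := 33) (Runs.mul fun z hz => ⟨z, by rw [← hρ]; exact hO.mul _ _ _ _ h1 h1 z hz, rfl⟩)
    ?_)
  rintro _ ⟨z, hz, rfl⟩
  refine (runs_initRegs hO (List.finRange 16) (by simpa using hz)).mono (by simp) ?_
  rintro s' ⟨g1, g2⟩
  refine ⟨fun a ha => ?_, ?_, ?_, ?_, fun i => g2 i (Or.inl (List.mem_finRange i))⟩
  · rw [g1 a (by omega), Function.update_of_ne (by omega)]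
  · rw [g1 7 (by norm_num)]; simpa using hz
  · rw [g1 8 (by norm_num)]; simpa using h8
  · rw [g1 9 (by norm_num)]; simpa using h9

theorem runs_load (hO : O.Faithful dec) (h : Rel dec fr s σ) {a : ℕ} (ha : a < 7) {g : H}
    (hg : dec (fr a) = some g) (i : Reg) :
    Runs O (.mul a 7 (loc i)) s 1 fun s' => Rel dec fr s' (Function.update σ i g) :=
  Runs.mul fun z hz => h.update (by
    simpa using hO.mul _ _ _ _ (by rwa [h.frame a ha]) h.one z hz) i

theorem runs_splitLoop {a : ℕ} (ha : 3 ≤ a) (ha' : a < 7) (l m u : List Bool) {s : Store}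
    (h1 : s 1 = l) (hlm : m.length = l.length) (hx : s a = m ++ u) :
    Runs O (.loop (.nonempty 1) (.seq (moveBit 1 8) (moveBit a 9))) s (10 * l.length + 1)
      fun s' => s' = Function.update (Function.update (Function.update (Function.update s 1 [])
        a u) 8 (l.reverse ++ s 8)) 9 (m.reverse ++ s 9) := by
  have n1 : a ≠ 1 := by omega
  have n8 : a ≠ 8 := by omega
  have n9 : a ≠ 9 := by omega
  induction l generalizing s m with
  | nil =>
    obtain rfl : m = [] := by simpa using hlm
    refine Runs.loop_of_false (by simp [Test.eval, h1]) ?_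
    funext c
    rcases eq_or_ne c 9 with rfl | c9; · simp
    rcases eq_or_ne c 8 with rfl | c8; · simp
    rcases eq_or_ne c a with rfl | ca; · simp [*]
    rcases eq_or_ne c 1 with rfl | c1
    · simp [*, n1.symm]
    · simp [*]
  | cons b l ih =>
    obtain ⟨b', m, rfl⟩ : ∃ b' m', m = b' :: m' := by
      cases m with
      | nil => simp at hlm
      | cons b' m' => exact ⟨b', m', rfl⟩
    have step : Runs O (.seq (moveBit 1 8) (moveBit a 9)) s 9 fun s' => s' =
        Function.update (Function.update (Function.update (Function.update s 1 l)
          a (m ++ u)) 8 (b :: s 8)) 9 (b' :: s 9) := by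
      refine Runs.seq (T₁ := 4) (T₂ := 4) (mid := fun s' => s' =
        Function.update (Function.update s 8 (b :: s 8)) 1 l)
        (runs_moveBit (by norm_num) h1 rfl) ?_
      rintro _ rfl
      refine runs_moveBit n9 (x := b') (l := m ++ u) (by simp [n1, n8, hx]) ?_
      funext c
      rcases eq_or_ne c 9 with rfl | c9; · simp [n9.symm]
      rcases eq_or_ne c 8 with rfl | c8; · simp [n8.symm]
      rcases eq_or_ne c a with rfl | ca; · simp [*]
      rcases eq_or_ne c 1 with rfl | c1
      · simp [*]
      · simp [*]
    refine (Runs.loop_of_true (T₁ := 9) (T₂ := 10 * l.length + 1) (by simp [Test.eval, h1])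
      step ?_).mono (by simp; omega) fun _ => id
    rintro _ rfl
    refine (ih m (by simp [n1.symm]) (by simpa using hlm) (by simp [*])).mono le_rfl ?_
    rintro _ rfl
    funext c
    rcases eq_or_ne c 9 with rfl | c9; · simp
    rcases eq_or_ne c 8 with rfl | c8; · simp
    rcases eq_or_ne c a with rfl | ca; · simp [*]
    rcases eq_or_ne c 1 with rfl | c1
    · simp [*]
    · simp [*]

theorem runs_unpack (hO : O.Faithful dec) (h : Rel dec fr s σ) {a : ℕ} (ha : 3 ≤ a) (ha' : a < 7)
    {m u : List Bool} (hx : fr a = m ++ u) (hm : m.length = (fr 1).length) {g v : H}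
    (hg : dec m = some g) (hv : dec u = some v) (i j : Reg) :
    Runs O (unpack a i j) s (22 * ((fr 1).length + 1)) fun s' =>
      Rel dec (Function.update fr a u) s' (Function.update (Function.update σ i g) j v) := by
  have n1 : a ≠ 1 := by omega
  have n7 : a ≠ 7 := by omega
  have n8 : a ≠ 8 := by omega
  have n9 : a ≠ 9 := by omega
  have key : ∀ {z₁ z₂ : List Bool} (_ : dec z₁ = some g) (_ : dec z₂ = some v) (s' : Store),
      s' = Function.update (Function.update (Function.update s a u) (loc i) z₁) (loc j) z₂ →
      Rel dec (Function.update fr a u) s' (Function.update (Function.update σ i g) j v) := by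
    rintro z₁ z₂ hz₁ hz₂ _ rfl
    refine (Rel.update (Rel.update ⟨fun b hb => ?_, ?_, ?_, ?_, fun k => ?_⟩ hz₁ i) hz₂ j)
    · rcases eq_or_ne b a with rfl | hba
      · simp
      · simp [hba, h.frame b hb]
    · simpa [n7.symm] using h.one
    · simpa [n8.symm] using h.tmp₁
    · simpa [n9.symm] using h.tmp₂
    · rw [Function.update_of_ne (loc_ne (by omega)), h.reg]
  refine (Runs.seq (T₂ := 12 * (fr 1).length + 9) (runs_splitLoop ha ha' (fr 1) m u
    (h.frame 1 (by norm_num)) hm (by rw [h.frame a ha', hx])) ?_).mono (by omega) fun _ => id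
  rintro _ rfl
  refine (Runs.seq (T₂ := 7 * (fr 1).length + 7) (runs_moveAll (by norm_num) ((fr 1).reverse)
    (by simp [h.tmp₁]) rfl) ?_).mono (by simp; omega) fun _ => id
  rintro _ rfl
  refine (Runs.seq (T₂ := 2 * (fr 1).length + 5) (runs_moveAll (by norm_num) m.reverse
    (by simp [h.tmp₂]) rfl) ?_).mono (by simp; omega) fun _ => id
  rintro _ rfl
  have h1 := h.frame 1 (by norm_num)
  refine (Runs.seq (T₁ := 1) (T₂ := 2 * (fr 1).length + 3) (mid := fun s' => ∃ z, dec z = some g ∧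
    s' = Function.update (Function.update (Function.update s a u) 8 m) (loc i) z)
    (Runs.mul fun z hz => ⟨z, ?_, ?_⟩) ?_).mono (by omega) fun _ => id
  · have := hO.mul m (s 7) g 1 hg h.one
    rw [mul_one] at this
    refine this z ?_
    simpa [n7.symm] using hz
  · congr 1
    funext c
    rcases eq_or_ne c 9 with rfl | c9; · simp [n9.symm, h.tmp₂]
    rcases eq_or_ne c 8 with rfl | c8; · simp
    rcases eq_or_ne c a with rfl | ca; · simp [*]
    rcases eq_or_ne c 1 with rfl | c1
    · simp [*, n1.symm]
    · simp [*]
  rintro _ ⟨z, hz, rfl⟩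
  refine (Runs.seq (T₂ := 1) (runs_clear m (by
    rw [Function.update_of_ne (loc_ne (by norm_num)).symm]; simp) rfl) ?_).mono
    (by omega) fun _ => id
  rintro _ rfl
  refine Runs.mul fun z' hz' => key hz (z₂ := z') ?_ _ ?_
  · have := hO.mul u (s 7) v 1 hv h.one
    rw [mul_one] at this
    refine this z' ?_
    simpa [n7.symm, n8, (loc_ne (i := i) (a := 7) (by norm_num)).symm,
      (loc_ne (i := i) (a := a) (by omega)).symm] using hz'
  · congr 1
    funext c
    rcases eq_or_ne c 8 with rfl | c8
    · simp [n8.symm, (loc_ne (i := i) (a := 8) (by norm_num)).symm, h.tmp₁]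
    · rcases eq_or_ne c (loc i) with rfl | hc
      · simp [*]
      · simp [*]

theorem runs_pack {n : ℕ} (hlen : ∀ x g, dec x = some g → x.length = n) (h : Rel dec fr s σ)
    {i j : Reg} (hij : i ≠ j) :
    Runs O (pack i j) s (2 * (fr 0).length + 20 * n + 9) fun s' =>
      ∃ t u, s' 0 = t ++ u ∧ dec t = some (σ i) ∧ dec u = some (σ j) := by
  have li := hlen _ _ (h.reg i)
  have lj := hlen _ _ (h.reg j)
  have i0 := loc_ne (i := i) (a := 0) (by norm_num)
  have i8 := loc_ne (i := i) (a := 8) (by norm_num)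
  have j0 := loc_ne (i := j) (a := 0) (by norm_num)
  have j8 := loc_ne (i := j) (a := 8) (by norm_num)
  have hij' : loc i ≠ loc j := by rwa [Ne, loc_inj]
  refine (Runs.seq (T₂ := 20 * n + 7) (runs_clear (fr 0) (h.frame 0 (by norm_num)) rfl) ?_).mono
    (by omega) fun _ => id
  rintro _ rfl
  refine (Runs.seq (T₂ := 15 * n + 5) (runs_moveAll j8 (s (loc j)) (by simp [j0]) rfl) ?_).mono
    (by omega) fun _ => id
  rintro _ rfl
  refine (Runs.seq (T₂ := 10 * n + 3) (runs_moveAll (by norm_num) (s (loc j)).reverse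
    (by simp [j8.symm, h.tmp₁]) rfl) ?_).mono (by simp; omega) fun _ => id
  rintro _ rfl
  refine (Runs.seq (T₂ := 5 * n + 1) (runs_moveAll i8 (s (loc i))
    (by simp [*]) rfl) ?_).mono (by omega) fun _ => id
  rintro _ rfl
  refine (runs_moveAll (by norm_num) (s (loc i)).reverse
    (by simp [i8.symm]) ?_).mono (by simp; omega) fun _ => id
  exact ⟨s (loc i), s (loc j), by simp [i0.symm, j0.symm], h.reg i, h.reg j⟩

end

/-! ### `SL₂` in characteristic two -/

section

variable {F : Type} [Field F]

def upper (x : F) : SL(2, F) := ⟨!![1, x; 0, 1], by simp⟩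

def lower (x : F) : SL(2, F) := ⟨!![1, 0; x, 1], by simp⟩

theorem sl_mul_apply (g h : SL(2, F)) (i j : Fin 2) :
    (g * h).val i j = g.val i 0 * h.val 0 j + g.val i 1 * h.val 1 j := by
  simp [Matrix.mul_apply, Fin.sum_univ_two]

theorem sl_one_apply (i j : Fin 2) : (1 : SL(2, F)).val i j = if i = j then 1 else 0 := by
  simp [Matrix.one_apply]

theorem sl_det (g : SL(2, F)) : g.val 0 0 * g.val 1 1 - g.val 0 1 * g.val 1 0 = 1 := by
  have := g.2
  rwa [Matrix.det_fin_two] at this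

theorem sl_ext {g h : SL(2, F)} (h00 : g.val 0 0 = h.val 0 0) (h01 : g.val 0 1 = h.val 0 1)
    (h10 : g.val 1 0 = h.val 1 0) (h11 : g.val 1 1 = h.val 1 1) : g = h := by
  apply Subtype.ext
  ext i j
  fin_cases i <;> fin_cases j <;> assumption

theorem sl_inv_00 (g : SL(2, F)) : (g⁻¹).val 0 0 = g.val 1 1 := by
  simp [Matrix.SpecialLinearGroup.coe_inv, Matrix.adjugate_fin_two]
theorem sl_inv_01 (g : SL(2, F)) : (g⁻¹).val 0 1 = - g.val 0 1 := by
  simp [Matrix.SpecialLinearGroup.coe_inv, Matrix.adjugate_fin_two]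
theorem sl_inv_10 (g : SL(2, F)) : (g⁻¹).val 1 0 = - g.val 1 0 := by
  simp [Matrix.SpecialLinearGroup.coe_inv, Matrix.adjugate_fin_two]
theorem sl_inv_11 (g : SL(2, F)) : (g⁻¹).val 1 1 = g.val 0 0 := by
  simp [Matrix.SpecialLinearGroup.coe_inv, Matrix.adjugate_fin_two]

theorem upper_00 (x : F) : (upper x).val 0 0 = 1 := by simp [upper]
theorem upper_01 (x : F) : (upper x).val 0 1 = x := by simp [upper]
theorem upper_10 (x : F) : (upper x).val 1 0 = 0 := by simp [upper]
theorem upper_11 (x : F) : (upper x).val 1 1 = 1 := by simp [upper]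
theorem lower_00 (x : F) : (lower x).val 0 0 = 1 := by simp [lower]
theorem lower_01 (x : F) : (lower x).val 0 1 = 0 := by simp [lower]
theorem lower_10 (x : F) : (lower x).val 1 0 = x := by simp [lower]
theorem lower_11 (x : F) : (lower x).val 1 1 = 1 := by simp [lower]

theorem upper_injective : Function.Injective (upper : F → SL(2, F)) := fun x y h => by
  rw [← upper_01 x, h, upper_01]

theorem upper_zero : upper (0 : F) = 1 := by
  apply sl_ext <;> simp [upper]

theorem upper_mul (x y : F) : upper x * upper y = upper (x + y) := by
  apply sl_ext <;> simp only [sl_mul_apply, upper_00, upper_01, upper_10, upper_11] <;> ring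

theorem commute_upper_one_iff (g : SL(2, F)) :
    g * upper 1 = upper 1 * g ↔ g.val 1 0 = 0 ∧ g.val 0 0 = g.val 1 1 := by
  constructor
  · intro h
    have h00 := congrArg (fun m => m.val 0 0) h
    have h01 := congrArg (fun m => m.val 0 1) h
    simp only [sl_mul_apply, upper_00, upper_01, upper_10, upper_11] at h00 h01
    exact ⟨by linear_combination -h00, by linear_combination h01⟩
  · rintro ⟨h1, h2⟩
    apply sl_ext <;> simp only [sl_mul_apply, upper_00, upper_01, upper_10, upper_11, h1, h2] <;>
      ring

variable [CharP F 2]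

theorem two_eq_zero' : (2 : F) = 0 := CharP.cast_eq_zero F 2

theorem eq_of_sq_eq_sq {x y : F} (h : x ^ 2 = y ^ 2) : x = y := by
  have h2 : (2 : F) = 0 := two_eq_zero'
  have : (x - y) ^ 2 = 0 := by linear_combination h - (x * y - y ^ 2) * h2
  exact sub_eq_zero.1 (pow_eq_zero_iff (two_ne_zero) |>.1 this)

/-- The square roots of `z` are given by an explicit formula. -/
theorem sq_eq_apply {S z : SL(2, F)} (h : S * S = z) :
    (S.val 0 0 + S.val 1 1) ^ 2 = z.val 0 0 + z.val 1 1 ∧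
    S.val 0 0 * (S.val 0 0 + S.val 1 1) = z.val 0 0 + 1 ∧
    S.val 0 1 * (S.val 0 0 + S.val 1 1) = z.val 0 1 ∧
    S.val 1 0 * (S.val 0 0 + S.val 1 1) = z.val 1 0 ∧
    S.val 1 1 * (S.val 0 0 + S.val 1 1) = z.val 1 1 + 1 := by
  have h2 : (2 : F) = 0 := two_eq_zero'
  have hd := sl_det S
  subst h
  simp only [sl_mul_apply]
  -- This is `S² = tr(S) S + 1`, read entry by entry.
  refine ⟨?_, ?_, ?_, ?_, ?_⟩ <;> grind

/-- The conjugate `g⁻¹ * ρ * g` of `ρ = upper 1`. -/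
theorem conj_upper_one_apply (g : SL(2, F)) :
    (g⁻¹ * upper 1 * g).val 0 0 = 1 + g.val 1 0 * g.val 1 1 ∧
    (g⁻¹ * upper 1 * g).val 0 1 = g.val 1 1 ^ 2 ∧
    (g⁻¹ * upper 1 * g).val 1 0 = g.val 1 0 ^ 2 ∧
    (g⁻¹ * upper 1 * g).val 1 1 = 1 + g.val 1 0 * g.val 1 1 := by
  have h2 : (2 : F) = 0 := two_eq_zero'
  have hd := sl_det g
  simp only [sl_mul_apply, sl_inv_00, sl_inv_01, sl_inv_10, sl_inv_11, upper_00, upper_01, upper_10,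
    upper_11]
  refine ⟨?_, ?_, ?_, ?_⟩ <;> grind

theorem conj_commute_iff (g : SL(2, F)) :
    (g⁻¹ * upper 1 * g) * upper 1 = upper 1 * (g⁻¹ * upper 1 * g) ↔ g.val 1 0 = 0 := by
  obtain ⟨h00, h01, h10, h11⟩ := conj_upper_one_apply g
  rw [commute_upper_one_iff, h10, h00, h11]
  simp

end

/-! ### Conjugating elements obtained from square roots -/

/-- The group elements computed by the recovery algorithm; `e` is the exponent which computes square
roots of elements of odd order. -/
def zetaElt {H : Type} [Group H] (e : ℕ) (ρ g : H) : H := g * (g⁻¹ * ρ * g * ρ) ^ e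

/-- The first factor conjugates `ρ` to `t`, the second `t` to `v`, provided `e` extracts the two
square roots. -/
def betaElt {H : Type} [Group H] (e : ℕ) (ρ t v : H) : H := (ρ * t) ^ e * (t * v) ^ e

/-- For `t = lower c` the two `betaElt`s are diagonal, with squared lower entries `(1 + y) / c` and
`1 + y` (identifying `upper y` with `y`). The quotient has squared lower entry `c`, which is the
factor needed to rescale `t`. -/
def scaleElt {H : Type} [Group H] (e : ℕ) (ρ t y : H) : H :=
  (betaElt e ρ t (ρ * zetaElt e ρ (t * betaElt e ρ t y)))⁻¹ * betaElt e ρ t (ρ * y)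

/-- Group words commute with isomorphisms; this transports the computation for `lower c` to its
conjugates under `U`. -/
theorem map_scaleElt {H : Type} [Group H] (θ : H ≃* H) (e : ℕ) (ρ t y : H) :
    θ (scaleElt e ρ t y) = scaleElt e (θ ρ) (θ t) (θ y) := by
  simp [scaleElt, betaElt, zetaElt]

section

variable {F : Type} [Field F] [CharP F 2] {e : ℕ}

/-- With `v = g⁻¹ρg`, the root of `vρ` conjugates `v` to `ρ`, so multiplying `g` by it gives an
element centralizing `ρ`. The root exists because `tr(vρ) = (g.val 1 0)²`, and its explicit form
yields the parameter. -/
theorem zetaElt_upper (he : ∀ z : SL(2, F), z.val 0 0 + z.val 1 1 ≠ 0 → z ^ e * z ^ e = z)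
    {g : SL(2, F)} (hg : g.val 1 0 ≠ 0) :
    zetaElt e (upper 1) g = upper (1 + (g.val 0 0 + g.val 1 1) / g.val 1 0) := by
  have h2 : (2 : F) = 0 := two_eq_zero'
  have hd := sl_det g
  unfold zetaElt
  obtain ⟨h00, h01, h10, h11⟩ := conj_upper_one_apply g
  generalize g⁻¹ * upper 1 * g = v at *
  have z00 : (v * upper 1).val 0 0 = 1 + g.val 1 0 * g.val 1 1 := by
    simp only [sl_mul_apply, upper_00, upper_10, h00]; ring
  have z01 : (v * upper 1).val 0 1 = 1 + g.val 1 0 * g.val 1 1 + g.val 1 1 ^ 2 := by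
    simp only [sl_mul_apply, upper_01, upper_11, h00, h01]; ring
  have z10 : (v * upper 1).val 1 0 = g.val 1 0 ^ 2 := by
    simp only [sl_mul_apply, upper_00, upper_10, h10]; ring
  have z11 : (v * upper 1).val 1 1 = 1 + g.val 1 0 * g.val 1 1 + g.val 1 0 ^ 2 := by
    simp only [sl_mul_apply, upper_01, upper_11, h10, h11]; ring
  have htr : (v * upper 1).val 0 0 + (v * upper 1).val 1 1 = g.val 1 0 ^ 2 := by
    rw [z00, z11]; linear_combination (1 + g.val 1 0 * g.val 1 1) * h2
  obtain ⟨s, s00, s01, s10, s11⟩ := sq_eq_apply (he (v * upper 1)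
    (by rw [htr]; exact pow_ne_zero 2 hg))
  generalize (v * upper 1) ^ e = S at *
  rw [htr] at s
  -- Squaring is injective, so the trace of the root is `g.val 1 0`, and its entries follow by
  -- division.
  have s := eq_of_sq_eq_sq s
  rw [s, z00] at s00
  rw [s, z01] at s01
  rw [s, z10] at s10
  rw [s, z11] at s11
  clear he h00 h01 h10 h11 z00 z01 z10 z11 htr s
  apply sl_ext <;> simp only [sl_mul_apply, upper_00, upper_01, upper_10, upper_11] <;>
    generalize S.val 0 0 = p at * <;> generalize S.val 0 1 = q at * <;>
    generalize S.val 1 0 = r at * <;> generalize S.val 1 1 = t at * <;>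
    generalize g.val 0 0 = a at * <;> generalize g.val 0 1 = b at * <;>
    generalize g.val 1 0 = c at * <;> generalize g.val 1 1 = d at * <;>
    apply mul_right_cancel₀ hg
  · grind
  · rw [show (1 + (a + d) / c) * c = c + (a + d) by field_simp]
    grind
  · grind
  · grind

/-- Up to scalars the two roots are `ρt + 1` and `tv + 1`. As `t² = 1`, their product is `ρv + ρt +
tv + 1 = c · diag(1, y)`; determinant one fixes the scalar. -/
theorem betaElt_apply (he : ∀ z : SL(2, F), z.val 0 0 + z.val 1 1 ≠ 0 → z ^ e * z ^ e = z)
    {c y : F} (hc : c ≠ 0) (hy : y ≠ 0) :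
    (betaElt e (upper 1) (lower c) (upper y)).val 0 1 = 0 ∧
    (betaElt e (upper 1) (lower c) (upper y)).val 1 0 = 0 ∧
    (betaElt e (upper 1) (lower c) (upper y)).val 1 1 ^ 2 = y := by
  have h2 : (2 : F) = 0 := two_eq_zero'
  have tr1 : (upper 1 * lower c).val 0 0 + (upper 1 * lower c).val 1 1 = c := by
    simp only [sl_mul_apply, upper_00, upper_01, upper_10, upper_11, lower_00, lower_01,
      lower_10, lower_11]
    linear_combination h2
  have tr2 : (lower c * upper y).val 0 0 + (lower c * upper y).val 1 1 = c * y := by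
    simp only [sl_mul_apply, upper_00, upper_01, upper_10, upper_11, lower_00, lower_01,
      lower_10, lower_11]
    linear_combination h2
  obtain ⟨s, s00, s01, s10, s11⟩ := sq_eq_apply (he (upper 1 * lower c) (by rwa [tr1]))
  obtain ⟨r, r00, r01, r10, r11⟩ := sq_eq_apply (he (lower c * upper y)
    (by rw [tr2]; exact mul_ne_zero hc hy))
  unfold betaElt
  rw [tr1] at s
  rw [tr2] at r
  set S := (upper 1 * lower c) ^ e
  set R := (lower c * upper y) ^ e
  simp only [sl_mul_apply, upper_00, upper_01, upper_10, upper_11, lower_00, lower_01, lower_10,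
    lower_11] at *
  generalize S.val 0 0 = a at *
  generalize S.val 0 1 = b at *
  generalize S.val 1 0 = c' at *
  generalize S.val 1 1 = d at *
  generalize R.val 0 0 = a' at *
  generalize R.val 0 1 = b' at *
  generalize R.val 1 0 = c'' at *
  generalize R.val 1 1 = d' at *
  have hA : a + d ≠ 0 := fun h => hc (by rw [← s, h]; ring)
  have hB : a' + d' ≠ 0 := fun h => mul_ne_zero hc hy (by rw [← r, h]; ring)
  have h01 : a * b' + b * d' = 0 := by
    apply mul_right_cancel₀ hA
    apply mul_right_cancel₀ hB
    have : (a * b' + b * d') * (a + d) * (a' + d') = (a * (a + d)) * (b' * (a' + d')) +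
      (b * (a + d)) * (d' * (a' + d')) := by ring
    rw [this, s00, s01, r01, r11]
    linear_combination (c * y + y + 1) * h2
  have h10 : c' * a' + d * c'' = 0 := by
    apply mul_right_cancel₀ hA
    apply mul_right_cancel₀ hB
    have : (c' * a' + d * c'') * (a + d) * (a' + d') = (c' * (a + d)) * (a' * (a' + d')) +
      (d * (a + d)) * (c'' * (a' + d')) := by ring
    rw [this, s10, s11, r00, r10]
    linear_combination (2 * c) * h2
  refine ⟨h01, h10, ?_⟩
  apply mul_right_cancel₀ (pow_ne_zero 2 hA)
  apply mul_right_cancel₀ (pow_ne_zero 2 hB)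
  have : (c' * b' + d * d') ^ 2 * (a + d) ^ 2 * (a' + d') ^ 2 = ((c' * (a + d)) * (b' * (a' + d')) +
      (d * (a + d)) * (d' * (a' + d'))) ^ 2 := by ring
  rw [this, s10, s11, r01, r11, s, r]
  grind

end

/-! ### Conjugation in the Borel subgroup, Bruhat factorisation, partners of an involution -/

section

variable {F : Type} [Field F]

theorem exists_sl {a b c d : F} (h : a * d - b * c = 1) : ∃ g : SL(2, F),
    g.val 0 0 = a ∧ g.val 0 1 = b ∧ g.val 1 0 = c ∧ g.val 1 1 = d :=
  ⟨⟨!![a, b; c, d], by rw [Matrix.det_fin_two_of, h]⟩, rfl, rfl, rfl, rfl⟩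

theorem mul_upper_mul_inv {b : SL(2, F)} (hb : b.val 1 0 = 0) (x : F) :
    b * upper x * b⁻¹ = upper (x / b.val 1 1 ^ 2) := by
  have hd := sl_det b
  rw [hb, mul_zero, sub_zero] at hd
  have h11 : b.val 1 1 ≠ 0 := right_ne_zero_of_mul_eq_one hd
  have h00 : b.val 0 0 = (b.val 1 1)⁻¹ := eq_inv_of_mul_eq_one_left hd
  apply sl_ext <;> simp only [sl_mul_apply, upper_00, upper_01, upper_10, upper_11, sl_inv_00,
    sl_inv_01, sl_inv_10, sl_inv_11, hb, h00] <;> field_simp <;> ring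

theorem inv_mul_upper_mul {b : SL(2, F)} (hb : b.val 1 0 = 0) (x : F) :
    b⁻¹ * upper x * b = upper (x * b.val 1 1 ^ 2) := by
  have hb' : (b⁻¹).val 1 0 = 0 := by rw [sl_inv_10, hb, neg_zero]
  have hd := sl_det b
  rw [hb, mul_zero, sub_zero] at hd
  have h := mul_upper_mul_inv hb' x
  rw [inv_inv, sl_inv_11, eq_inv_of_mul_eq_one_left hd, inv_pow, div_inv_eq_mul] at h
  exact h

theorem eq_upper {g : SL(2, F)} (h : g.val 1 0 = 0) (h' : g.val 1 1 = 1) :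
    g = upper (g.val 0 1) := by
  have hd := sl_det g
  rw [h, h'] at hd
  apply sl_ext <;> simp only [upper_00, upper_01, upper_10, upper_11, h, h']
  linear_combination hd

variable [CharP F 2]

theorem upper_mul_self (x : F) : upper x * upper x = 1 := by
  rw [upper_mul, CharTwo.add_self_eq_zero, upper_zero]

theorem lower_mul_self (x : F) : lower x * lower x = 1 := by
  apply sl_ext <;> simp only [sl_mul_apply, lower_00, lower_01, lower_10, lower_11, sl_one_apply] <;>
    simp [CharTwo.add_self_eq_zero]

theorem exists_sq_eq [Finite F] (x : F) : ∃ s : F, s ^ 2 = x := by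
  have : Fintype F := Fintype.ofFinite F
  obtain ⟨s, hs⟩ := FiniteField.isSquare_of_char_two (ringChar.eq F 2) x
  exact ⟨s, by rw [hs, pow_two]⟩

theorem exists_borel_elt [Finite F] {x : F} (hx : x ≠ 0) :
    ∃ b : SL(2, F), b.val 1 0 = 0 ∧ b.val 1 1 ^ 2 = x := by
  obtain ⟨s, rfl⟩ := exists_sq_eq x
  have hs : s ≠ 0 := by rintro rfl; simp at hx
  exact ⟨⟨!![s⁻¹, 0; 0, s], by simp [hs]⟩, by simp, by simp⟩

/-- The Weyl element. -/
def weyl (F : Type) [Field F] : SL(2, F) := upper 1 * lower 1 * upper 1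

theorem weyl_mul_upper_mul_weyl (x : F) : weyl F * upper x * weyl F = lower x := by
  have h2 : (2 : F) = 0 := two_eq_zero'
  apply sl_ext <;> simp only [weyl, sl_mul_apply, upper_00, upper_01, upper_10, upper_11, lower_00,
    lower_01, lower_10, lower_11] <;> grind

/-- Factorisation of the big Bruhat cell. The parameters involve only matrix entries and division by
a single entry, so they can be evaluated on strings. -/
theorem upper_mul_lower_mul_upper {g : SL(2, F)} (hg : g.val 1 0 ≠ 0) :
    upper ((g.val 0 0 + 1) / g.val 1 0) * lower (g.val 1 0) *
      upper ((g.val 1 1 + 1) / g.val 1 0) = g := by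
  have h2 : (2 : F) = 0 := two_eq_zero'
  have hd := sl_det g
  apply sl_ext <;> simp only [sl_mul_apply, upper_00, upper_01, upper_10, upper_11, lower_00,
    lower_01, lower_10, lower_11] <;> field_simp <;> grind

/-- The properties which make `t` together with `ρ` generate a dihedral group of order six. -/
def IsPartner {H : Type} [Group H] (ρ t : H) : Prop :=
  t * t = 1 ∧ t ≠ ρ ∧ ρ * t * (ρ * t) * (ρ * t) = 1

theorem isPartner_map {H H' : Type} [Group H] [Group H'] (θ : H ≃* H') {ρ t : H} :
    IsPartner (θ ρ) (θ t) ↔ IsPartner ρ t := by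
  simp only [IsPartner, ← map_mul, ← map_one θ, θ.injective.eq_iff, ne_eq]

theorem isPartner_upper_lower : IsPartner (upper (1 : F)) (lower 1) := by
  have h2 : (2 : F) = 0 := two_eq_zero'
  refine ⟨lower_mul_self 1, fun h => ?_, ?_⟩
  · have := congrArg (fun g => g.val 1 0) h
    simp [upper_10, lower_10] at this
  · apply sl_ext <;> simp only [sl_mul_apply, upper_00, upper_01, upper_10, upper_11, lower_00,
      lower_01, lower_10, lower_11, sl_one_apply] <;> norm_num <;> grind

theorem upper_inv_mul_lower_mul_upper (m c : F) :
    ((upper m)⁻¹ * lower c * upper m).val 0 0 = 1 + m * c ∧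
    ((upper m)⁻¹ * lower c * upper m).val 0 1 = m ^ 2 * c ∧
    ((upper m)⁻¹ * lower c * upper m).val 1 0 = c ∧
    ((upper m)⁻¹ * lower c * upper m).val 1 1 = 1 + m * c := by
  have h2 : (2 : F) = 0 := two_eq_zero'
  simp only [sl_mul_apply, upper_00, upper_01, upper_10, upper_11, lower_00,
    lower_01, lower_10, lower_11, sl_inv_00, sl_inv_01, sl_inv_10, sl_inv_11]
  refine ⟨?_, ?_, ?_, ?_⟩ <;> grind

/-- An involution has trace zero, so `ρt` has trace `c`, the lower left entry of `t`; order three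
forces `c = 1`. Such an involution is determined by its diagonal entry, which conjugation by `U`
moves arbitrarily. -/
theorem IsPartner.exists_conj {t : SL(2, F)} (h : IsPartner (upper 1) t) :
    ∃ m, t = (upper m)⁻¹ * lower 1 * upper m := by
  have h2 : (2 : F) = 0 := two_eq_zero'
  obtain ⟨h1, hne, h3⟩ := h
  have hd := sl_det t
  have htr := (sq_eq_apply h1).1
  simp only [sl_one_apply, if_true] at htr
  have htr : t.val 1 1 = t.val 0 0 := by
    have : t.val 0 0 + t.val 1 1 = 0 := by
      apply pow_eq_zero_iff (two_ne_zero) |>.1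
      rw [htr]; linear_combination h2
    linear_combination this - t.val 0 0 * h2
  have e10 := congrArg (fun g => g.val 1 0) h3
  have e01 := congrArg (fun g => g.val 0 1) h3
  simp only [sl_mul_apply, upper_00, upper_01, upper_10, upper_11, sl_one_apply, htr] at e10 e01 hd
  norm_num at e10 e01
  have hc : t.val 1 0 * (t.val 1 0 + 1) ^ 2 = 0 := by grind
  have key : t.val 1 0 = 1 := by
    -- If `c = 0`, then `ρt` lies in `U`, so its cube is itself and `t = ρ`.
    rcases mul_eq_zero.1 hc with h0 | h0
    · exfalso
      apply hne
      have ha : t.val 0 0 = 1 := by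
        apply eq_of_sq_eq_sq
        rw [h0] at hd
        linear_combination hd
      have hb : t.val 0 1 = 1 := by
        rw [h0, ha] at e01
        grind
      exact sl_ext (by rw [ha, upper_00]) (by rw [hb, upper_01]) (by rw [h0, upper_10])
        (by rw [htr, ha, upper_11])
    · have := pow_eq_zero_iff (two_ne_zero) |>.1 h0
      linear_combination this - h2
  obtain ⟨g00, g01, g10, g11⟩ := upper_inv_mul_lower_mul_upper (t.val 0 0 + 1) 1
  refine ⟨t.val 0 0 + 1, sl_ext ?_ ?_ ?_ ?_⟩
  · rw [g00]; linear_combination -h2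
  · rw [g01]; rw [key] at hd; linear_combination -hd - (t.val 0 0 + 1) * h2
  · rw [g10, key]
  · rw [g11, htr]; linear_combination -h2

/-- Coordinates in which a given involution and a partner are standard. -/
theorem IsPartner.exists_equiv {H : Type} [Group H] (γ : SL(2, F) ≃* H) {t : H}
    (h : IsPartner (γ (upper 1)) t) :
    ∃ γ' : SL(2, F) ≃* H, γ' (upper 1) = γ (upper 1) ∧ γ' (lower 1) = t := by
  rw [← γ.apply_symm_apply t, isPartner_map] at h
  obtain ⟨m, hm⟩ := h.exists_conj
  refine ⟨(MulAut.conj (upper m)⁻¹).trans γ, ?_, ?_⟩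
  · have : (upper m)⁻¹ * upper 1 * upper m = upper 1 := by
      rw [mul_assoc, upper_mul, add_comm, ← upper_mul, inv_mul_cancel_left]
    simp [this]
  · simpa using (congrArg γ hm).symm

/-- All involutions are conjugate, because every element of a finite field of characteristic two is
a square. -/
theorem exists_equiv_of_orderOf_eq_two [Finite F] {ρ : SL(2, F)} (hρ : orderOf ρ = 2) :
    ∃ γ : SL(2, F) ≃* SL(2, F), γ (upper 1) = ρ := by
  have h2 : (2 : F) = 0 := two_eq_zero'
  have h1 : ρ * ρ = 1 := by
    have := pow_orderOf_eq_one ρ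
    rwa [hρ, pow_two] at this
  have hne : ρ ≠ 1 := by rintro rfl; simp at hρ
  suffices ∃ h : SL(2, F), h * upper 1 = ρ * h by
    obtain ⟨h, hh⟩ := this
    exact ⟨MulAut.conj h, by simp [MulAut.conj_apply, hh]⟩
  have hd := sl_det ρ
  have htr := (sq_eq_apply h1).1
  simp only [sl_one_apply, if_true] at htr
  have htr : ρ.val 1 1 = ρ.val 0 0 := by
    have : ρ.val 0 0 + ρ.val 1 1 = 0 := by
      apply pow_eq_zero_iff (two_ne_zero) |>.1
      rw [htr]; linear_combination h2
    linear_combination this - ρ.val 0 0 * h2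
  rw [htr] at hd
  by_cases hc : ρ.val 1 0 = 0
  · have ha : ρ.val 0 0 = 1 := by
      apply eq_of_sq_eq_sq
      rw [hc] at hd
      linear_combination hd
    have hb : ρ.val 0 1 ≠ 0 := by
      intro hb
      exact hne (sl_ext (by simp [ha]) (by simp [hb]) (by simp [hc]) (by simp [htr, ha]))
    obtain ⟨h, g10, g11⟩ := exists_borel_elt (inv_ne_zero hb)
    refine ⟨h, ?_⟩
    have hρ' : ρ = upper (ρ.val 0 1) := eq_upper hc (by rw [htr, ha])
    rw [← mul_inv_eq_iff_eq_mul, mul_upper_mul_inv g10, g11, one_div, inv_inv, ← hρ']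
  · obtain ⟨s, hs⟩ := exists_sq_eq (ρ.val 1 0)⁻¹
    have hs : s ^ 2 * ρ.val 1 0 = 1 := by rw [hs, inv_mul_cancel₀ hc]
    -- The columns are `s(ρ + 1)e₁` and `s e₁`: `ρ` fixes the first and adds it to the second. The
    -- choice of `s` makes the determinant one.
    obtain ⟨h, h00, h01, h10, h11⟩ := exists_sl (a := s * (ρ.val 0 0 + 1)) (b := s)
      (c := s * ρ.val 1 0) (d := 0) (by linear_combination -hs - h2)
    refine ⟨h, ?_⟩
    apply sl_ext <;> simp only [sl_mul_apply, upper_00, upper_01, upper_10, upper_11, htr, h00, h01,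
      h10, h11] <;> grind

end

/-! ### Odd order of elements of nonzero trace -/

section

variable {F : Type} [Field F]

/-- By Cayley–Hamilton all powers of `z` stay in the span of `z` and `1`. -/
theorem exists_pow_eq (z : SL(2, F)) (k : ℕ) : ∃ α β : F,
    (z ^ k).val 0 0 = α * z.val 0 0 + β ∧ (z ^ k).val 0 1 = α * z.val 0 1 ∧
    (z ^ k).val 1 0 = α * z.val 1 0 ∧ (z ^ k).val 1 1 = α * z.val 1 1 + β := by
  have hd := sl_det z
  induction k with
  | zero => exact ⟨0, 1, by simp, by simp, by simp, by simp⟩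
  | succ k ih =>
    obtain ⟨α, β, h00, h01, h10, h11⟩ := ih
    refine ⟨α * (z.val 0 0 + z.val 1 1) + β, -α, ?_⟩
    simp only [pow_succ, sl_mul_apply, h00, h01, h10, h11]
    refine ⟨?_, ?_, ?_, ?_⟩
    · linear_combination -α * hd
    · ring
    · ring
    · linear_combination -α * hd

variable [CharP F 2]

/-- Write `z ^ k = αz + β`, of trace `α tr z`. A matrix of square one has trace zero, so `α = 0`,
and a scalar of determinant one is `1`. -/
theorem pow_eq_one_of_sq_eq_one {z : SL(2, F)} (hz : z.val 0 0 + z.val 1 1 ≠ 0) {k : ℕ}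
    (h : z ^ k * z ^ k = 1) : z ^ k = 1 := by
  have h2 : (2 : F) = 0 := two_eq_zero'
  obtain ⟨α, β, h00, h01, h10, h11⟩ := exists_pow_eq z k
  have htr := (sq_eq_apply h).1
  have hd := sl_det (z ^ k)
  simp only [sl_one_apply, if_true, h00, h11] at htr
  have : α = 0 := by
    have : (α * (z.val 0 0 + z.val 1 1)) ^ 2 = 0 := by
      rw [show α * (z.val 0 0 + z.val 1 1) = α * z.val 0 0 + β + (α * z.val 1 1 + β) by
        linear_combination -β * h2, htr]
      linear_combination h2
    exact (mul_eq_zero.1 ((pow_eq_zero_iff two_ne_zero).1 this)).resolve_right hz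
  subst this
  rw [h00, h01, h10, h11] at hd
  have : β = 1 := eq_of_sq_eq_sq (by linear_combination hd)
  apply sl_ext <;> simp [h00, h01, h10, h11, this]

/-- The factors `2` of the exponent are removed one by one, leaving `z ^ (2m + 1) = 1`; then `2(1 +
m) = (2m + 1) + 1`. -/
theorem pow_mul_pow_self {a m : ℕ} (hE : ∀ z : SL(2, F), z ^ (2 ^ a * (2 * m + 1)) = 1)
    (z : SL(2, F)) (hz : z.val 0 0 + z.val 1 1 ≠ 0) : z ^ (1 + m) * z ^ (1 + m) = z := by
  have key : z ^ (2 * m + 1) = 1 := by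
    have := hE z
    clear hE
    induction a with
    | zero => simpa using this
    | succ a ih =>
      refine ih (pow_eq_one_of_sq_eq_one hz ?_)
      rw [← pow_add, ← this]
      congr 1
      ring
  rw [← pow_add, show 1 + m + (1 + m) = 2 * m + 1 + 1 by ring, pow_succ, key, one_mul]

end

/-! ### Construction of a partner and count of the exceptions -/

section

variable {F : Type} [Field F] [CharP F 2] {e : ℕ}

/-- If `h` is the diagonal element for `y`, then `h₁₁ / h₀₀ = y`, so `zetaElt` of `lower c * h` has
parameter `1 + (1 + y) / c`. This divides by the unknown `c`, and comparing the diagonal elements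
for `(1 + y) / c` and `1 + y` isolates a square root of `c`. The conditions on `y` keep all
parameters nonzero. -/
theorem scaleElt_conj_lower
    (he : ∀ z : SL(2, F), z.val 0 0 + z.val 1 1 ≠ 0 → z ^ e * z ^ e = z) {c y : F} (hc : c ≠ 0)
    (hy : y ≠ 0) (hy' : y ≠ 1) :
    (scaleElt e (upper 1) (lower c) (upper y))⁻¹ * lower c *
      scaleElt e (upper 1) (lower c) (upper y) = lower 1 := by
  have h2 : (2 : F) = 0 := two_eq_zero'
  have hy1 : 1 + y ≠ 0 := fun h => hy' (by linear_combination h - h2)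
  unfold scaleElt
  obtain ⟨p01, p10, p11⟩ := betaElt_apply he hc hy
  have pd := sl_det (betaElt e (upper 1) (lower c) (upper y))
  generalize betaElt e (upper 1) (lower c) (upper y) = h at *
  have hp : h.val 0 0 ≠ 0 := by
    intro h0; rw [h0, p01] at pd; simp at pd
  have t10 : (lower c * h).val 1 0 = c * h.val 0 0 := by
    simp only [sl_mul_apply, lower_10, lower_11, p10]; ring
  have t00 : (lower c * h).val 0 0 = h.val 0 0 := by
    simp only [sl_mul_apply, lower_00, lower_01]; ring
  have t11 : (lower c * h).val 1 1 = h.val 1 1 := by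
    simp only [sl_mul_apply, lower_10, lower_11, p01]; ring
  have hz : upper 1 * zetaElt e (upper 1) (lower c * h) = upper ((1 + y) / c) := by
    rw [zetaElt_upper he (by rw [t10]; exact mul_ne_zero hc hp), upper_mul, t00, t11, t10]
    congr 1
    rw [p01, zero_mul, sub_zero] at pd
    field_simp
    grind
  rw [hz, upper_mul]
  obtain ⟨q01, q10, q11⟩ := betaElt_apply he hc (div_ne_zero hy1 hc)
  have qd := sl_det (betaElt e (upper 1) (lower c) (upper ((1 + y) / c)))
  generalize betaElt e (upper 1) (lower c) (upper ((1 + y) / c)) = q at *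
  obtain ⟨r01, r10, r11⟩ := betaElt_apply he hc hy1
  have rd := sl_det (betaElt e (upper 1) (lower c) (upper (1 + y)))
  generalize betaElt e (upper 1) (lower c) (upper (1 + y)) = r at *
  rw [eq_div_iff hc] at q11
  rw [q01, zero_mul, sub_zero] at qd
  rw [r01, zero_mul, sub_zero] at rd
  rw [mul_assoc, inv_mul_eq_iff_eq_mul]
  clear he hz p01 p10 p11 pd t10 t00 t11
  apply sl_ext <;> simp only [sl_mul_apply, lower_00, lower_01, lower_10, lower_11, sl_inv_00,
    sl_inv_01, sl_inv_10, sl_inv_11, q01, q10, r01, r10]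
  · ring
  · ring
  · apply mul_right_cancel₀ (right_ne_zero_of_mul_eq_one qd)
    apply mul_right_cancel₀ (right_ne_zero_of_mul_eq_one rd)
    linear_combination c * q.val 1 1 ^ 2 * rd - r.val 1 1 ^ 2 * qd + q11 - r11
  · ring

/-- The group elements from which the construction of a partner does not succeed. -/
def badSet (F : Type) [Field F] : Set SL(2, F) :=
  {g | g.val 1 0 = 0 ∨ (Nat.card F ≠ 2 ∧ (g.val 0 0 + g.val 1 1 = 0 ∨
    g.val 0 0 + g.val 1 1 = g.val 1 0))}

open Classical in
/-- The partner computed from a random element `g`, where `y` stands for `zetaElt e ρ g`. -/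
noncomputable def candidate {H : Type} [Group H] (e : ℕ) (ρ g : H) : H :=
  if zetaElt e ρ g = 1 ∨ zetaElt e ρ g = ρ then g⁻¹ * ρ * g
  else (scaleElt e ρ (g⁻¹ * ρ * g) (zetaElt e ρ g))⁻¹ * (g⁻¹ * ρ * g) *
    scaleElt e ρ (g⁻¹ * ρ * g) (zetaElt e ρ g)

/-- The conjugate `g⁻¹ρg` is `lower (g₁₀²)` conjugated by some `upper m`, which fixes all of `U` and
in particular `zetaElt`. Hence rescaling may be computed with `m = 0` and transported back. -/
theorem isPartner_candidate
    (he : ∀ z : SL(2, F), z.val 0 0 + z.val 1 1 ≠ 0 → z ^ e * z ^ e = z) {g : SL(2, F)}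
    (hg : g ∉ badSet F) : IsPartner (upper 1) (candidate e (upper 1) g) := by
  have h2 : (2 : F) = 0 := two_eq_zero'
  obtain ⟨hg, hg'⟩ := not_or.1 hg
  have hg' := not_and.1 hg'
  obtain ⟨g00, g01, g10, g11⟩ := conj_upper_one_apply g
  obtain ⟨m00, m01, m10, m11⟩ := upper_inv_mul_lower_mul_upper (g.val 1 1 / g.val 1 0)
    (g.val 1 0 ^ 2)
  have ht : g⁻¹ * upper 1 * g = (upper (g.val 1 1 / g.val 1 0))⁻¹ * lower (g.val 1 0 ^ 2) *
      upper (g.val 1 1 / g.val 1 0) := by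
    refine sl_ext ?_ ?_ ?_ ?_
    · rw [g00, m00]; field_simp
    · rw [g01, m01]; field_simp
    · rw [g10, m10]
    · rw [g11, m11]; field_simp
  generalize g.val 1 1 / g.val 1 0 = m at *
  have fix : ∀ x : F, (upper m)⁻¹ * upper x * upper m = upper x := fun x => by
    rw [mul_assoc, upper_mul, add_comm, ← upper_mul, inv_mul_cancel_left]
  have hpart : IsPartner (upper 1) ((upper m)⁻¹ * lower 1 * upper m) := by
    have := (isPartner_map (MulAut.conj (upper m)⁻¹)).2 (isPartner_upper_lower (F := F))
    simpa [fix] using this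
  unfold candidate
  rw [zetaElt_upper he hg, ht]
  split_ifs with hy
  -- The excluded values of `zetaElt` mean trace `g₁₀` or `0`, which off the bad set happens only
  -- over the field of two elements. There `g₁₀ = 1`, and no rescaling is needed.
  · have hq : Nat.card F = 2 := by
      by_contra hq
      obtain ⟨h0, h1⟩ := not_or.1 (hg' hq)
      rw [← upper_zero, upper_injective.eq_iff, upper_injective.eq_iff] at hy
      rcases hy with hy | hy <;> field_simp at hy
      · exact h1 (by linear_combination hy - g.val 1 0 * h2)
      · exact h0 (by linear_combination hy)
    have : g.val 1 0 = 1 := by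
      have : Finite F := Nat.finite_of_card_ne_zero (by omega)
      have : Fintype F := Fintype.ofFinite F
      have h := FiniteField.pow_card_sub_one_eq_one _ hg
      rwa [← Nat.card_eq_fintype_card, hq, pow_one] at h
    rw [this, one_pow]
    exact hpart
  · obtain ⟨hy, hy'⟩ := not_or.1 hy
    rw [← upper_zero, upper_injective.eq_iff] at hy
    rw [upper_injective.eq_iff] at hy'
    have key := scaleElt_conj_lower he (pow_ne_zero 2 hg) hy hy'
    generalize (1 + (g.val 0 0 + g.val 1 1) / g.val 1 0) = y at *
    have h3 := map_scaleElt (MulAut.conj (upper m)⁻¹) e (upper 1) (lower (g.val 1 0 ^ 2)) (upper y)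
    simp only [MulAut.conj_apply, inv_inv, fix] at h3
    rw [← h3]
    convert hpart using 1
    rw [← key]
    group

/-- Let `q = |F|`. Each of the three conditions allows at most `q(q - 1)` matrices, out of at least
`q(q - 1)(q + 1)`. For `q ≥ 4` this gives the proportion `3 / (q + 1) ≤ 3/5`; for `q = 2` only the
first condition is present. -/
theorem ncard_badSet_le [Finite F] : 5 * (badSet F).ncard ≤ 3 * Nat.card SL(2, F) := by
  classical
  choose f₁ a₁ b₁ c₁ d₁ using fun x : Fˣ × F => exists_sl (a := (x.1 : F)) (b := x.2) (c := 0)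
    (d := (x.1 : F)⁻¹) (by simp)
  choose f₂ a₂ b₂ c₂ d₂ using fun (x : Fˣ × F) (d : F) => exists_sl (a := x.2)
    (b := (x.2 * d - 1) / x.1) (c := (x.1 : F)) (d := d) (by field_simp; ring)
  have card_units : Nat.card F = Nat.card Fˣ + 1 := by
    exact Nat.card_eq_card_units_add_one F
  have hN : Nat.card (Fˣ × F) = Nat.card Fˣ * Nat.card F := Nat.card_prod _ _
  have lower_bound : Nat.card (Fˣ × F) * (Nat.card F + 1) ≤ Nat.card SL(2, F) := by
    rw [← Finite.card_option, ← Nat.card_prod]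
    -- `none` parametrises upper triangular matrices, `some d` those with nonzero lower left entry
    -- and lower right entry `d`.
    refine Nat.card_le_card_of_injective
      (fun x : (Fˣ × F) × Option F => x.2.elim (f₁ x.1) (f₂ x.1)) ?_
    rintro ⟨⟨x, y⟩, d⟩ ⟨⟨x', y'⟩, d'⟩ h
    have h00 := congrArg (fun g => g.val 0 0) h
    have h01 := congrArg (fun g => g.val 0 1) h
    have h10 := congrArg (fun g => g.val 1 0) h
    have h11 := congrArg (fun g => g.val 1 1) h
    cases d <;> cases d' <;>
      simp only [Option.elim, a₁, a₂, b₁, b₂, c₁, c₂, d₁, d₂] at h00 h01 h10 h11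
    · simp [h01, Units.ext h00]
    · exact absurd h10.symm (Units.ne_zero _)
    · exact absurd h10 (Units.ne_zero _)
    · simp [h00, Units.ext h10, h11]
  have image_le : ∀ f : Fˣ × F → SL(2, F), (f '' Set.univ).ncard ≤ Nat.card (Fˣ × F) := fun f =>
    (Set.ncard_image_le Set.finite_univ).trans (by rw [Set.ncard_univ])
  have sl_eq₁ : ∀ g : SL(2, F), g.val 1 0 = 0 → g ∈ f₁ '' Set.univ := by
    intro g h
    have hd := sl_det g
    rw [h, mul_zero, sub_zero] at hd
    refine ⟨(Units.mk0 _ (left_ne_zero_of_mul_eq_one hd), g.val 0 1), trivial, ?_⟩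
    refine sl_ext (a₁ _) (b₁ _) (by rw [c₁, h]) ((d₁ _).trans ?_)
    exact inv_eq_of_mul_eq_one_right hd
  have sl_eq₂ : ∀ (g : SL(2, F)) (d : Fˣ × F → F) (h : g.val 1 0 ≠ 0),
      d (Units.mk0 _ h, g.val 0 0) = g.val 1 1 → g ∈ (fun x => f₂ x (d x)) '' Set.univ := by
    intro g d h hdd
    have hd := sl_det g
    refine ⟨(Units.mk0 _ h, g.val 0 0), trivial, ?_⟩
    refine sl_ext (a₂ _ _) ((b₂ _ _).trans ?_) (c₂ _ _) ((d₂ _ _).trans hdd)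
    rw [hdd, Units.val_mk0, div_eq_iff h]
    linear_combination hd
  by_cases hq : Nat.card F = 2
  · have : badSet F ⊆ f₁ '' Set.univ := by
      rintro g (h | ⟨h, _⟩)
      · exact sl_eq₁ g h
      · exact absurd hq h
    have := (Set.ncard_le_ncard this (Set.toFinite _)).trans (image_le f₁)
    rw [hq] at lower_bound
    omega
  · have h4 : 4 ≤ Nat.card F := by
      have : Fintype F := Fintype.ofFinite F
      obtain ⟨n, -, hn⟩ := FiniteField.card F 2
      rw [Nat.card_eq_fintype_card, hn] at hq ⊢
      have hn1 : (n : ℕ) ≠ 1 := fun h => hq (by rw [h, pow_one])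
      have := n.pos
      exact Nat.pow_le_pow_right (n := 2) (i := 2) (by norm_num) (by omega)
    have : badSet F ⊆ (f₁ '' Set.univ ∪ (fun x => f₂ x x.2) '' Set.univ) ∪
        (fun x => f₂ x (x.2 + x.1)) '' Set.univ := by
      intro g hg
      by_cases h : g.val 1 0 = 0
      · exact Or.inl (Or.inl (sl_eq₁ g h))
      rcases hg with hg | ⟨_, hg | hg⟩
      · exact absurd hg h
      · exact Or.inl (Or.inr (sl_eq₂ g (fun x => x.2) h (CharTwo.add_eq_zero.1 hg)))
      · refine Or.inr (sl_eq₂ g (fun x => x.2 + x.1) h ?_)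
        have h2 : (2 : F) = 0 := two_eq_zero'
        simp only [Units.val_mk0]
        linear_combination -hg + g.val 0 0 * h2
    have h1 := Set.ncard_le_ncard this (Set.toFinite _)
    have h2 := Set.ncard_union_le (f₁ '' Set.univ ∪ (fun x => f₂ x x.2) '' Set.univ)
      ((fun x => f₂ x (x.2 + x.1)) '' Set.univ)
    have h3 := Set.ncard_union_le (f₁ '' Set.univ) ((fun x => f₂ x x.2) '' Set.univ)
    have i1 := image_le f₁
    have i2 := image_le fun x => f₂ x x.2
    have i3 := image_le fun x => f₂ x (x.2 + x.1)
    have : Nat.card (Fˣ × F) * 5 ≤ Nat.card (Fˣ × F) * (Nat.card F + 1) :=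
      Nat.mul_le_mul_left _ (by omega)
    omega

end

/-! ### Uniform field elements from uniform group elements -/

section

variable {F : Type} [Field F]

open Classical in
/-- The field element which is produced from the group element `g`. -/
noncomputable def sampleField (g : SL(2, F)) : F :=
  if g.val 1 0 = 0 then 1 + ((g * lower 1).val 0 0 + (g * lower 1).val 1 1) / (g * lower 1).val 1 0
  else 1 + (g.val 0 0 + g.val 1 1) / g.val 1 0

/-- Left multiplication by `upper x` keeps the bottom row and adds `x · g₁₀` to the trace. It also
commutes with the correction by `lower 1` on the right. -/
theorem sampleField_upper_mul (x : F) (g : SL(2, F)) :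
    sampleField (upper x * g) = x + sampleField g := by
  have key : ∀ g : SL(2, F), g.val 1 0 ≠ 0 → 1 + ((upper x * g).val 0 0 + (upper x * g).val 1 1) /
      (upper x * g).val 1 0 = x + (1 + (g.val 0 0 + g.val 1 1) / g.val 1 0) := by
    intro g hg
    simp only [sl_mul_apply, upper_00, upper_01, upper_10, upper_11, zero_mul, one_mul, zero_add]
    field_simp
    ring
  have h10 : (upper x * g).val 1 0 = g.val 1 0 := by
    simp only [sl_mul_apply, upper_10, upper_11]; ring
  unfold sampleField
  rw [h10]
  split_ifs with h
  · rw [mul_assoc]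
    refine key _ fun h' => ?_
    simp only [sl_mul_apply, lower_00, lower_10, h] at h'
    have hd := sl_det g
    rw [h] at hd
    simp at h' hd
    simp [h'] at hd
  · have := key g h
    rwa [h10] at this

/-- By equivariance `U` permutes the fibres simply transitively, so they all have the same size. -/
theorem ncard_preimage_sampleField [Finite F] (S : Set F) :
    (sampleField ⁻¹' S : Set SL(2, F)).ncard * Nat.card F = S.ncard * Nat.card SL(2, F) := by
  have h0 : ∀ T : Set F, (sampleField ⁻¹' T : Set SL(2, F)).ncard =
      T.ncard * (sampleField ⁻¹' {0} : Set SL(2, F)).ncard := by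
    intro T
    rw [← Nat.card_coe_set_eq, ← Nat.card_coe_set_eq, ← Nat.card_coe_set_eq, ← Nat.card_prod]
    refine Nat.card_congr
      { toFun := fun g => (⟨sampleField g.1, g.2⟩, ⟨upper (-sampleField g.1) * g.1, ?_⟩)
        invFun := fun p => ⟨upper p.1.1 * p.2.1, ?_⟩
        left_inv := ?_
        right_inv := ?_ }
    · simp [sampleField_upper_mul]
    · have : sampleField p.2.1 = 0 := p.2.2
      simp [sampleField_upper_mul, this]
    · rintro ⟨g, hg⟩
      simp [← mul_assoc, upper_mul, upper_zero]
    · rintro ⟨⟨x, hx⟩, ⟨g, hg⟩⟩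
      have : sampleField g = 0 := hg
      simp [sampleField_upper_mul, this, ← mul_assoc, upper_mul, upper_zero]
  have h1 := h0 Set.univ
  rw [Set.preimage_univ, Set.ncard_univ, Set.ncard_univ] at h1
  rw [h0 S, h1]
  ring

end

/-! ### The field interpreted in the Borel subgroup -/

section

variable {F : Type} [Field F] {G : Type} [Group G]

/-- The decoding of strings, in coordinates given by an isomorphism with `SL₂`. -/
def Encryption.coord (X : Encryption G) (γ : SL(2, F) ≃* G) (x : List Bool) : Option SL(2, F) :=
  (X.decode x).map γ.symm

theorem Encryption.coord_eq_some {X : Encryption G} {γ : SL(2, F) ≃* G} {x : List Bool}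
    {g : SL(2, F)} : X.coord γ x = some g ↔ X.decode x = some (γ g) := by
  simp [Encryption.coord, MulEquiv.symm_apply_eq]

theorem BlackBoxGroup.faithful (X : BlackBoxGroup G) (γ : SL(2, F) ≃* G) :
    X.toOracle.Faithful (X.coord γ) where
  mul x y g h hx hy z hz := by
    rw [Encryption.coord_eq_some] at *
    rw [map_mul]
    exact X.mul_spec x y _ _ hx hy z hz
  inv x g hx z hz := by
    rw [Encryption.coord_eq_some] at *
    rw [map_inv]
    exact X.inv_spec x _ hx z hz
  eq x y g h hx hy := by
    rw [Encryption.coord_eq_some] at *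
    rw [X.eq_spec x y _ _ hx hy, γ.injective.eq_iff]

/-- The element `b` of the standard Borel subgroup stands for the field element `x`. -/
def Represents (b : SL(2, F)) (x : F) : Prop :=
  b.val 1 0 = 0 ∧ (x = 0 → b.val 1 1 = 1) ∧ (x ≠ 0 → b.val 1 1 ^ 2 = x)

def Encryption.IsFieldString (X : Encryption G) (γ : SL(2, F) ≃* G) (a : List Bool) (x : F) :
    Prop :=
  ∃ t s b, a = t ++ s ∧ X.coord γ t = some b ∧ X.coord γ s = some (upper x) ∧ Represents b x

theorem Encryption.coord_length {X : Encryption G} {γ : SL(2, F) ≃* G} {x : List Bool}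
    {g : SL(2, F)} (h : X.coord γ x = some g) : x.length = X.len :=
  X.length_eq _ _ (coord_eq_some.1 h)

/-- The fixed length of strings determines the cut, and the second half alone determines `x`. -/
theorem Encryption.IsFieldString.unique {X : Encryption G} {γ : SL(2, F) ≃* G} {a : List Bool}
    {x y : F} (hx : X.IsFieldString γ a x) (hy : X.IsFieldString γ a y) : x = y := by
  obtain ⟨t, s, b, rfl, ht, hs, -⟩ := hx
  obtain ⟨t', s', b', h, ht', hs', -⟩ := hy
  obtain ⟨rfl, rfl⟩ := List.append_inj h
    ((coord_length ht).trans (coord_length ht').symm)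
  rw [hs, Option.some_inj, upper_injective.eq_iff] at hs'
  exact hs'

theorem exists_represents [CharP F 2] [Finite F] (x : F) : ∃ b : SL(2, F), Represents b x := by
  by_cases hx : x = 0
  · exact ⟨1, by simp, by simp, fun h => absurd hx h⟩
  · obtain ⟨b, h1, h2⟩ := exists_borel_elt hx
    exact ⟨b, h1, fun h => absurd h hx, fun _ => h2⟩

open Classical in
/-- The encryption of the field by pairs of strings. -/
noncomputable def Encryption.field [CharP F 2] [Finite F] (X : Encryption G) (γ : SL(2, F) ≃* G) :
    Encryption F where
  len := X.len + X.len
  decode a := if h : ∃ x, X.IsFieldString γ a x then some h.choose else none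
  length_eq a x h := by
    split_ifs at h with h'
    obtain ⟨t, s, b, ha, ht, hs, -⟩ := h'.choose_spec
    rw [ha, List.length_append, coord_length ht, coord_length hs]
  surj x := by
    obtain ⟨b, hb⟩ := exists_represents x
    obtain ⟨t, ht⟩ := X.surj (γ b)
    obtain ⟨s, hs⟩ := X.surj (γ (upper x))
    have h : X.IsFieldString γ (t ++ s) x :=
      ⟨t, s, b, rfl, coord_eq_some.2 ht, coord_eq_some.2 hs, hb⟩
    refine ⟨t ++ s, ?_⟩
    have h' : ∃ x, X.IsFieldString γ (t ++ s) x := ⟨x, h⟩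
    rw [dif_pos h', h'.choose_spec.unique h]

theorem Encryption.field_decode [CharP F 2] [Finite F] {X : Encryption G} {γ : SL(2, F) ≃* G}
    {a : List Bool} {x : F} : (X.field γ).decode a = some x ↔ X.IsFieldString γ a x := by
  simp only [Encryption.field]
  constructor
  · intro h
    split_ifs at h with h'
    rw [← Option.some_inj.1 h]
    exact h'.choose_spec
  · intro h
    have h' : ∃ x, X.IsFieldString γ a x := ⟨x, h⟩
    rw [dif_pos h', h'.choose_spec.unique h]

theorem mem_cent_iff (γ : SL(2, F) ≃* G) (g : SL(2, F)) :
    γ g ∈ cent (γ (upper 1)) ↔ g.val 1 0 = 0 ∧ g.val 0 0 = g.val 1 1 := by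
  rw [Subgroup.mem_centralizer_singleton_iff, ← map_mul, ← map_mul, γ.injective.eq_iff,
    ← commute_upper_one_iff]

theorem mem_cent_iff_exists [CharP F 2] (γ : SL(2, F) ≃* G) (g : G) :
    g ∈ cent (γ (upper 1)) ↔ ∃ x, g = γ (upper x) := by
  obtain ⟨g, rfl⟩ := γ.surjective g
  rw [mem_cent_iff]
  constructor
  · rintro ⟨h1, h2⟩
    refine ⟨g.val 0 1, congrArg γ (eq_upper h1 ?_)⟩
    have hd := sl_det g
    rw [h1, h2] at hd
    exact eq_of_sq_eq_sq (by linear_combination hd)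
  · rintro ⟨x, hx⟩
    rw [γ.injective hx, upper_10, upper_00, upper_11]
    exact ⟨rfl, rfl⟩

/-- An element normalising `U` conjugates `ρ` into `U`, and the lower left entry of `gρg⁻¹` is
`-g₁₀²`. -/
theorem mem_borel_iff [CharP F 2] (γ : SL(2, F) ≃* G) (g : SL(2, F)) :
    γ g ∈ borel (γ (upper 1)) ↔ g.val 1 0 = 0 := by
  have key : ∀ g : SL(2, F), g.val 1 0 = 0 → ∀ h ∈ cent (γ (upper 1)),
      γ g * h * (γ g)⁻¹ ∈ cent (γ (upper 1)) := by
    intro g hg h hh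
    obtain ⟨x, rfl⟩ := (mem_cent_iff_exists γ h).1 hh
    rw [← map_inv, ← map_mul, ← map_mul, mul_upper_mul_inv hg, mem_cent_iff_exists]
    exact ⟨_, rfl⟩
  rw [Subgroup.mem_normalizer_iff]
  constructor
  · intro h
    have h := (h (γ (upper 1))).1 ((mem_cent_iff_exists γ _).2 ⟨1, rfl⟩)
    rw [← map_inv, ← map_mul, ← map_mul] at h
    have h := ((mem_cent_iff γ _).1 h).1
    simp only [sl_mul_apply, upper_00, upper_01, upper_10, upper_11, sl_inv_00, sl_inv_10] at h
    have : g.val 1 0 ^ 2 = 0 := by linear_combination -h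
    exact (pow_eq_zero_iff two_ne_zero).1 this
  · intro hg h
    refine ⟨key g hg h, fun hh => ?_⟩
    have := key g⁻¹ (by rw [sl_inv_10, hg, neg_zero]) _ hh
    rw [map_inv] at this
    convert this using 1
    group

/-- The character of the Borel subgroup is the square of the lower right entry; injectivity of
squaring makes its kernel `U`. -/
theorem isInterpretedInBorel_field [CharP F 2] [Finite F] (X : Encryption G)
    (γ : SL(2, F) ≃* G) : IsInterpretedInBorel X (γ (upper 1)) (X.field γ) := by
  let unipHom : Multiplicative F →* cent (γ (upper 1)) :=
    MonoidHom.mk' (fun x => ⟨γ (upper x.toAdd), (mem_cent_iff_exists γ _).2 ⟨_, rfl⟩⟩)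
      (fun x y => Subtype.ext (by simp [← map_mul, upper_mul]))
  have bij : Function.Bijective unipHom := by
    constructor
    · intro x y h
      have h := congrArg Subtype.val h
      exact Multiplicative.toAdd.injective (upper_injective (γ.injective h))
    · rintro ⟨g, hg⟩
      obtain ⟨x, rfl⟩ := (mem_cent_iff_exists γ _).1 hg
      exact ⟨Multiplicative.ofAdd x, rfl⟩
  have hb : ∀ b : borel (γ (upper 1)), (γ.symm b).val 1 0 = 0 := fun b => by
    rw [← mem_borel_iff γ, γ.apply_symm_apply]; exact b.2
  have hne : ∀ b : borel (γ (upper 1)), (γ.symm b).val 1 1 ^ 2 ≠ 0 := fun b => by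
    have hd := sl_det (γ.symm b)
    rw [hb b, mul_zero, sub_zero] at hd
    exact pow_ne_zero 2 (right_ne_zero_of_mul_eq_one hd)
  let tor : borel (γ (upper 1)) →* Fˣ := MonoidHom.mk' (fun b => Units.mk0 _ (hne b))
    (fun b c => Units.ext (by
      simp only [Subgroup.coe_mul, map_mul, sl_mul_apply, hb b, Units.val_mk0, Units.val_mul]
      ring))
  have htor : ∀ b, (tor b : F) = (γ.symm b).val 1 1 ^ 2 := fun b => rfl
  have hunip : ∀ x : F, ((MulEquiv.ofBijective unipHom bij (Multiplicative.ofAdd x) :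
      cent (γ (upper 1))) : G) = γ (upper x) := fun x => rfl
  have hker : ∀ b : borel (γ (upper 1)), (b : G) ∈ cent (γ (upper 1)) ↔
      (γ.symm b).val 1 1 = 1 := by
    intro b
    rw [← γ.apply_symm_apply (b : G), mem_cent_iff, γ.symm_apply_apply]
    have hd := sl_det (γ.symm b)
    rw [hb b, mul_zero, sub_zero] at hd
    constructor
    · rintro ⟨-, h⟩
      rw [h] at hd
      exact eq_of_sq_eq_sq (by linear_combination hd)
    · intro h
      rw [h, mul_one] at hd
      exact ⟨hb b, by rw [h, hd]⟩
  refine ⟨MulEquiv.ofBijective unipHom bij, tor, hunip 1, ?_, fun b x => ?_, fun a x => ?_⟩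
  · ext b
    rw [MonoidHom.mem_ker, Subgroup.mem_subgroupOf, hker, Units.ext_iff, htor, Units.val_one]
    exact ⟨fun h => eq_of_sq_eq_sq (by rw [h, one_pow]), fun h => by rw [h, one_pow]⟩
  · rw [hunip, hunip, htor]
    have := congrArg γ (inv_mul_upper_mul (hb b) x)
    simpa using this
  · rw [Encryption.field_decode]
    constructor
    · rintro ⟨t, s, b, rfl, ht, hs, hb10, h0, h1⟩
      rw [Encryption.coord_eq_some] at ht hs
      refine ⟨t, s, ⟨γ b, (mem_borel_iff γ b).2 hb10⟩, rfl, ht, by rw [hunip]; exact hs, ?_⟩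
      rw [hker, htor]
      simp only [γ.symm_apply_apply]
      by_cases hx : x = 0
      · exact Or.inl ⟨hx, h0 hx⟩
      · exact Or.inr ⟨hx, h1 hx⟩
    · rintro ⟨t, s, b, rfl, ht, hs, h⟩
      refine ⟨t, s, γ.symm b, rfl, Encryption.coord_eq_some.2 (by rw [γ.apply_symm_apply]; exact ht),
        Encryption.coord_eq_some.2 hs, hb b, ?_⟩
      rw [hker, htor] at h
      rcases h with ⟨hx, h⟩ | ⟨hx, h⟩
      · exact ⟨fun _ => h, fun h' => absurd hx h'⟩
      · exact ⟨fun h' => absurd h' hx, fun _ => h⟩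

end

/-! ### The programs of the black box field and of the isomorphism -/

def GroupProg.block (l : List GroupProg) : GroupProg := l.foldr .seq .skip

/-- Prepare the registers, with `ρ` in `0` and its partner in `1`. -/
def setup₀ : Prog := .seq initProg (.seq (.mul 1 7 (loc 0)) (.mul 2 7 (loc 1)))

def setup₁ : Prog := .seq setup₀ (unpack 3 2 3)

def setup₂ : Prog := .seq setup₁ (unpack 4 4 5)

def setup₄ : Prog := .seq (.seq setup₂ (unpack 5 6 7)) (unpack 6 8 9)

/-- An element of the Borel subgroup which conjugates `ρ` to the element in `v`, computed with the
involution in `t`. -/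
def betaProg (t v out : Reg) : GroupProg :=
  .block [.mul 0 t 13, .root 13 13, .mul t v 14, .root 14 14, .mul 13 14 out]

/-- Put in `10` an element of the Borel subgroup standing for the element in `11`. -/
def completeProg : GroupProg := .ifeq 11 15 (.mul 15 15 10) (betaProg 1 11 10)

/-- Borel representatives do not add, so the first half is recomputed from the sum. -/
def addBody : GroupProg := .seq (.mul 3 5 11) completeProg

def zeroBody : GroupProg := .block [.mul 15 15 10, .mul 15 15 11]

/-- Zero has to be treated separately: its representative lies in `U` and does not act as
multiplication by zero. -/
def mulBody : GroupProg :=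
  .ifeq 3 15 zeroBody (.ifeq 5 15 zeroBody
    (.block [.mul 2 4 10, .inv 4 12, .mul 12 3 11, .mul 11 4 11]))

def invBody : GroupProg := .block [.inv 2 10, .mul 2 0 11, .mul 11 10 11]

/-- The element of the centralizer of `ρ` computed from the element in `2`. -/
def zetaProg : GroupProg :=
  .block [.inv 2 10, .mul 10 0 11, .mul 11 2 11, .mul 11 0 11, .root 11 11, .mul 2 11 11]

/-- The case distinction of `sampleField` is visible in the group: `g₁₀ = 0` exactly when `g⁻¹ρg`
commutes with `ρ`. -/
def genBody : GroupProg :=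
  .seq (.block [.inv 2 10, .mul 10 0 11, .mul 11 2 11, .mul 11 0 12, .mul 0 11 13])
    (.seq (.ifeq 12 13 (.mul 2 1 2) .skip) (.seq zetaProg completeProg))

/-- Register `14` receives the Weyl element `ρtρ`. If the lower left entry is zero, `g * lower 1` is
factored instead, and the last multiplication by `t` undoes the change. -/
def morphismBody : GroupProg :=
  .seq (.block [.mul 0 1 14, .mul 14 0 14])
    (.ifeq 7 15
      (.block [.mul 3 5 10, .mul 10 0 10, .mul 8 10 10, .inv 8 12, .mul 10 12 10, .mul 14 9 11,
        .mul 11 14 11, .mul 10 11 10, .mul 8 9 11, .mul 11 0 11, .mul 11 12 11, .mul 10 11 10,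
        .mul 10 1 10])
      (.block [.mul 3 0 10, .mul 6 10 10, .inv 6 12, .mul 10 12 10, .mul 14 7 11,
        .mul 11 14 11, .mul 10 11 10, .mul 6 9 11, .mul 11 0 11, .mul 11 12 11, .mul 10 11 10]))

def fieldOp (setup : Prog) (P : GroupProg) (i j : Reg) : Prog :=
  .seq setup (.seq P.compile (pack i j))

/-- The data are the digits of `m`, where `E = 2^a (2m + 1)`, the string `r`, and a string for a
partner. Zero and one are the pairs `(1, 1)` and `(1, ρ)`; negation only repacks its argument, the
characteristic being two. -/
def recoveryAlgorithm (construct : Prog) : RecoveryAlgorithm where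
  construct := construct
  arity := 3
  zero := fieldOp setup₀ .skip 15 14
  one := fieldOp setup₀ .skip 15 0
  add := fieldOp setup₂ addBody 10 11
  neg := fieldOp setup₁ .skip 2 3
  mul := fieldOp setup₂ mulBody 10 11
  inv := fieldOp setup₁ invBody 10 11
  eq := .seq setup₂ (.eq (loc 3) (loc 5) 0)
  gen := .seq setup₀ (.seq (.gen (loc 2)) (.seq genBody.compile (pack 10 11)))
  morphism := .seq setup₄ (.seq morphismBody.compile (.mul (loc 10) 7 0))

/-! ### Effects of the group programs -/

section

variable {H : Type} [Group H] (e : ℕ) (σ : Reg → H)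

open Classical in
theorem eval_completeProg : completeProg.eval e σ 11 = σ 11 ∧
    completeProg.eval e σ 10 = if σ 11 = σ 15 then σ 15 * σ 15
      else betaElt e (σ 0) (σ 1) (σ 11) := by
  simp only [completeProg, GroupProg.eval]
  split_ifs with h
  · simp [Function.update]
  · simp [betaProg, GroupProg.block, GroupProg.eval, Function.update, betaElt]

theorem eval_zetaProg : zetaProg.eval e σ 11 = zetaElt e (σ 0) (σ 2) ∧
    ∀ i, i ≠ 10 → i ≠ 11 → zetaProg.eval e σ i = σ i := by
  constructor
  · simp [zetaProg, GroupProg.block, GroupProg.eval, Function.update, zetaElt]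
  · intro i h1 h2
    simp [zetaProg, GroupProg.block, GroupProg.eval, h1, h2]

open Classical in
theorem eval_genBody (h15 : σ 15 = 1) {g' : H}
    (hg : g' = if (σ 2)⁻¹ * σ 0 * σ 2 * σ 0 = σ 0 * ((σ 2)⁻¹ * σ 0 * σ 2) then σ 2 * σ 1 else σ 2) :
    genBody.eval e σ 11 = zetaElt e (σ 0) g' ∧
    genBody.eval e σ 10 = if zetaElt e (σ 0) g' = 1 then 1
      else betaElt e (σ 0) (σ 1) (zetaElt e (σ 0) g') := by
  obtain ⟨σ', hσ', h0, h1, h2, h15'⟩ : ∃ σ' : Reg → H,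
      genBody.eval e σ = completeProg.eval e (zetaProg.eval e σ') ∧
      σ' 0 = σ 0 ∧ σ' 1 = σ 1 ∧ σ' 2 = g' ∧ σ' 15 = 1 := by
    simp only [genBody, GroupProg.eval]
    refine ⟨_, rfl, ?_⟩
    by_cases h : (σ 2)⁻¹ * σ 0 * σ 2 * σ 0 = σ 0 * ((σ 2)⁻¹ * σ 0 * σ 2) <;>
      simp [GroupProg.block, GroupProg.eval, h, hg, h15]
  obtain ⟨z1, z2⟩ := eval_zetaProg e σ'
  obtain ⟨c1, c2⟩ := eval_completeProg e (zetaProg.eval e σ')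
  rw [hσ', c1, c2, z1, z2 15 (by decide) (by decide), z2 0 (by decide) (by decide),
    z2 1 (by decide) (by decide), h0, h1, h2, h15', mul_one]
  exact ⟨rfl, rfl⟩

end

/-! ### Correctness of the loading phase -/

section

variable {H : Type} [Group H] {O : Oracle} {dec : List Bool → Option H}

/-- The state of the group registers after the loading phase, without arguments. -/
def state₀ (ρ t : H) : Reg → H := Function.update (Function.update (fun _ => 1) 0 ρ) 1 t

def state₁ (ρ t : H) (b u : H) : Reg → H :=
  Function.update (Function.update (state₀ ρ t) 2 b) 3 u

def state₂ (ρ t : H) (b u b' u' : H) : Reg → H :=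
  Function.update (Function.update (state₁ ρ t b u) 4 b') 5 u'

def state₄ (ρ t : H) (b u b' u' b'' u'' b₃ u₃ : H) : Reg → H :=
  Function.update (Function.update (Function.update (Function.update
    (state₂ ρ t b u b' u') 6 b'') 7 u'') 8 b₃) 9 u₃

theorem runs_setup₀ (hO : O.Faithful dec) {ρ t : H} (hρ : ρ * ρ = 1) {f r st : List Bool}
    (hr : dec r = some ρ) (ht : dec st = some t) {args : List (List Bool)}
    (hargs : args.length ≤ 4) :
    Runs O setup₀ (initStore ([f, r, st] ++ args)) 39 fun s =>
      Rel dec (initStore ([f, r, st] ++ args)) s (state₀ ρ t) := by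
  have hlen : ([f, r, st] ++ args).length ≤ 7 := by simp; omega
  refine Runs.seq (T₁ := 35) (T₂ := 3) (runs_initProg hO hρ hr ?_ ?_) fun s hs =>
    Runs.seq (T₁ := 1) (T₂ := 1) (runs_load hO hs (a := 1) (by norm_num) hr 0) fun s hs =>
      runs_load hO hs (a := 2) (by norm_num) ht 1
  · exact List.getD_eq_default _ _ (by omega)
  · exact List.getD_eq_default _ _ (by omega)

theorem runs_setup₁ (hO : O.Faithful dec) {ρ t : H} (hρ : ρ * ρ = 1) {f r st : List Bool}
    (hr : dec r = some ρ) (ht : dec st = some t) {x y : List Bool} {b u : H}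
    (hxr : x.length = r.length) (hx : dec x = some b) (hy : dec y = some u)
    {args : List (List Bool)} (hargs : args.length ≤ 3) :
    Runs O setup₁ (initStore ([f, r, st] ++ (x ++ y) :: args)) (22 * r.length + 62) fun s =>
      Rel dec (Function.update (initStore ([f, r, st] ++ (x ++ y) :: args)) 3 y) s
        (state₁ ρ t b u) :=
  (Runs.seq (runs_setup₀ hO hρ hr ht (by simp; omega)) fun s hs =>
    runs_unpack hO hs (a := 3) (by norm_num) (by norm_num) (m := x) (u := y) rfl hxr hx hy 2 3).mono
    (by simp [initStore]; omega) fun _ => id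

theorem runs_setup₂ (hO : O.Faithful dec) {ρ t : H} (hρ : ρ * ρ = 1) {f r st : List Bool}
    (hr : dec r = some ρ) (ht : dec st = some t) {x y x' y' : List Bool} {b u b' u' : H}
    (hxr : x.length = r.length) (hx : dec x = some b) (hy : dec y = some u)
    (hxr' : x'.length = r.length) (hx' : dec x' = some b') (hy' : dec y' = some u')
    {args : List (List Bool)} (hargs : args.length ≤ 2) :
    Runs O setup₂ (initStore ([f, r, st] ++ (x ++ y) :: (x' ++ y') :: args))
      (44 * r.length + 85) fun s =>
      Rel dec (Function.update (Function.update
          (initStore ([f, r, st] ++ (x ++ y) :: (x' ++ y') :: args)) 3 y) 4 y') s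
        (state₂ ρ t b u b' u') :=
  (Runs.seq (runs_setup₁ hO hρ hr ht hxr hx hy (by simp; omega)) fun s hs =>
    runs_unpack hO hs (a := 4) (by norm_num) (by norm_num) (m := x') (u := y') rfl hxr' hx' hy'
      4 5).mono (by simp [initStore]; omega) fun _ => id

theorem runs_setup₄ (hO : O.Faithful dec) {ρ t : H} (hρ : ρ * ρ = 1) {f r st : List Bool}
    (hr : dec r = some ρ) (ht : dec st = some t) {x y x' y' x'' y'' x₃ y₃ : List Bool}
    {b u b' u' b'' u'' b₃ u₃ : H}
    (hxr : x.length = r.length) (hx : dec x = some b) (hy : dec y = some u)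
    (hxr' : x'.length = r.length) (hx' : dec x' = some b') (hy' : dec y' = some u')
    (hxr'' : x''.length = r.length) (hx'' : dec x'' = some b'') (hy'' : dec y'' = some u'')
    (hxr₃ : x₃.length = r.length) (hx₃ : dec x₃ = some b₃) (hy₃ : dec y₃ = some u₃) :
    Runs O setup₄ (initStore ([f, r, st] ++ [x ++ y, x' ++ y', x'' ++ y'', x₃ ++ y₃]))
      (88 * r.length + 131) fun s => ∃ fr, fr 0 = f ∧
      Rel dec fr s (state₄ ρ t b u b' u' b'' u'' b₃ u₃) :=
  (Runs.seq (Runs.seq (runs_setup₂ hO hρ hr ht hxr hx hy hxr' hx' hy' (by simp)) fun s hs =>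
    runs_unpack hO hs (a := 5) (by norm_num) (by norm_num) (m := x'') (u := y'') rfl hxr'' hx'' hy''
      6 7) fun s hs =>
    runs_unpack hO hs (a := 6) (by norm_num) (by norm_num) (m := x₃) (u := y₃) rfl hxr₃ hx₃ hy₃
      8 9).mono (by simp [initStore]; omega) fun _ hs => ⟨_, by simp [initStore], hs⟩

theorem runs_fieldOp (hO : O.Faithful dec) {n : ℕ} (hlen : ∀ x g, dec x = some g → x.length = n)
    {setup : Prog} {s : Store} {T : ℕ} {f : List Bool} {σ : Reg → H}
    (hs : Runs O setup s T fun s' => ∃ fr, fr 0 = f ∧ Rel dec fr s' σ) (P : GroupProg) {i j : Reg}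
    (hij : i ≠ j) {post : List Bool → Prop}
    (hpost : ∀ t u, dec t = some (P.eval (1 + bitsValue f) σ i) →
      dec u = some (P.eval (1 + bitsValue f) σ j) → post (t ++ u)) :
    Runs O (fieldOp setup P i j) s
      (T + P.size * (16 * (f.length + 1)) + 2 * f.length + 20 * n + 11) fun s' => post (s' 0) := by
  refine (Runs.seq (T₂ := P.size * (16 * (f.length + 1)) + 2 * f.length + 20 * n + 10) hs
    ?_).mono (by omega) fun _ => id
  rintro s' ⟨fr, rfl, hs'⟩
  refine (Runs.seq (runs_compile hO P hs') fun s'' hs'' =>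
    (runs_pack hlen hs'' hij).mono le_rfl ?_).mono (by omega) fun _ => id
  rintro s₃ ⟨t, u, h0, ht, hu⟩
  rw [h0]
  exact hpost t u ht hu

end

/-! ### Representatives of field elements in the Borel subgroup -/

section

variable {F : Type} [Field F]

theorem represents_one_zero : Represents (1 : SL(2, F)) 0 :=
  ⟨by simp, fun _ => by simp, fun h => absurd rfl h⟩

theorem represents_one_one : Represents (1 : SL(2, F)) 1 :=
  ⟨by simp, fun _ => by simp, fun _ => by simp⟩

theorem Represents.sq_eq {b : SL(2, F)} {x : F} (h : Represents b x) (hx : x ≠ 0) :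
    b.val 1 1 ^ 2 = x := h.2.2 hx

theorem Represents.mul {b b' : SL(2, F)} {x x' : F} (h : Represents b x) (h' : Represents b' x')
    (hx : x ≠ 0) (hx' : x' ≠ 0) : Represents (b * b') (x * x') := by
  have h11 : (b * b').val 1 1 = b.val 1 1 * b'.val 1 1 := by rw [sl_mul_apply, h.1]; ring
  refine ⟨by rw [sl_mul_apply, h.1, h'.1]; ring, fun h0 => absurd h0 (mul_ne_zero hx hx'),
    fun _ => by rw [h11, mul_pow, h.sq_eq hx, h'.sq_eq hx']⟩

theorem Represents.inv {b : SL(2, F)} {x : F} (h : Represents b x) (hx : x ≠ 0) :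
    Represents b⁻¹ x⁻¹ := by
  have hd := sl_det b
  rw [h.1, mul_zero, sub_zero] at hd
  refine ⟨by rw [sl_inv_10, h.1, neg_zero], fun h0 => absurd h0 (inv_ne_zero hx), fun _ => ?_⟩
  rw [sl_inv_11, eq_inv_of_mul_eq_one_left hd, inv_pow, h.sq_eq hx]

theorem upper_eq_one_iff {x : F} : upper x = 1 ↔ x = 0 := by
  rw [← upper_zero, upper_injective.eq_iff]

variable [CharP F 2] {e : ℕ}

open Classical in
theorem represents_complete
    (he : ∀ z : SL(2, F), z.val 0 0 + z.val 1 1 ≠ 0 → z ^ e * z ^ e = z) (x : F) :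
    Represents (if upper x = 1 then 1 else betaElt e (upper 1) (lower 1) (upper x)) x := by
  split_ifs with h
  · rw [upper_eq_one_iff] at h
    rw [h]
    exact represents_one_zero
  · rw [upper_eq_one_iff] at h
    obtain ⟨-, h10, h11⟩ := betaElt_apply he one_ne_zero h
    exact ⟨h10, fun h' => absurd h' h, fun _ => h11⟩

open Classical in
theorem zetaElt_sample
    (he : ∀ z : SL(2, F), z.val 0 0 + z.val 1 1 ≠ 0 → z ^ e * z ^ e = z) (g : SL(2, F)) :
    zetaElt e (upper 1) (if g⁻¹ * upper 1 * g * upper 1 = upper 1 * (g⁻¹ * upper 1 * g)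
      then g * lower 1 else g) = upper (sampleField g) := by
  simp only [conj_commute_iff, sampleField]
  split_ifs with h
  · refine zetaElt_upper he ?_
    have hd := sl_det g
    rw [h, mul_zero, sub_zero] at hd
    simp only [sl_mul_apply, h, lower_10, zero_mul, zero_add, mul_one]
    exact right_ne_zero_of_mul_eq_one hd
  · exact zetaElt_upper he h

end

/-! ### Random generation in the black box field -/

theorem toOuterMeasure_add_compl {α : Type*} (p : PMF α) (A : Set α) :
    p.toOuterMeasure A + p.toOuterMeasure Aᶜ = 1 := by
  rw [PMF.toOuterMeasure_apply, PMF.toOuterMeasure_apply, ← ENNReal.tsum_add]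
  rw [← p.tsum_coe]
  refine tsum_congr fun x => ?_
  by_cases h : x ∈ A <;> simp [h]

theorem toOuterMeasure_le_one {α : Type*} (p : PMF α) (A : Set α) : p.toOuterMeasure A ≤ 1 := by
  rw [← toOuterMeasure_add_compl p A]; exact le_self_add

theorem loss_gen_le {O : Oracle} {a : ℕ} {k : List Prog} {s : Store} {N : ℕ} {S : Store → Prop}
    {y : ℝ≥0∞} (bad : Set (List Bool))
    (h : ∀ z ∈ O.gen.support, z ∉ bad → loss O N (k, Function.update s a z) S = 0)
    (h' : ∀ z ∈ O.gen.support, loss O N (k, Function.update s a z) S ≤ y) :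
    loss O (1 + N) (.gen a :: k, s) S ≤ O.gen.toOuterMeasure bad * y := by
  rw [add_comm, loss_succ_of_step_eq_map (p := O.gen)
    (f := fun z => (k, Function.update s a z)) rfl]
  exact tsum_mul_le_toOuterMeasure_mul _ _ _ _ h h'

theorem loss_seq {O : Oracle} {P Q : Prog} {k : List Prog} {s : Store} {N : ℕ}
    {S : Store → Prop} : loss O (1 + N) (.seq P Q :: k, s) S = loss O N (P :: Q :: k, s) S := by
  rw [add_comm]; exact loss_succ_of_step_eq_pure rfl _ _

section

variable {F : Type} [Field F] {G : Type} [Group G]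

theorem BlackBoxGroup.exists_coord_of_mem_support_gen (X : BlackBoxGroup G) (γ : SL(2, F) ≃* G)
    {z : List Bool} (hz : z ∈ X.gen.support) : ∃ g, X.coord γ z = some g := by
  obtain ⟨g, hg⟩ := X.gen_spec.1 z hz
  exact ⟨γ.symm g, Encryption.coord_eq_some.2 (by rw [γ.apply_symm_apply, hg])⟩

theorem ncard_image_div_card [Finite F] (γ : SL(2, F) ≃* G) (S : Set F) :
    ((γ '' (sampleField ⁻¹' S)).ncard : ℝ) / (Nat.card G : ℝ) = (S.ncard : ℝ) / (Nat.card F : ℝ) := by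
  rw [Set.ncard_image_of_injective _ γ.injective, ← Nat.card_congr γ.toEquiv]
  have h := ncard_preimage_sampleField S
  have h1 : (Nat.card F : ℝ) ≠ 0 := by exact_mod_cast Nat.card_pos.ne'
  have h2 : (Nat.card SL(2, F) : ℝ) ≠ 0 := by exact_mod_cast Nat.card_pos.ne'
  rw [div_eq_div_iff h2 h1]
  exact_mod_cast h

end

section

variable {F : Type} [Field F] [CharP F 2] [Finite F] {G : Type} [Group G] {X : BlackBoxGroup G}
  {γ : SL(2, F) ≃* G}

theorem Encryption.field_decode_append {X : Encryption G} {t u : List Bool} {b : SL(2, F)} {x : F}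
    (ht : X.coord γ t = some b) (hu : X.coord γ u = some (upper x)) (hb : Represents b x) :
    (X.field γ).decode (t ++ u) = some x :=
  field_decode.2 ⟨t, u, b, rfl, ht, hu, hb⟩

/-- Only the query to `gen` matters: whatever strings the box returns later, the output encrypts
`sampleField` of the random element. -/
theorem loss_genProg_le {f r st : List Bool}
    (he : ∀ z : SL(2, F), z.val 0 0 + z.val 1 1 ≠ 0 →
      z ^ (1 + bitsValue f) * z ^ (1 + bitsValue f) = z)
    (hr : X.coord γ r = some (upper 1)) (ht : X.coord γ st = some (lower 1)) (S : Set F)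
    (construct : Prog) {T : ℕ} (hT : 2000 * (f.length + X.len + 1) ≤ T) :
    loss X.toOracle T ([(recoveryAlgorithm construct).gen], initStore [f, r, st])
      (fun s => ∃ x ∈ S, (X.field γ).decode (s 0) = some x) ≤
    X.gen.toOuterMeasure {z | ∃ g, X.coord γ z = some g ∧ sampleField g ∈ S}ᶜ := by
  classical
  have hO := X.faithful γ
  have hlen : ∀ x g, X.coord γ x = some g → x.length = X.len :=
    fun x g h => Encryption.coord_length h
  refine (loss_anti _ (N := 1 + (39 + (1 + (1 + (1 + (genBody.size * (16 * (f.length + 1)) +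
    (2 * f.length + 20 * X.len + 9 + 0))))))) ?_ _ _).trans ?_
  · have := Nat.mul_le_mul_right (16 * (f.length + 1)) (show genBody.size ≤ 50 by decide)
    omega
  rw [show (recoveryAlgorithm construct).gen = .seq setup₀ (.seq (.gen (loc 2))
    (.seq genBody.compile (pack 10 11))) from rfl, loss_seq]
  refine runs_setup₀ hO (upper_mul_self 1) hr ht (args := []) (by simp) _ _ _ _ fun s hs => ?_
  rw [loss_seq, ← mul_one (X.gen.toOuterMeasure _)]
  refine loss_gen_le _ (fun z hz hgood => ?_) fun z hz => loss_le_one _ _ _ _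
  obtain ⟨g, hg⟩ := X.exists_coord_of_mem_support_gen γ hz
  have hgS : sampleField g ∈ S := by
    obtain ⟨g', hg', hS⟩ := not_not.1 hgood
    rw [hg, Option.some_inj] at hg'
    rwa [hg']
  have hs := hs.update hg 2
  rw [loss_seq]
  refine le_antisymm (runs_compile hO genBody hs _ _ _ _ fun s' hs' => ?_) zero_le
  refine runs_pack hlen hs' (by decide) _ _ _ _ fun s'' hs'' => ?_
  have hS : ∃ x ∈ S, (X.field γ).decode (s'' 0) = some x := by
    obtain ⟨t, u, h0, h1, h2⟩ := hs''
    refine ⟨_, hgS, ?_⟩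
    rw [h0]
    have f0 : initStore ([f, r, st] ++ []) 0 = f := rfl
    obtain ⟨e11, e10⟩ := eval_genBody (1 + bitsValue f)
      (Function.update (state₀ (upper 1) (lower 1)) 2 g) (by simp [state₀]) rfl
    rw [f0] at h1 h2
    rw [e11] at h2
    rw [e10] at h1
    simp only [state₀, Function.update_self, Function.update_of_ne, ne_eq, Fin.reduceEq,
      not_false_eq_true] at h1 h2
    simp only [zetaElt_sample he] at h1 h2
    exact Encryption.field_decode_append h1 h2 (represents_complete he _)
  simp [loss, run, PMF.toOuterMeasure_pure_apply, hS]

theorem nearlyUniform_genProg {f r st : List Bool}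
    (he : ∀ z : SL(2, F), z.val 0 0 + z.val 1 1 ≠ 0 →
      z ^ (1 + bitsValue f) * z ^ (1 + bitsValue f) = z)
    (hr : X.coord γ r = some (upper 1)) (ht : X.coord γ st = some (lower 1))
    (construct : Prog) {T : ℕ} (hT : 2000 * (f.length + X.len + 1) ≤ T) :
    HaltsWithin X.toOracle (recoveryAlgorithm construct).gen [f, r, st] T ∧
    (X.field γ).NearlyUniform X.bias
      ((exec X.toOracle (recoveryAlgorithm construct).gen [f, r, st] T).map fun c => c.2 0) := by
  have hloss := fun S => loss_genProg_le he hr ht S construct hT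
  -- With `S` the whole field nothing is lost, which gives termination and validity of the output.
  have h0 := forall_mem_support_of_loss_eq_zero (le_antisymm ((hloss Set.univ).trans (by
    rw [nonpos_iff_eq_zero, PMF.toOuterMeasure_apply_eq_zero_iff, Set.disjoint_left]
    intro z hz hn
    obtain ⟨g, hg⟩ := X.exists_coord_of_mem_support_gen γ hz
    exact hn ⟨g, hg, trivial⟩)) zero_le)
  refine ⟨fun c hc => (h0 c hc).1, ?_, ?_⟩
  · intro x hx
    obtain ⟨c, hc, rfl⟩ := (PMF.mem_support_map_iff _ _ _).1 hx
    obtain ⟨x, -, hx⟩ := (h0 c hc).2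
    exact ⟨x, hx⟩
  set μ := (exec X.toOracle (recoveryAlgorithm construct).gen [f, r, st] T).map fun c => c.2 0
  set A : Set F → Set (List Bool) := fun S => {x | ∃ g ∈ S, (X.field γ).decode x = some g}
  -- A lower bound for every `S` suffices: the probabilities of `S` and `Sᶜ` add up to at most one,
  -- so the bound for `Sᶜ` is an upper bound for `S`.
  have lower : ∀ S : Set F, (S.ncard : ℝ) / Nat.card F - X.bias ≤ (μ.toOuterMeasure (A S)).toReal := by
    intro S
    have h1 : X.gen.toOuterMeasure {z | ∃ g, X.coord γ z = some g ∧ sampleField g ∈ S} ≤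
        μ.toOuterMeasure (A S) := by
      refine ENNReal.le_of_add_le_add_right (ne_top_of_le_ne_top ENNReal.one_ne_top
        (toOuterMeasure_le_one _ _)) ?_ (a := X.gen.toOuterMeasure
          {z | ∃ g, X.coord γ z = some g ∧ sampleField g ∈ S}ᶜ)
      rw [toOuterMeasure_add_compl, ← toOuterMeasure_add_compl μ (A S)]
      refine add_le_add le_rfl (le_trans ?_ (hloss S))
      simp only [μ, PMF.toOuterMeasure_map_apply, loss]
      exact MeasureTheory.OuterMeasure.mono _ fun c hc hc' => hc hc'.2
    have h2 := (abs_le.1 (X.gen_spec.2 (γ '' (sampleField ⁻¹' S)))).1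
    rw [ncard_image_div_card] at h2
    have h3 := ENNReal.toReal_mono (ne_top_of_le_ne_top ENNReal.one_ne_top
      (toOuterMeasure_le_one _ _)) h1
    have h4 : {x | ∃ g ∈ γ '' (sampleField ⁻¹' S), X.decode x = some g} =
        {z | ∃ g, X.coord γ z = some g ∧ sampleField g ∈ S} := by
      ext z
      constructor
      · rintro ⟨_, ⟨g, hg, rfl⟩, hz⟩
        exact ⟨g, Encryption.coord_eq_some.2 hz, hg⟩
      · rintro ⟨g, hz, hg⟩
        exact ⟨_, ⟨g, hg, rfl⟩, Encryption.coord_eq_some.1 hz⟩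
    rw [h4] at h2
    linarith
  intro S
  have hsum : (μ.toOuterMeasure (A S)).toReal + (μ.toOuterMeasure (A Sᶜ)).toReal ≤ 1 := by
    have ne : ∀ B, μ.toOuterMeasure B ≠ ⊤ := fun B =>
      ne_top_of_le_ne_top ENNReal.one_ne_top (toOuterMeasure_le_one _ _)
    rw [← ENNReal.toReal_add (ne _) (ne _), ← ENNReal.toReal_one,
      ← toOuterMeasure_add_compl μ (A S)]
    refine ENNReal.toReal_mono (ENNReal.add_ne_top.2 ⟨ne _, ne _⟩) ?_
    refine add_le_add le_rfl (MeasureTheory.OuterMeasure.mono _ ?_)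
    rintro x ⟨g, hg, hx⟩ ⟨g', hg', hx'⟩
    rw [hx, Option.some_inj] at hx'
    exact hg (hx' ▸ hg')
  have l1 := lower S
  have l2 := lower Sᶜ
  have hcard : (S.ncard : ℝ) / Nat.card F + (Sᶜ.ncard : ℝ) / Nat.card F = 1 := by
    rw [← add_div, ← Nat.cast_add, Set.ncard_add_ncard_compl]
    exact div_self (by exact_mod_cast Nat.card_pos.ne')
  exact abs_le.2 ⟨by linarith, by linarith⟩

end

/-! ### Effects of the programs for the field operations and the isomorphism -/

section

variable {H : Type} [Group H] (e : ℕ) (ρ t : H)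

open Classical in
theorem eval_addBody {b u b' u' : H} :
    addBody.eval e (state₂ ρ t b u b' u') 11 = u * u' ∧
    addBody.eval e (state₂ ρ t b u b' u') 10 = if u * u' = 1 then 1
      else betaElt e ρ t (u * u') := by
  obtain ⟨c1, c2⟩ := eval_completeProg e (GroupProg.eval e (.mul 3 5 11) (state₂ ρ t b u b' u'))
  simp only [addBody, GroupProg.eval] at *
  rw [c1, c2]
  simp [state₂, state₁, state₀]

theorem eval_mulBody_of_eq_one {b u b' u' : H} (h : u = 1 ∨ u' = 1) :
    mulBody.eval e (state₂ ρ t b u b' u') 11 = 1 ∧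
    mulBody.eval e (state₂ ρ t b u b' u') 10 = 1 := by
  by_cases hu : u = 1
  · simp [mulBody, zeroBody, GroupProg.block, GroupProg.eval, state₂, state₁, state₀, hu]
  · have hu' := h.resolve_left hu
    simp [mulBody, zeroBody, GroupProg.block, GroupProg.eval, state₂, state₁, state₀, hu, hu']

theorem eval_mulBody {b u b' u' : H} (hu : u ≠ 1) (hu' : u' ≠ 1) :
    mulBody.eval e (state₂ ρ t b u b' u') 11 = b'⁻¹ * u * b' ∧
    mulBody.eval e (state₂ ρ t b u b' u') 10 = b * b' := by
  simp [mulBody, GroupProg.block, GroupProg.eval, state₂, state₁, state₀, hu, hu']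

theorem eval_invBody {b u : H} :
    invBody.eval e (state₁ ρ t b u) 11 = b * ρ * b⁻¹ ∧
    invBody.eval e (state₁ ρ t b u) 10 = b⁻¹ := by
  simp [invBody, GroupProg.block, GroupProg.eval, state₁, state₀]

theorem eval_morphismBody_of_eq_one {b u b' u' b'' u'' b₃ u₃ : H} (h : u'' = 1) :
    morphismBody.eval e (state₄ ρ t b u b' u' b'' u'' b₃ u₃) 10 =
      (b₃ * (u * u' * ρ) * b₃⁻¹) * (ρ * t * ρ * u₃ * (ρ * t * ρ)) * (b₃ * u₃ * ρ * b₃⁻¹) * t := by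
  simp [morphismBody, GroupProg.block, GroupProg.eval, state₄, state₂, state₁, state₀, h]

theorem eval_morphismBody {b u b' u' b'' u'' b₃ u₃ : H} (h : u'' ≠ 1) :
    morphismBody.eval e (state₄ ρ t b u b' u' b'' u'' b₃ u₃) 10 =
      (b'' * (u * ρ) * b''⁻¹) * (ρ * t * ρ * u'' * (ρ * t * ρ)) * (b'' * u₃ * ρ * b''⁻¹) := by
  simp [morphismBody, GroupProg.block, GroupProg.eval, state₄, state₂, state₁, state₀, h]

end

/-! ### Correctness of the recovered field and isomorphism -/

section

variable {F : Type} [Field F] [CharP F 2]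

theorem eq_product_of_ne {g b : SL(2, F)} (hg : g.val 1 0 ≠ 0) (hb : Represents b (g.val 1 0)) :
    b * (upper (g.val 0 0) * upper 1) * b⁻¹ *
      (upper 1 * lower 1 * upper 1 * upper (g.val 1 0) * (upper 1 * lower 1 * upper 1)) *
      (b * upper (g.val 1 1) * upper 1 * b⁻¹) = g := by
  rw [mul_assoc b (upper _) (upper 1), upper_mul, upper_mul, mul_upper_mul_inv hb.1,
    mul_upper_mul_inv hb.1, hb.sq_eq hg]
  exact (congrArg (fun x => _ * x * _) (weyl_mul_upper_mul_weyl _)).trans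
    (upper_mul_lower_mul_upper hg)

/-- The lower left entry of `g * lower 1` is `g₁₁ ≠ 0`, so the factorisation of the big cell
applies, with divisions by `g₁₁`. -/
theorem eq_product_of_eq {g b : SL(2, F)} (hg : g.val 1 0 = 0) (hb : Represents b (g.val 1 1)) :
    b * (upper (g.val 0 0) * upper (g.val 0 1) * upper 1) * b⁻¹ *
      (upper 1 * lower 1 * upper 1 * upper (g.val 1 1) * (upper 1 * lower 1 * upper 1)) *
      (b * upper (g.val 1 1) * upper 1 * b⁻¹) * lower 1 = g := by
  have hd := sl_det g
  rw [hg, mul_zero, sub_zero] at hd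
  have h11 := right_ne_zero_of_mul_eq_one hd
  rw [mul_assoc b (upper _) (upper 1), upper_mul, upper_mul, upper_mul, mul_upper_mul_inv hb.1,
    mul_upper_mul_inv hb.1, hb.sq_eq h11]
  have h00 : (g * lower 1).val 0 0 = g.val 0 0 + g.val 0 1 := by
    simp only [sl_mul_apply, lower_00, lower_10]; ring
  have h10 : (g * lower 1).val 1 0 = g.val 1 1 := by
    simp only [sl_mul_apply, lower_00, lower_10, hg]; ring
  have h11' : (g * lower 1).val 1 1 = g.val 1 1 := by
    simp only [sl_mul_apply, lower_01, lower_11, hg]; ring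
  have key := upper_mul_lower_mul_upper (g := g * lower 1) (by rwa [h10])
  rw [h00, h10, h11'] at key
  have hw := weyl_mul_upper_mul_weyl (g.val 1 1)
  simp only [weyl] at hw
  rw [hw, key, mul_assoc, lower_mul_self, mul_one]

variable [Finite F] {G : Type} [Group G] {X : BlackBoxGroup G} {γ : SL(2, F) ≃* G}

/-- Everything is checked in the coordinates `γ`, in which `ρ` and its partner are standard; `γ`
itself is the isomorphism encrypted by the morphism program. -/
theorem recoveryAlgorithm_recovers {f r st : List Bool}
    (he : ∀ z : SL(2, F), z.val 0 0 + z.val 1 1 ≠ 0 →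
      z ^ (1 + bitsValue f) * z ^ (1 + bitsValue f) = z)
    (hr : X.decode r = some (γ (upper 1))) (ht : X.decode st = some (γ (lower 1)))
    (construct : Prog) {T : ℕ} (hT : 2000 * (f.length + X.len + 1) ≤ T) :
    (recoveryAlgorithm construct).Recovers F X (γ (upper 1)) [f, r, st] T := by
  classical
  replace hr := Encryption.coord_eq_some.2 hr
  replace ht := Encryption.coord_eq_some.2 ht
  have hO := X.faithful γ
  have hlen : ∀ x g, X.coord γ x = some g → x.length = X.len :=
    fun x g h => Encryption.coord_length h
  have hrlen := hlen _ _ hr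
  have hρ := upper_mul_self (1 : F)
  have hsize : ∀ P : GroupProg, P.size ≤ 50 →
      P.size * (16 * (f.length + 1)) ≤ 50 * (16 * (f.length + 1)) :=
    fun P hP => Nat.mul_le_mul_right _ hP
  have hgen := nearlyUniform_genProg he hr ht construct hT
  have op : ∀ {setup : Prog} {s : Store} {T₀ : ℕ} {σ : Reg → SL(2, F)} (P : GroupProg) {i j : Reg}
      {x : F}, Runs X.toOracle setup s T₀ (fun s' => ∃ fr, fr 0 = f ∧ Rel (X.coord γ) fr s' σ) →
      T₀ ≤ 44 * r.length + 85 → P.size ≤ 50 → i ≠ j →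
      (∀ t u, X.coord γ t = some (P.eval (1 + bitsValue f) σ i) →
        X.coord γ u = some (P.eval (1 + bitsValue f) σ j) → (X.field γ).decode (t ++ u) = some x) →
      Runs X.toOracle (fieldOp setup P i j) s T fun s' => (X.field γ).decode (s' 0) = some x := by
    intro setup s T₀ σ P i j x hs hT₀ hP hij hpost
    have := hsize P hP
    exact (runs_fieldOp hO hlen hs P hij (post := fun z => (X.field γ).decode z = some x)
      hpost).mono (by omega) fun _ => id
  refine ⟨X.field γ, ⟨?_, ?_, ?_, ?_, ?_, ?_, ?_, hgen.1, hgen.2⟩,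
    isInterpretedInBorel_field X.toEncryption γ, γ, ?_⟩
  · refine Runs.computes (op .skip ((runs_setup₀ hO hρ hr ht (args := [])
      (by simp)).mono le_rfl fun _ h => ⟨_, rfl, h⟩) (by omega) (by decide) (by decide) ?_)
    intro t u h1 h2
    refine Encryption.field_decode_append h1 (h2.trans ?_) represents_one_zero
    simp [GroupProg.eval, state₀, upper_zero]
  · refine Runs.computes (op .skip ((runs_setup₀ hO hρ hr ht (args := [])
      (by simp)).mono le_rfl fun _ h => ⟨_, rfl, h⟩) (by omega) (by decide) (by decide) ?_)
    intro t u h1 h2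
    refine Encryption.field_decode_append h1 (h2.trans ?_) represents_one_one
    simp [GroupProg.eval, state₀]
  · intro x y a b hx hy
    obtain ⟨t, u, g, rfl, hx1, hx2, hg⟩ := Encryption.field_decode.1 hx
    obtain ⟨t', u', g', rfl, hy1, hy2, hg'⟩ := Encryption.field_decode.1 hy
    refine Runs.computes (op addBody ((runs_setup₂ hO hρ hr ht
      ((hlen _ _ hx1).trans hrlen.symm) hx1 hx2 ((hlen _ _ hy1).trans hrlen.symm) hy1 hy2 (args := [])
      (by simp)).mono le_rfl fun _ h => ⟨_, rfl, h⟩) (by omega) (by decide) (by decide) ?_)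
    intro t u h1 h2
    obtain ⟨e1, e2⟩ := eval_addBody (1 + bitsValue f) (upper 1) (lower 1) (b := g) (u := upper a)
      (b' := g') (u' := upper b)
    rw [upper_mul] at e1 e2
    exact Encryption.field_decode_append (h1.trans (congrArg some e2)) (h2.trans (congrArg some e1))
      (by convert represents_complete he (a + b))
  · intro x a hx
    obtain ⟨t, u, g, rfl, hx1, hx2, hg⟩ := Encryption.field_decode.1 hx
    refine Runs.computes (op .skip ((runs_setup₁ hO hρ hr ht
      ((hlen _ _ hx1).trans hrlen.symm) hx1 hx2 (args := [])
      (by simp)).mono le_rfl fun _ h => ⟨_, rfl, h⟩) (by omega) (by decide) (by decide) ?_)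
    intro t u h1 h2
    rw [CharTwo.neg_eq]
    exact Encryption.field_decode_append h1 h2 hg
  · intro x y a b hx hy
    obtain ⟨t, u, g, rfl, hx1, hx2, hg⟩ := Encryption.field_decode.1 hx
    obtain ⟨t', u', g', rfl, hy1, hy2, hg'⟩ := Encryption.field_decode.1 hy
    refine Runs.computes (op mulBody ((runs_setup₂ hO hρ hr ht
      ((hlen _ _ hx1).trans hrlen.symm) hx1 hx2 ((hlen _ _ hy1).trans hrlen.symm) hy1 hy2 (args := [])
      (by simp)).mono le_rfl fun _ h => ⟨_, rfl, h⟩) (by omega) (by decide) (by decide) ?_)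
    intro t u h1 h2
    by_cases hab : a = 0 ∨ b = 0
    · obtain ⟨e1, e2⟩ := eval_mulBody_of_eq_one (1 + bitsValue f) (upper 1) (lower 1) (b := g)
        (u := upper a) (b' := g') (u' := upper b) (by simpa [upper_eq_one_iff] using hab)
      rw [mul_eq_zero.2 hab]
      exact Encryption.field_decode_append (h1.trans (congrArg some e2))
        (h2.trans (congrArg some (e1.trans upper_zero.symm))) represents_one_zero
    · obtain ⟨ha, hb⟩ := not_or.1 hab
      obtain ⟨e1, e2⟩ := eval_mulBody (1 + bitsValue f) (upper 1) (lower 1) (b := g)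
        (u := upper a) (b' := g') (u' := upper b) (by rwa [Ne, upper_eq_one_iff])
        (by rwa [Ne, upper_eq_one_iff])
      rw [inv_mul_upper_mul hg'.1, hg'.sq_eq hb] at e1
      exact Encryption.field_decode_append (h1.trans (congrArg some e2))
        (h2.trans (congrArg some e1)) (hg.mul hg' ha hb)
  · intro x a hx ha
    obtain ⟨t, u, g, rfl, hx1, hx2, hg⟩ := Encryption.field_decode.1 hx
    refine Runs.computes (op invBody ((runs_setup₁ hO hρ hr ht
      ((hlen _ _ hx1).trans hrlen.symm) hx1 hx2 (args := [])
      (by simp)).mono le_rfl fun _ h => ⟨_, rfl, h⟩) (by omega) (by decide) (by decide) ?_)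
    intro t u h1 h2
    obtain ⟨e1, e2⟩ := eval_invBody (1 + bitsValue f) (upper 1) (lower 1) (b := g) (u := upper a)
    rw [mul_upper_mul_inv hg.1, hg.sq_eq ha, one_div] at e1
    exact Encryption.field_decode_append (h1.trans (congrArg some e2))
      (h2.trans (congrArg some e1)) (hg.inv ha)
  · intro x y a b hx hy
    obtain ⟨t, u, g, rfl, hx1, hx2, hg⟩ := Encryption.field_decode.1 hx
    obtain ⟨t', u', g', rfl, hy1, hy2, hg'⟩ := Encryption.field_decode.1 hy
    refine Runs.computes ((Runs.seq (T₂ := 1) (runs_setup₂ hO hρ hr ht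
      ((hlen _ _ hx1).trans hrlen.symm) hx1 hx2 ((hlen _ _ hy1).trans hrlen.symm) hy1 hy2 (args := [])
      (by simp)) fun s hs => Runs.eq ?_).mono (by omega) fun _ => id)
    have h3 : X.coord γ (s (loc 3)) = some (upper a) := (hs.reg 3).trans (by simp [state₂, state₁])
    have h5 : X.coord γ (s (loc 5)) = some (upper b) := (hs.reg 5).trans (by simp [state₂])
    have key := hO.eq _ _ _ _ h3 h5
    rw [upper_injective.eq_iff] at key
    rw [Function.update_self]
    cases h : X.eq (s (loc 3)) (s (loc 5))
    · exact Or.inr ⟨rfl, fun hab => by rw [key.2 hab] at h; cases h⟩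
    · exact Or.inl ⟨rfl, key.1 h⟩
  · intro g x₁₁ x₁₂ x₂₁ x₂₂ hx hy hz hw
    obtain ⟨t, u, b, rfl, hx1, hx2, -⟩ := Encryption.field_decode.1 hx
    obtain ⟨t', u', b', rfl, hy1, hy2, -⟩ := Encryption.field_decode.1 hy
    obtain ⟨t'', u'', b'', rfl, hz1, hz2, hb''⟩ := Encryption.field_decode.1 hz
    obtain ⟨t₃, u₃, b₃, rfl, hw1, hw2, hb₃⟩ := Encryption.field_decode.1 hw
    have := Nat.mul_le_mul_right (16 * (f.length + 1)) (show morphismBody.size ≤ 80 by decide)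
    refine Runs.computes ((Runs.seq (T₂ := 1 + morphismBody.size * (16 * (f.length + 1)) + 1)
      (runs_setup₄ hO hρ hr ht
      ((hlen _ _ hx1).trans hrlen.symm) hx1 hx2 ((hlen _ _ hy1).trans hrlen.symm) hy1 hy2
      ((hlen _ _ hz1).trans hrlen.symm) hz1 hz2 ((hlen _ _ hw1).trans hrlen.symm) hw1 hw2) ?_).mono
      (by omega) fun _ => id)
    rintro s ⟨fr, rfl, hs⟩
    refine Runs.seq (runs_compile hO morphismBody hs) fun s' hs' => Runs.mul fun z hz => ?_
    rw [Function.update_self, ← Encryption.coord_eq_some]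
    have h10 := hO.mul _ _ _ _ (hs'.reg 10) hs'.one z hz
    rw [h10, mul_one]
    congr 1
    by_cases hc : g.val 1 0 = 0
    · rw [eval_morphismBody_of_eq_one _ _ _ (by rw [hc, upper_zero])]
      exact eq_product_of_eq hc hb₃
    · rw [eval_morphismBody _ _ _ (by rwa [Ne, upper_eq_one_iff])]
      exact eq_product_of_ne hc hb''

end

/-! ### The search for a partner -/

def scaleProg : GroupProg :=
  .seq (betaProg 3 4 6) (.seq (.mul 3 6 2) (.seq zetaProg (.seq (.mul 0 11 7)
    (.seq (betaProg 3 7 8) (.seq (.mul 0 4 7) (.seq (betaProg 3 7 9)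
      (.block [.inv 8 8, .mul 8 9 8, .inv 8 9, .mul 9 3 9, .mul 9 8 5])))))))

def candidateProg : GroupProg :=
  .seq zetaProg (.seq (.block [.inv 2 10, .mul 10 0 3, .mul 3 2 3, .mul 11 15 4])
    (.ifeq 4 15 (.mul 3 15 5) (.ifeq 4 0 (.mul 3 15 5) scaleProg)))

/-- A candidate is a conjugate of `ρ`, so `t * t = 1` need not be tested. Register `1` is
overwritten only by verified partners, so success is never undone. -/
def checkProg : GroupProg :=
  .ifeq 5 0 .skip (.seq (.block [.mul 0 5 12, .mul 12 12 13, .mul 13 12 13])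
    (.ifeq 13 15 (.mul 5 15 1) .skip))

def trialBody : GroupProg := .seq candidateProg checkProg

/-- Test whether a random element yields a partner of `ρ`, to be kept in `1`. -/
def trial : Prog := .seq (.gen (loc 2)) trialBody.compile

/-- Five is the least number of trials for which `(17/20)^5 ≤ 1/2`. -/
def trials : Prog := .seq trial (.seq trial (.seq trial (.seq trial trial)))

/-- Register `12` is a flag, cleared at the first digit `1`. That digit is dropped as well, so the
digits of `m` remain, where `E = 2^a (2m + 1)`. -/
def stripLoop : Prog := .loop (.top 12) (.seq (.ite (.top 0) (.pop 12) .skip) (.pop 0))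

def searchLoop : Prog := .loop (.nonempty 2) (.seq (.pop 2) trials)

def constructProg : Prog :=
  .seq (.push 12 true) (.seq stripLoop (.seq initProg (.seq (.mul 1 7 (loc 0))
    (.seq searchLoop (.seq (moveAll (loc 1) 8) (moveAll 8 2))))))

/-! ### Effects of the group programs -/

section

variable {H : Type} [Group H] (e : ℕ) (σ : Reg → H)

theorem eval_betaProg (t v out : Reg) (ht : t ≠ 13) (hv : v ≠ 13) :
    (betaProg t v out).eval e σ out = betaElt e (σ 0) (σ t) (σ v) ∧
    ∀ i, i ≠ 13 → i ≠ 14 → i ≠ out → (betaProg t v out).eval e σ i = σ i := by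
  constructor
  · simp [betaProg, GroupProg.block, GroupProg.eval, betaElt, ht, hv]
  · intro i h1 h2 h3
    simp [betaProg, GroupProg.block, GroupProg.eval, h1, h2, h3]

theorem eval_scaleProg :
    scaleProg.eval e σ 5 = (scaleElt e (σ 0) (σ 3) (σ 4))⁻¹ * σ 3 * scaleElt e (σ 0) (σ 3) (σ 4) ∧
    ∀ i, i = 0 ∨ i = 1 ∨ i = 15 → scaleProg.eval e σ i = σ i := by
  simp only [scaleProg, GroupProg.eval]
  obtain ⟨a1, a2⟩ := eval_betaProg e σ 3 4 6 (by decide) (by decide)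
  generalize (betaProg 3 4 6).eval e σ = τ at *
  obtain ⟨b1, b2⟩ := eval_zetaProg e (Function.update τ 2 (τ 3 * τ 6))
  generalize zetaProg.eval e (Function.update τ 2 (τ 3 * τ 6)) = τ₂ at *
  obtain ⟨c1, c2⟩ := eval_betaProg e (Function.update τ₂ 7 (τ₂ 0 * τ₂ 11)) 3 7 8
    (by decide) (by decide)
  generalize (betaProg 3 7 8).eval e (Function.update τ₂ 7 (τ₂ 0 * τ₂ 11)) = τ₃ at *
  obtain ⟨d1, d2⟩ := eval_betaProg e (Function.update τ₃ 7 (τ₃ 0 * τ₃ 4)) 3 7 9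
    (by decide) (by decide)
  generalize (betaProg 3 7 9).eval e (Function.update τ₃ 7 (τ₃ 0 * τ₃ 4)) = τ₄ at *
  have g0 : τ₃ 0 = σ 0 := by simp [c2, b2, a2]
  have g3 : τ₃ 3 = σ 3 := by simp [c2, b2, a2]
  have g4 : τ₃ 4 = σ 4 := by simp [c2, b2, a2]
  have g8 : τ₄ 8 = betaElt e (σ 0) (σ 3) (σ 0 * zetaElt e (σ 0) (σ 3 * betaElt e (σ 0) (σ 3) (σ 4))) := by
    simp [d2, c1, b2, a2, b1, a1]
  have g9 : τ₄ 9 = betaElt e (σ 0) (σ 3) (σ 0 * σ 4) := by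
    simp [d1, g0, g3, g4]
  have h3 : τ₄ 3 = σ 3 := by simp [d2, g3]
  constructor
  · simp [GroupProg.block, GroupProg.eval, h3, g8, g9, scaleElt]
  · rintro i (rfl | rfl | rfl) <;> simp [GroupProg.block, GroupProg.eval, d2, c2, b2, a2]

theorem eval_candidateProg (h15 : σ 15 = 1) :
    candidateProg.eval e σ 5 = candidate e (σ 0) (σ 2) ∧
    ∀ i, i = 0 ∨ i = 1 ∨ i = 15 → candidateProg.eval e σ i = σ i := by
  obtain ⟨z1, z2⟩ := eval_zetaProg e σ
  obtain ⟨τ, hτ, t0, t1, t15, t3, t4⟩ : ∃ τ : Reg → H, candidateProg.eval e σ =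
      GroupProg.eval e (.ifeq 4 15 (.mul 3 15 5) (.ifeq 4 0 (.mul 3 15 5) scaleProg)) τ ∧
      τ 0 = σ 0 ∧ τ 1 = σ 1 ∧ τ 15 = 1 ∧ τ 3 = (σ 2)⁻¹ * σ 0 * σ 2 ∧
      τ 4 = zetaElt e (σ 0) (σ 2) := by
    refine ⟨_, rfl, ?_⟩
    simp [GroupProg.block, GroupProg.eval, z1, z2, h15]
  obtain ⟨s1, s2⟩ := eval_scaleProg e τ
  have hkeep : ∀ i, i = 0 ∨ i = 1 ∨ i = 15 → τ i = σ i := by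
    rintro i (rfl | rfl | rfl)
    exacts [t0, t1, t15.trans h15.symm]
  rw [t0, t3, t4] at s1
  rw [hτ]
  simp only [GroupProg.eval, candidate]
  have hcopy : ∀ x : H, ∀ i, i = 0 ∨ i = 1 ∨ i = 15 → Function.update τ 5 x i = σ i := by
    intro x i hi
    rw [Function.update_of_ne (by rcases hi with rfl | rfl | rfl <;> decide), hkeep i hi]
  by_cases h1 : zetaElt e (σ 0) (σ 2) = 1
  · rw [if_pos (show τ 4 = τ 15 by rw [t4, t15, h1]), if_pos (Or.inl h1), t3, t15]
    exact ⟨by simp, hcopy _⟩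
  rw [if_neg (show ¬ τ 4 = τ 15 by rw [t4, t15]; exact h1)]
  by_cases h2 : zetaElt e (σ 0) (σ 2) = σ 0
  · rw [if_pos (show τ 4 = τ 0 by rw [t4, t0, h2]), if_pos (Or.inr h2), t3, t15]
    exact ⟨by simp, hcopy _⟩
  · rw [if_neg (show ¬ τ 4 = τ 0 by rw [t4, t0]; exact h2), if_neg (not_or.2 ⟨h1, h2⟩)]
    exact ⟨s1, fun i hi => (s2 i hi).trans (hkeep i hi)⟩

theorem eval_trialBody (hσ : σ 0 * σ 0 = 1) (h15 : σ 15 = 1) :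
    trialBody.eval e σ 0 = σ 0 ∧ trialBody.eval e σ 15 = 1 ∧
    (IsPartner (σ 0) (candidate e (σ 0) (σ 2)) ∧
      trialBody.eval e σ 1 = candidate e (σ 0) (σ 2) ∨
    ¬ IsPartner (σ 0) (candidate e (σ 0) (σ 2)) ∧ trialBody.eval e σ 1 = σ 1) := by
  obtain ⟨c1, c2⟩ := eval_candidateProg e σ h15
  have c0 := c2 0 (by decide)
  have c11 := c2 1 (by decide)
  have c15 := (c2 15 (by decide)).trans h15
  have hsq : candidate e (σ 0) (σ 2) * candidate e (σ 0) (σ 2) = 1 := by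
    have key : ∀ x y : H, x * x = 1 → (y⁻¹ * x * y) * (y⁻¹ * x * y) = 1 := by
      intro x y hx
      calc _ = y⁻¹ * (x * x) * y := by group
        _ = 1 := by rw [hx]; group
    unfold candidate
    split_ifs
    · exact key _ _ hσ
    · exact key _ _ (key _ _ hσ)
  simp only [trialBody, GroupProg.eval]
  generalize candidateProg.eval e σ = τ at *
  rw [← c1] at hsq ⊢
  rw [← c0, ← c11]
  simp only [IsPartner, hsq, true_and, checkProg, GroupProg.eval]
  by_cases h1 : τ 5 = τ 0
  · simp [h1, c15]
  · by_cases h2 : τ 0 * τ 5 * (τ 0 * τ 5) * (τ 0 * τ 5) = 1 <;>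
      simp [h1, h2, GroupProg.block, GroupProg.eval, c15]

end

/-! ### Stripping the even part of the exponent -/

def stripZeros : List Bool → List Bool
  | [] => []
  | true :: l => l
  | false :: l => stripZeros l

theorem bitsValue_cons (b : Bool) (l : List Bool) :
    bitsValue (b :: l) = b.toNat + 2 * bitsValue l := by
  cases b <;> simp [bitsValue, Nat.bit]; ring

theorem bitsValue_bits (n : ℕ) : bitsValue (Nat.bits n) = n := by
  induction n using Nat.binaryRec' with
  | zero => simp [bitsValue]
  | bit b n h ih =>
    rw [Nat.bits_append_bit n b h]
    simp only [bitsValue, List.foldr] at *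
    rw [ih]

theorem stripZeros_spec (l : List Bool) (hl : bitsValue l ≠ 0) :
    (stripZeros l).length ≤ l.length ∧
      ∃ a, bitsValue l = 2 ^ a * (2 * bitsValue (stripZeros l) + 1) := by
  induction l with
  | nil => simp [bitsValue] at hl
  | cons b l ih =>
    rw [bitsValue_cons] at hl ⊢
    cases b
    · obtain ⟨h1, a, h2⟩ := ih (by simpa using hl)
      refine ⟨by simpa [stripZeros] using h1.trans (Nat.le_succ _), a + 1, ?_⟩
      rw [h2, stripZeros, pow_succ]
      simp
      ring
    · exact ⟨by simp [stripZeros], 0, by simp [stripZeros, add_comm]⟩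

theorem runs_stripLoop {O : Oracle} (l : List Bool) (hl : bitsValue l ≠ 0) {s : Store}
    (h0 : s 0 = l) (h12 : s 12 = [true]) {post : Store → Prop}
    (hp : post (Function.update (Function.update s 0 (stripZeros l)) 12 [])) :
    Runs O stripLoop s (5 * l.length + 1) post := by
  induction l generalizing s with
  | nil => simp [bitsValue] at hl
  | cons b l ih =>
    cases b
    · refine (Runs.loop_of_true (T₁ := 4) (T₂ := 5 * l.length + 1)
        (mid := fun s' => s' = Function.update s 0 l) (by simp [Test.eval, h12])
        (Runs.seq (T₁ := 2) (T₂ := 1) (mid := fun s' => s' = s) (Runs.ite (T := 1) (fun h => ?_)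
          (fun _ => Runs.skip rfl)) ?_) ?_).mono (by simp; omega) fun _ => id
      · simp [Test.eval, h0] at h
      · rintro _ rfl
        exact Runs.pop (by rw [h0, List.tail_cons])
      · rintro _ rfl
        exact ih (by simpa [bitsValue_cons] using hl) (by simp) (by simpa using h12)
          (by simpa [stripZeros] using hp)
    · refine (Runs.loop_of_true (T₁ := 4) (T₂ := 1)
        (mid := fun s' => s' = Function.update (Function.update s 12 []) 0 l)
        (by simp [Test.eval, h12])
        (Runs.seq (T₁ := 2) (T₂ := 1) (mid := fun s' => s' = Function.update s 12 [])
          (Runs.ite (T := 1) (fun _ => Runs.pop (by rw [h12, List.tail_cons])) (fun h => ?_)) ?_)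
        ?_).mono (by simp) fun _ => id
      · simp [Test.eval, h0] at h
      · rintro _ rfl
        exact Runs.pop (by rw [Function.update_of_ne (by norm_num), h0, List.tail_cons])
      · rintro _ rfl
        refine Runs.loop_of_false (by simp [Test.eval]) ?_
        rw [Function.update_comm (by norm_num)]
        exact hp

/-! ### The failure probability of the search -/

open Classical in
/-- The bound `y`, or `0` if `t` is already as desired. -/
noncomputable def failBound {H : Type} (Found : H → Prop) (t : H) (y : ℝ≥0∞) : ℝ≥0∞ :=
  if Found t then 0 else y

theorem failBound_of_found {H : Type} {Found : H → Prop} {t : H} (h : Found t) (y : ℝ≥0∞) :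
    failBound Found t y = 0 := if_pos h

theorem failBound_of_not_found {H : Type} {Found : H → Prop} {t : H} (h : ¬ Found t) (y : ℝ≥0∞) :
    failBound Found t y = y := if_neg h

theorem failBound_le {H : Type} (Found : H → Prop) (t : H) (y : ℝ≥0∞) :
    failBound Found t y ≤ y := by
  unfold failBound; split_ifs <;> simp

theorem failBound_mono {H : Type} (Found : H → Prop) (t : H) {y y' : ℝ≥0∞} (h : y ≤ y') :
    failBound Found t y ≤ failBound Found t y' := by
  unfold failBound; split_ifs <;> simp [h]

/-- The program `P` runs for `T` steps, preserves `ρ` in the register `0` and `1` in the register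
`15`, and reduces by the factor `c` the probability that the content of the register `1`
does not satisfy `Found`. -/
def Improves {H : Type} [Group H] (O : Oracle) (dec : List Bool → Option H) (fr : ℕ → List Bool)
    (ρ : H) (Found : H → Prop) (P : Prog) (T : ℕ) (c : ℝ≥0∞) : Prop :=
  ∀ (k : List Prog) (N : ℕ) (S : Store → Prop) (y : ℝ≥0∞),
    (∀ s σ, Rel dec fr s σ → σ 0 = ρ → σ 15 = 1 → loss O N (k, s) S ≤ failBound Found (σ 1) y) →
    ∀ s σ, Rel dec fr s σ → σ 0 = ρ → σ 15 = 1 →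
      loss O (T + N) (P :: k, s) S ≤ failBound Found (σ 1) (c * y)

section

variable {H : Type} [Group H] {O : Oracle} {dec : List Bool → Option H} {fr : ℕ → List Bool}
  {ρ : H} {Found : H → Prop}

theorem Improves.seq {P Q : Prog} {T₁ T₂ : ℕ} {c₁ c₂ : ℝ≥0∞}
    (h₁ : Improves O dec fr ρ Found P T₁ c₁) (h₂ : Improves O dec fr ρ Found Q T₂ c₂) :
    Improves O dec fr ρ Found (.seq P Q) (1 + T₁ + T₂) (c₁ * c₂) := by
  intro k N S y hy s σ hs h0 h15
  rw [show 1 + T₁ + T₂ + N = 1 + (T₁ + (T₂ + N)) by ring, loss_seq, mul_assoc]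
  exact h₁ _ _ _ _ (h₂ _ _ _ _ hy) s σ hs h0 h15

theorem Improves.mono {P : Prog} {T : ℕ} {c c' : ℝ≥0∞} (h : Improves O dec fr ρ Found P T c)
    (hc : c ≤ c') : Improves O dec fr ρ Found P T c' := fun k N S y hy s σ hs h0 h15 =>
  (h k N S y hy s σ hs h0 h15).trans (failBound_mono _ _ (mul_le_mul_left hc _))

theorem Rel.update_frame {s : Store} {σ : Reg → H} (h : Rel dec fr s σ) {a : ℕ} (ha : a < 7)
    (x : List Bool) : Rel dec (Function.update fr a x) (Function.update s a x) σ where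
  frame b hb := by
    rcases eq_or_ne b a with rfl | hba
    · simp
    · simp [hba, h.frame b hb]
  one := by rw [Function.update_of_ne (by omega), h.one]
  tmp₁ := by rw [Function.update_of_ne (by omega), h.tmp₁]
  tmp₂ := by rw [Function.update_of_ne (by omega), h.tmp₂]
  reg i := by rw [Function.update_of_ne (loc_ne (by omega)), h.reg i]

/-- Each bit of the unary counter halves the bound; the three extra steps per round are the test,
the sequencing and the removal of that bit. -/
theorem loss_searchLoop_le {T : ℕ}
    (h : ∀ x, Improves O dec (Function.update fr 2 x) ρ Found trials T 2⁻¹) (j : ℕ)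
    {k : List Prog} {N : ℕ} {S : Store → Prop} {y : ℝ≥0∞}
    (hy : ∀ s σ, Rel dec (Function.update fr 2 []) s σ → σ 0 = ρ → σ 15 = 1 →
      loss O N (k, s) S ≤ failBound Found (σ 1) y)
    {s : Store} {σ : Reg → H} (hs : Rel dec (Function.update fr 2 (List.replicate j true)) s σ)
    (h0 : σ 0 = ρ) (h15 : σ 15 = 1) :
    loss O (j * (3 + T) + 1 + N) (searchLoop :: k, s) S ≤
      failBound Found (σ 1) (2⁻¹ ^ j * y) := by
  induction j generalizing s σ with
  | zero =>
    have h2 : s 2 = [] := by simpa using hs.frame 2 (by norm_num)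
    rw [show 0 * (3 + T) + 1 + N = N + 1 by ring, loss_succ_of_step_eq_pure (c' := (k, s))
      (by simp [searchLoop, step, Test.eval, h2]), pow_zero, one_mul]
    exact hy s σ hs h0 h15
  | succ j ih =>
    have h2 : s 2 = true :: List.replicate j true := by
      rw [hs.frame 2 (by norm_num), Function.update_self, List.replicate_succ]
    rw [show (j + 1) * (3 + T) + 1 + N = (1 + (T + (j * (3 + T) + 1 + N)) + 1) + 1 by ring,
      loss_succ_of_step_eq_pure (c' := (.seq (.pop 2) trials :: searchLoop :: k, s))
      (by simp [searchLoop, step, Test.eval, h2]), add_comm _ 1, loss_seq, add_comm 1,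
      loss_succ_of_step_eq_pure (c' := (trials :: searchLoop :: k,
        Function.update s 2 (List.replicate j true))) (by simp [step, h2]),
      pow_succ', mul_assoc]
    refine h _ _ _ _ _ (fun s σ hs h0 h15 => ih hs h0 h15) _ _ ?_ h0 h15
    have := hs.update_frame (a := 2) (by norm_num) (List.replicate j true)
    rwa [Function.update_idem] at this

end

theorem two_inv_bound : (17 / 20 : ℝ≥0∞) * (17 / 20 * (17 / 20 * (17 / 20 * (17 / 20)))) ≤ 2⁻¹ := by
  have h : (17 / 20 : ℝ≥0∞) ≠ ⊤ := ENNReal.div_ne_top (by norm_num) (by norm_num)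
  refine (ENNReal.toReal_le_toReal (by finiteness) (by simp)).1 ?_
  simp only [ENNReal.toReal_mul, ENNReal.toReal_div, ENNReal.toReal_ofNat, ENNReal.toReal_inv]
  norm_num

section

variable {F : Type} [Field F] [CharP F 2] [Finite F] {G : Type} [Group G] {X : BlackBoxGroup G}
  {γ : SL(2, F) ≃* G} {fr : ℕ → List Bool} {Found : SL(2, F) → Prop}

/-- `17/20` is `3/5`, the proportion of bad elements, plus `1/4`, the bias. -/
theorem toOuterMeasure_badSet_le :
    X.gen.toOuterMeasure {z | ∃ g ∈ badSet F, X.coord γ z = some g} ≤ 17 / 20 := by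
  have h : (17 / 20 : ℝ≥0∞) ≠ ⊤ := ENNReal.div_ne_top (by norm_num) (by norm_num)
  refine (ENNReal.toReal_le_toReal (ne_top_of_le_ne_top ENNReal.one_ne_top
    (toOuterMeasure_le_one _ _)) h).1 ?_
  have h1 := (abs_le.1 (X.gen_spec.2 (γ '' badSet F))).2
  have h2 : {x | ∃ g ∈ γ '' badSet F, X.decode x = some g} =
      {z | ∃ g ∈ badSet F, X.coord γ z = some g} := by
    ext z
    simp [Encryption.coord_eq_some]
  rw [h2, Set.ncard_image_of_injective _ γ.injective, ← Nat.card_congr γ.toEquiv] at h1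
  have h3 : (0 : ℝ) < Nat.card SL(2, F) := by exact_mod_cast Nat.card_pos
  have h4 : (5 * (badSet F).ncard : ℝ) ≤ 3 * Nat.card SL(2, F) := by exact_mod_cast ncard_badSet_le
  have h5 : ((badSet F).ncard : ℝ) / Nat.card SL(2, F) ≤ 3 / 5 := by
    rw [div_le_iff₀ h3]; linarith
  have h6 := X.bias_le
  simp only [ENNReal.toReal_div, ENNReal.toReal_ofNat]
  linarith

/-- Once `Found` holds, register `1` is kept or replaced by a partner, so nothing can be lost.
Otherwise only bad random elements contribute. -/
theorem improves_trial (he : ∀ z : SL(2, F), z.val 0 0 + z.val 1 1 ≠ 0 →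
      z ^ (1 + bitsValue (fr 0)) * z ^ (1 + bitsValue (fr 0)) = z)
    (hF : ∀ t, IsPartner (upper 1) t → Found t) :
    Improves X.toOracle (X.coord γ) fr (upper 1) Found trial
      (2 + trialBody.size * (16 * ((fr 0).length + 1))) (17 / 20) := by
  intro k N S y hy s σ hs h0 h15
  have hO := X.faithful γ
  set B := trialBody.size * (16 * ((fr 0).length + 1))
  have hbody : ∀ z g, X.coord γ z = some g →
      loss X.toOracle (B + N) (trialBody.compile :: k, Function.update s (loc 2) z) S ≤
        failBound Found (trialBody.eval (1 + bitsValue (fr 0)) (Function.update σ 2 g) 1) y ∧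
      (IsPartner (upper 1) (candidate (1 + bitsValue (fr 0)) (upper 1) g) ∨ Found (σ 1) →
        Found (trialBody.eval (1 + bitsValue (fr 0)) (Function.update σ 2 g) 1)) := by
    intro z g hz
    obtain ⟨e0, e15, e1⟩ := eval_trialBody (1 + bitsValue (fr 0)) (Function.update σ 2 g)
      (by simpa [h0] using upper_mul_self (1 : F)) (by simpa using h15)
    have u0 : Function.update σ 2 g 0 = upper 1 := by simp [h0]
    have u1 : Function.update σ 2 g 1 = σ 1 := by simp
    rw [u0, Function.update_self, u1] at e1
    refine ⟨?_, ?_⟩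
    · refine runs_compile hO trialBody (hs.update hz 2) _ _ _ _ fun s' hs' => ?_
      exact hy _ _ hs' (by rw [e0, u0]) e15
    · intro h
      rcases e1 with ⟨p, e1⟩ | ⟨p, e1⟩
      · rw [e1]; exact hF _ p
      · rw [e1]; exact h.resolve_left p
  rw [show 2 + B + N = 1 + (1 + (B + N)) by ring, trial, loss_seq]
  by_cases hf : Found (σ 1)
  · rw [failBound_of_found hf]
    refine (loss_gen_le Set.univ (fun z _ hz => absurd trivial hz) fun z hz => ?_).trans_eq
      (mul_zero _)
    obtain ⟨g, hg⟩ := X.exists_coord_of_mem_support_gen γ hz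
    refine (hbody z g hg).1.trans_eq (failBound_of_found ((hbody z g hg).2 (Or.inr hf)) _)
  · rw [failBound_of_not_found hf]
    refine (loss_gen_le _ (fun z hz hgood => ?_) fun z hz => ?_).trans
      (mul_le_mul_left (toOuterMeasure_badSet_le (γ := γ)) _)
    · obtain ⟨g, hg⟩ := X.exists_coord_of_mem_support_gen γ hz
      refine le_antisymm ((hbody z g hg).1.trans_eq (failBound_of_found
        ((hbody z g hg).2 (Or.inl (isPartner_candidate he fun hb => hgood ⟨g, hb, hg⟩))) _)) zero_le
    · obtain ⟨g, hg⟩ := X.exists_coord_of_mem_support_gen γ hz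
      exact (hbody z g hg).1.trans (failBound_le _ _ _)

theorem improves_trials (he : ∀ z : SL(2, F), z.val 0 0 + z.val 1 1 ≠ 0 →
      z ^ (1 + bitsValue (fr 0)) * z ^ (1 + bitsValue (fr 0)) = z)
    (hF : ∀ t, IsPartner (upper 1) t → Found t) :
    Improves X.toOracle (X.coord γ) fr (upper 1) Found trials
      (9000 * ((fr 0).length + 1)) 2⁻¹ := by
  have h := improves_trial (X := X) (γ := γ) he hF
  have h5 := (h.seq (h.seq (h.seq (h.seq h)))).mono two_inv_bound
  intro k N S y hy s σ hs h0 h15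
  refine (loss_anti _ (Nat.add_le_add_right ?_ N) _ _).trans (h5 k N S y hy s σ hs h0 h15)
  have := Nat.mul_le_mul_right (16 * ((fr 0).length + 1)) (show trialBody.size ≤ 110 by decide)
  omega

/-- `Found` is left open for two uses: `IsPartner` gives the success probability, and the predicate
that is always true makes the bound zero, that is, certain termination. -/
theorem loss_constructProg_le {E : ℕ} (hE : E ≠ 0) {r : List Bool} (k : ℕ)
    (he : ∀ z : SL(2, F), z.val 0 0 + z.val 1 1 ≠ 0 →
      z ^ (1 + bitsValue (stripZeros (Nat.bits E))) * z ^ (1 + bitsValue (stripZeros (Nat.bits E)))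
        = z)
    (hr : X.coord γ r = some (upper 1)) (hF : ∀ t, IsPartner (upper 1) t → Found t) {T : ℕ}
    (hT : 10000 * ((Nat.bits E).length + X.len + k + 1) ^ 2 ≤ T) :
    loss X.toOracle T ([constructProg], initStore (constructInput E r k))
      (fun s => s 0 = stripZeros (Nat.bits E) ∧ s 1 = r ∧ ∃ t, X.coord γ (s 2) = some t ∧ Found t)
      ≤ failBound Found 1 (2⁻¹ ^ k) := by
  have hO := X.faithful γ
  have hlen : ∀ x g, X.coord γ x = some g → x.length = X.len :=
    fun x g h => Encryption.coord_length h
  have hE' : bitsValue (Nat.bits E) ≠ 0 := by rwa [bitsValue_bits]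
  have hL := (stripZeros_spec _ hE').1
  set L := Nat.bits E
  set f := stripZeros L
  refine (loss_anti _ (N := 1 + (1 + (1 + ((5 * L.length + 1) + (1 + (35 + (1 + (1 + (1 +
    (k * (3 + 9000 * (f.length + 1)) + 1 + ((1 + (5 * X.len + 1) + (5 * X.len + 1)) + 0)))))))))))
    ?_ _ _).trans ?_
  · nlinarith
  rw [constructProg, loss_seq]
  refine Runs.push (post := fun s => s 0 = L ∧ s 1 = r ∧ s 2 = List.replicate k true ∧
    s 8 = [] ∧ s 9 = [] ∧ s 12 = [true]) ⟨rfl, rfl, rfl, rfl, rfl, rfl⟩ _ _ _ _ ?_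
  rintro s ⟨g0, g1, g2, g8, g9, g12⟩
  rw [loss_seq]
  refine runs_stripLoop L hE' g0 g12 (post := fun s => s 0 = f ∧ s 1 = r ∧
    s 2 = List.replicate k true ∧ s 8 = [] ∧ s 9 = []) (by simp [*, f]) _ _ _ _ ?_
  rintro s₀ ⟨g0, g1, g2, g8, g9⟩
  rw [loss_seq]
  refine runs_initProg hO (upper_mul_self 1) (s := s₀) (by rw [g1, hr]) g8 g9 _ _ _ _
    fun s hs => ?_
  rw [loss_seq]
  refine runs_load hO hs (a := 1) (by norm_num) (by rw [g1, hr]) 0 _ _ _ _ fun s hs => ?_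
  rw [loss_seq]
  have hs₀ : Function.update s₀ 2 (List.replicate k true) = s₀ :=
    Function.update_eq_self_iff.2 g2.symm
  have himp : ∀ x, Improves X.toOracle (X.coord γ) (Function.update s₀ 2 x) (upper 1) Found trials
      (9000 * (f.length + 1)) 2⁻¹ := by
    intro x
    have hx : Function.update s₀ 2 x 0 = f := by simpa using g0
    have := improves_trials (X := X) (γ := γ) (fr := Function.update s₀ 2 x) (by rwa [hx]) hF
    rwa [hx] at this
  have key := loss_searchLoop_le (O := X.toOracle) (T := 9000 * (f.length + 1)) (fr := s₀) (ρ := upper 1) (Found := Found)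
    himp k
    (N := 1 + (5 * X.len + 1) + (5 * X.len + 1) + 0) (y := 1) 
    (k := [.seq (moveAll (loc 1) 8) (moveAll 8 2)])
    (S := fun s => s 0 = f ∧ s 1 = r ∧ ∃ t, X.coord γ (s 2) = some t ∧ Found t) ?_
    (s := s) (σ := Function.update (fun _ => 1) 0 (upper 1)) (by rwa [hs₀]) (by simp) (by simp)
  · simpa using key
  intro s σ hs h0 h15
  by_cases hf : Found (σ 1)
  swap
  · rw [failBound_of_not_found hf]
    exact loss_le_one _ _ _ _
  rw [failBound_of_found hf]
  have h1 := hlen _ _ (hs.reg 1)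
  refine (Runs.seq (T₁ := 5 * X.len + 1) (T₂ := 5 * X.len + 1)
    ((runs_moveAll (by decide) (s (loc 1)) rfl rfl).mono (by rw [h1]) fun _ => id) ?_ :
    Runs X.toOracle _ s _ fun s => s 0 = f ∧ s 1 = r ∧ ∃ t, X.coord γ (s 2) = some t ∧ Found t)
    _ _ _ _ ?_
  · rintro _ rfl
    refine (runs_moveAll (by decide) (s (loc 1)).reverse (by simp [hs.tmp₁, loc]) ?_).mono
      (by rw [List.length_reverse, h1]) fun _ => id
    have f0 : s 0 = f := by rw [hs.frame 0 (by norm_num)]; simpa using g0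
    have f1 : s 1 = r := by rw [hs.frame 1 (by norm_num)]; simpa using g1
    have f2 : s 2 = [] := by rw [hs.frame 2 (by norm_num)]; simp
    have fr := hs.reg 1
    refine ⟨?_, ?_, σ 1, ?_, hf⟩ <;> simp_all [loc]
  · intro s' hs'
    simp [loss, run, PMF.toOuterMeasure_pure_apply, hs']

end

/-! ### Polynomial bounds and conclusion -/

theorem eval_mono (p : Polynomial ℕ) {a b : ℕ} (h : a ≤ b) : p.eval a ≤ p.eval b := by
  rw [Polynomial.eval_eq_sum_range, Polynomial.eval_eq_sum_range]
  exact Finset.sum_le_sum fun i _ => Nat.mul_le_mul_left _ (Nat.pow_le_pow_left h i)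

theorem length_bits_le (n : ℕ) : (Nat.bits n).length ≤ Nat.log 2 n + 1 := by
  rw [Nat.size_eq_bits_len, Nat.size_le]
  exact Nat.lt_pow_succ_log_self (by norm_num) n

section

variable {F : Type} [Field F] [CharP F 2] {G : Type} [Group G] (X : BlackBoxGroup G)

/-- Half the exponent without its even part, rounded up, is an exponent extracting square roots. -/
theorem BlackBoxGroup.pow_stripZeros_exponent (γ : SL(2, F) ≃* G) (z : SL(2, F)) (hz : z.val 0 0 + z.val 1 1 ≠ 0) :
    z ^ (1 + bitsValue (stripZeros (Nat.bits X.exponent))) *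
      z ^ (1 + bitsValue (stripZeros (Nat.bits X.exponent))) = z := by
  obtain ⟨-, a, ha⟩ := stripZeros_spec (Nat.bits X.exponent)
    (by rw [bitsValue_bits]; exact X.exponent_pos.ne')
  rw [bitsValue_bits] at ha
  refine pow_mul_pow_self (a := a) (fun z => ?_) z hz
  rw [← ha]
  exact γ.injective (by rw [map_pow, map_one, X.pow_exponent])

theorem one_sub_le_toOuterMeasure_output [Finite F] (γ : SL(2, F) ≃* G) {r : List Bool}
    (hr : X.decode r = some (γ (upper 1)))
    (k : ℕ) {T T' : ℕ} (hT : 10000 * ((Nat.bits X.exponent).length + X.len + k + 1) ^ 2 ≤ T)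
    (hT' : 2000 * ((Nat.bits X.exponent).length + X.len + 1) ≤ T') :
    1 - 2⁻¹ ^ k ≤ ((recoveryAlgorithm constructProg).output X.toOracle
      (constructInput X.exponent r k) T).toOuterMeasure
      {d | (recoveryAlgorithm constructProg).Recovers F X (γ (upper 1)) d T'} := by
  have he := X.pow_stripZeros_exponent γ
  have hr' : X.coord γ r = some (upper 1) := Encryption.coord_eq_some.2 hr
  have h := (loss_constructProg_le (Found := IsPartner (upper 1)) X.exponent_pos.ne' k he hr'
    (fun _ => id) hT).trans (failBound_le _ _ _)
  rw [tsub_le_iff_right]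
  refine le_trans ?_ (add_le_add le_rfl h)
  rw [RecoveryAlgorithm.output, PMF.toOuterMeasure_map_apply, loss,
    ← toOuterMeasure_add_compl (exec X.toOracle (recoveryAlgorithm constructProg).construct
      (constructInput X.exponent r k) T)]
  refine add_le_add le_rfl (MeasureTheory.OuterMeasure.mono _ fun c hc hgood => hc ?_)
  obtain ⟨-, h0, h1, t, h2, ht⟩ := hgood
  -- The coordinates are adapted to the partner that was found; `ρ` stays standard in them.
  obtain ⟨γ', hγ, hγ'⟩ := IsPartner.exists_equiv γ ((isPartner_map γ).2 ht)
  have hd : (List.range (recoveryAlgorithm constructProg).arity).map c.2 =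
      [stripZeros (Nat.bits X.exponent), r, c.2 2] := by
    rw [← h0, ← h1]; rfl
  change RecoveryAlgorithm.Recovers _ F X _ (List.map c.2 _) T'
  rw [hd, ← hγ]
  refine recoveryAlgorithm_recovers he (by rw [hr, hγ]) ?_ _ (le_trans ?_ hT')
  · rw [Encryption.coord_eq_some.1 h2, hγ']
  · have := (stripZeros_spec (Nat.bits X.exponent)
      (by rw [bitsValue_bits]; exact X.exponent_pos.ne')).1
    omega

end

end BlackBox

theorem mainTheorem4 :
    ∃ A : BlackBox.RecoveryAlgorithm, ∀ Q : Polynomial ℕ, ∃ p : Polynomial ℕ,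
      ∀ (n : ℕ), 1 ≤ n → ∀ X : BlackBox.BlackBoxGroup SL(2, GaloisField 2 n), X.PolyBounded Q →
        ∀ (r : List Bool) (ρ : SL(2, GaloisField 2 n)), X.decode r = some ρ → orderOf ρ = 2 →
          ∀ k : ℕ,
            BlackBox.HaltsWithin X.toOracle A.construct
              (BlackBox.constructInput X.exponent r k) (p.eval (X.len + k)) ∧
            1 - (2⁻¹ : ℝ≥0∞) ^ k ≤
              (A.output X.toOracle (BlackBox.constructInput X.exponent r k)
                (p.eval (X.len + k))).toOuterMeasure
                {d | A.Recovers (GaloisField 2 n) X ρ d (p.eval X.len)} := by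
  -- The exponent has at most `Q(l) + 1` digits, so `Q + X + 2` at `l + k` bounds digits plus `l + k
  -- + 1`. The square accounts for `k` rounds, each linear in the number of digits.
  refine ⟨BlackBox.recoveryAlgorithm BlackBox.constructProg, fun Q =>
    ⟨Polynomial.C 10000 * (Q + Polynomial.X + Polynomial.C 2) ^ 2, ?_⟩⟩
  intro n hn X hX r ρ hr hρ k
  obtain ⟨γ, rfl⟩ := BlackBox.exists_equiv_of_orderOf_eq_two hρ
  have hL := BlackBox.length_bits_le X.exponent
  have hQ := hX.2
  have hQk := BlackBox.eval_mono Q (Nat.le_add_right X.len k)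
  have hT : 10000 * ((Nat.bits X.exponent).length + X.len + k + 1) ^ 2 ≤
      (Polynomial.C 10000 * (Q + Polynomial.X + Polynomial.C 2) ^ 2).eval (X.len + k) := by
    simp only [Polynomial.eval_mul, Polynomial.eval_pow, Polynomial.eval_add, Polynomial.eval_C,
      Polynomial.eval_X]
    exact Nat.mul_le_mul_left _ (Nat.pow_le_pow_left (by omega) 2)
  have hT' : 2000 * ((Nat.bits X.exponent).length + X.len + 1) ≤
      (Polynomial.C 10000 * (Q + Polynomial.X + Polynomial.C 2) ^ 2).eval X.len := by
    simp only [Polynomial.eval_mul, Polynomial.eval_pow, Polynomial.eval_add, Polynomial.eval_C,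
      Polynomial.eval_X]
    refine Nat.mul_le_mul (by norm_num) (le_trans (by omega) (Nat.le_self_pow (by norm_num) _))
  refine ⟨fun c hc => ?_, BlackBox.one_sub_le_toOuterMeasure_output X γ hr k hT hT'⟩
  have h := BlackBox.loss_constructProg_le (Found := fun _ => True) X.exponent_pos.ne' k
    (X.pow_stripZeros_exponent γ) (BlackBox.Encryption.coord_eq_some.2 hr) (fun _ _ => trivial) hT
  rw [BlackBox.failBound_of_found trivial] at h
  exact (BlackBox.forall_mem_support_of_loss_eq_zero (le_antisymm h zero_le) c hc).1
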